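/- Let $\mathbb F$ be a field. A line of a point-line geometry is regarded as a set of points; points and lines of $\mathrm{PG}(V)$ are the 1- and 2-dimensional subspaces of $V$, and $\langle X\rangle$ is the subspace of $V$ spanned by a set $X$ of points of $\mathrm{PG}(V)$. A *projective embedding* of a geometry in $\mathrm{PG}(V)$ is an injective map $\varepsilon$ from its points to the points of $\mathrm{PG}(V)$, whose image spans $V$, mapping every line $l$ onto the set of all points of a line $L$ of $\mathrm{PG}(V)$, with $\varepsilon(l)$ being the set of all image points on $L$. Let $\Gamma=(\mathcal P,\mathcal L)\cong W(3,\mathbb F)$, the generalized quadrangle of the points and totally isotropic lines of a non-degenerate alternating form of $\mathbb F^4$. For $p\in\mathcal P$ let $L(p)$ be the set of lines of $\Gamma$ through $p$, and let $\Gamma^*$ be the dual of $\Gamma$, with point set $\mathcal L$ and lines $L(p)$, $p\in\mathcal P$. Let $\dim V=5$, let $\chi$ be a quadratic form of Witt index 2 on $V$ which is non-singular (no non-zero singular vector lies in the radical of its bilinearization), and let $\varepsilon$ be a projective embedding of $\Gamma^*$ in $\mathrm{PG}(V)$ whose image is $Q(\chi)$, the geometry of the $\chi$-singular points and totally $\chi$-singular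 lines. The *Grassmann embedding* $\varepsilon^{\rm gr}$ of $\Gamma$ maps $p\in\mathcal P$ to the point $\langle x\wedge y\rangle$ of $\mathrm{PG}(V\wedge V)$, where $\langle x,y\rangle$ is the line $\varepsilon(L(p))$ of $\mathrm{PG}(V)$. Let $\dim V_0=4$, let $(e_i)_{1\le i\le 4}$ be a basis of $V_0$ and $(e_{i,j})_{1\le i\le j\le 4}$ a basis of the symmetrized tensor square $V_0^{\otimes}=(V_0\otimes V_0)/\langle x\otimes y-y\otimes x\rangle_{x,y\in V_0}$. Put $\eta(\sum_i x_ie_i)=\sum_{i\le j}x_ix_je_{i,j}$. By a *symplectic embedding* of $\Gamma$ we mean a projective embedding $\varepsilon_0$ of $\Gamma$ in $\mathrm{PG}(V_0)$ whose image is the geometry $Q(\alpha)$ of the points and totally isotropic lines of some non-degenerate alternating form $\alpha$ on $V_0$. The *veronesean embedding* $\varepsilon_0^{\rm ver}$ of $\Gamma$ maps $p$ to the point $\langle\eta(x)\rangle$ of $\mathrm{PG}(V_0^\otimes)$, where $\varepsilon_0(p)=\langle x\rangle$. A *projection* of $\varepsilon_0^{\rm ver}$ onto $\varepsilon^{\rm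 gr}$ is a semilinear map (with respect to an automorphism of $\mathbb F$) $\pi:\langle\varepsilon_0^{\rm ver}(\mathcal P)\rangle\to\langle\varepsilon^{\rm gr}(\mathcal P)\rangle$ with $\pi(\varepsilon_0^{\rm ver}(p))=\varepsilon^{\rm gr}(p)$ for all $p\in\mathcal P$. A set $S$ of points of a projective space is a *non-singular quadric* (a non-singular conic if $\dim\langle S\rangle=3$) if it is the set of singular points of a non-singular quadratic form $q$ on $\langle S\rangle$; in characteristic 2, the radical of the bilinearization of $q$ is then called the *nucleus* of $S$. **Proposition.** There exist a symplectic embedding $\varepsilon_0$ of $\Gamma$ in $\mathrm{PG}(V_0)$ and a linear projection of $\varepsilon_0^{\rm ver}$ onto $\varepsilon^{\rm gr}$. Moreover, let $\varepsilon_0$ be any symplectic embedding of $\Gamma$ in $\mathrm{PG}(V_0)$ and let $\pi$ be any projection of $\varepsilon_0^{\rm ver}$ onto $\varepsilon^{\rm gr}$. 1. If $\mathrm{char}\,\mathbb F\ne2$, then $\pi$ is an isomorphism (it is bijective). 2. If $\mathrm{char}\,\mathbb F=2$, then $\mathrm{Ker}(\pi)$ is 1-dimensional; moreover the set $\mathcal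 N$ of the nuclei of the conics $\varepsilon_0^{\rm ver}(l)$, $l\in\mathcal L$, is a non-singular quadric of $\langle\mathcal N\rangle$, and $\mathrm{Ker}(\pi)$ is its nucleus $n(\mathcal N)$. -/

import Mathlib

open scoped TensorProduct

noncomputable section

namespace GrassmannVeronese

/-! Points of `PG(V)` are the 1-dimensional subspaces of `V`, lines of `PG(V)` are the
2-dimensional ones. For a set `X` of points of `PG(V)`, the subspace `⟨X⟩` of `V` is `sSup X`. -/

/-- A point-line geometry with point set `P`; the lines are sets of points. -/
structure PointLineGeometry (P : Type*) where
  lines : Set (Set P)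

/-- The dual geometry: its points are the lines of `Γ`, its lines are the sets `L(p)` of all
lines of `Γ` through a point `p`. -/
def PointLineGeometry.dual {P : Type*} (Γ : PointLineGeometry P) :
    PointLineGeometry Γ.lines where
  lines := Set.range fun p : P => {l : Γ.lines | p ∈ l.1}

section Embeddings

variable {F : Type*} [Field F] {V : Type*} [AddCommGroup V] [Module F V] {P : Type*}

/-- The points of `PG(V)` lying on the subspace `U`. -/
def projPoints (U : Submodule F V) : Set (Submodule F V) :=
  {x | Module.finrank F x = 1 ∧ x ≤ U}

/-- Locally `d`-dimensional embeddings of `Γ` in `PG(V)`. -/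
structure IsEmbedding (Γ : PointLineGeometry P) (d : ℕ) (ε : P → Submodule F V) : Prop where
  isPoint : ∀ p, Module.finrank F (ε p) = 1
  injective : Function.Injective ε
  finrank_line : ∀ l ∈ Γ.lines, Module.finrank F (sSup (ε '' l) : Submodule F V) = d + 1
  inter_line : ∀ l ∈ Γ.lines, projPoints (sSup (ε '' l)) ∩ Set.range ε = ε '' l
  span_eq_top : sSup (Set.range ε) = ⊤

/-- Projective embeddings: full locally 1-dimensional embeddings. -/
structure IsProjectiveEmbedding (Γ : PointLineGeometry P) (ε : P → Submodule F V) : Prop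
    extends IsEmbedding Γ 1 ε where
  full : ∀ l ∈ Γ.lines, ε '' l = projPoints (sSup (ε '' l))

/-- `ε(Γ)` is the geometry whose points are the points `pts` of `PG(V)` and whose lines are the
lines `lns` of `PG(V)`. -/
def HasImage (Γ : PointLineGeometry P) (ε : P → Submodule F V)
    (pts lns : Set (Submodule F V)) : Prop :=
  Set.range ε = pts ∧ (fun l : Set P => ε '' l) '' Γ.lines = projPoints '' lns

/-- A morphism from `ε₁` to `ε₂`: a semilinear map from `⟨ε₁(P)⟩` to `⟨ε₂(P)⟩` mapping the
1-dimensional subspace `ε₁(p)` onto `ε₂(p)`, for every point `p`. (A surjective endomorphism `σ`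
of a field is an automorphism.) -/
def IsMorphism {V' : Type*} [AddCommGroup V'] [Module F V'] {σ : F →+* F} [RingHomSurjective σ]
    (ε₁ : P → Submodule F V) (ε₂ : P → Submodule F V')
    (f : (sSup (Set.range ε₁) : Submodule F V) →ₛₗ[σ]
      (sSup (Set.range ε₂) : Submodule F V')) : Prop :=
  ∀ p, ((ε₁ p).comap (sSup (Set.range ε₁)).subtype).map f =
    (ε₂ p).comap (sSup (Set.range ε₂)).subtype

end Embeddings

section Quadrangles

variable {F : Type*} [Field F] {V : Type*} [AddCommGroup V] [Module F V] {P : Type*}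

/-- Isotropic points of a bilinear form. -/
def isotropicPoints (α : LinearMap.BilinForm F V) : Set (Submodule F V) :=
  {x | Module.finrank F x = 1 ∧ ∀ u ∈ x, α u u = 0}

/-- Totally isotropic lines of a bilinear form. -/
def isotropicLines (α : LinearMap.BilinForm F V) : Set (Submodule F V) :=
  {U | Module.finrank F U = 2 ∧ ∀ u ∈ U, ∀ v ∈ U, α u v = 0}

/-- `ε` is a projective embedding of `Γ` in `PG(V)` with image `Q(α)`, where `α` is a
non-degenerate alternating form. -/
structure IsSymplecticEmbedding (Γ : PointLineGeometry P) (α : LinearMap.BilinForm F V)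
    (ε : P → Submodule F V) : Prop where
  isAlt : α.IsAlt
  nondegenerate : α.Nondegenerate
  isProjective : IsProjectiveEmbedding Γ ε
  image : HasImage Γ ε (isotropicPoints α) (isotropicLines α)

variable (F) in
/-- `Γ ≅ W(3, F)`. -/
def IsSymplecticQuadrangle (Γ : PointLineGeometry P) : Prop :=
  ∃ (α : LinearMap.BilinForm F (Fin 4 → F)) (e : P → Submodule F (Fin 4 → F)),
    α.IsAlt ∧ α.Nondegenerate ∧ Function.Injective e ∧
      HasImage Γ e (isotropicPoints α) (isotropicLines α)

/-- The subspace `U` is totally singular for `χ`. -/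
def IsTotallySingular (χ : QuadraticForm F V) (U : Submodule F V) : Prop :=
  ∀ u ∈ U, χ u = 0

/-- Singular points of a quadratic form. -/
def singularPoints (χ : QuadraticForm F V) : Set (Submodule F V) :=
  {x | Module.finrank F x = 1 ∧ IsTotallySingular χ x}

/-- Totally singular lines of a quadratic form. -/
def singularLines (χ : QuadraticForm F V) : Set (Submodule F V) :=
  {U | Module.finrank F U = 2 ∧ IsTotallySingular χ U}

/-- `χ` is non-singular: no non-zero singular vector is orthogonal to the whole space with respect
to the bilinearization of `χ`. -/
def IsNonsingular (χ : QuadraticForm F V) : Prop := χ.radical = ⊥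

/-- `χ` has Witt index `m`. -/
def HasWittIndex (χ : QuadraticForm F V) (m : ℕ) : Prop :=
  (∃ U : Submodule F V, IsTotallySingular χ U ∧ Module.finrank F U = m) ∧
    ∀ U : Submodule F V, IsTotallySingular χ U → Module.finrank F U ≤ m

/-- `N` is the nucleus of the non-singular quadric `S`: the set `S` of points of `PG(V)` is the
set of singular points of a non-singular quadratic form `q` of `⟨S⟩`, and `N` is the radical of
the bilinearization of `q`, regarded as a subspace of `V`. For a set `S` spanning a plane, this
is the nucleus of the non-singular conic `S`. -/
def IsNucleus (S : Set (Submodule F V)) (N : Submodule F V) : Prop :=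
  ∃ q : QuadraticForm F (sSup S : Submodule F V),
    IsNonsingular q ∧
    S = Submodule.map (sSup S).subtype '' singularPoints q ∧
    N = (LinearMap.ker q.polarBilin).map (sSup S).subtype

/-- The nuclei of the conics `ε(l)`, for `l` a line of `Γ`. -/
def conicNuclei (Γ : PointLineGeometry P) (ε : P → Submodule F V) : Set (Submodule F V) :=
  {n | ∃ l ∈ Γ.lines, IsNucleus (ε '' l) n}

end Quadrangles

section Veronese

variable {F : Type*} [Field F] {V : Type*} [AddCommGroup V] [Module F V] {P : Type*}

variable (F V) in
/-- The symmetrized tensor square of `V`. -/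
abbrev SymSquare : Type _ :=
  (V ⊗[F] V) ⧸ Submodule.span F {t : V ⊗[F] V | ∃ x y : V, t = x ⊗ₜ[F] y - y ⊗ₜ[F] x}

/-- The quadratic veronesean map relative to a basis `(eᵢ)` of `V` and a basis `(eᵢⱼ)`, `i ≤ j`,
of the symmetrized tensor square: it maps `∑ xᵢ eᵢ` to `∑ xᵢ xⱼ eᵢⱼ`. -/
def veronese {n : ℕ} (E : Module.Basis (Fin n) F V)
    (E' : Module.Basis {ij : Fin n × Fin n // ij.1 ≤ ij.2} F (SymSquare F V)) (x : V) :
    SymSquare F V :=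
  ∑ ij, (E.repr x ij.1.1 * E.repr x ij.1.2) • E' ij

/-- The veronesean embedding induced by `ε`. -/
def veroneseEmbedding {n : ℕ} (E : Module.Basis (Fin n) F V)
    (E' : Module.Basis {ij : Fin n × Fin n // ij.1 ≤ ij.2} F (SymSquare F V))
    (ε : P → Submodule F V) (p : P) : Submodule F (SymSquare F V) :=
  Submodule.span F (veronese E E' '' (ε p : Set V))

end Veronese

section Grassmann

variable {F : Type*} [Field F] {V : Type*} [AddCommGroup V] [Module F V] {P : Type*}

/-- The natural embedding of the line-grassmannian: it maps a line `⟨x, y⟩` of `PG(V)` to the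
point `⟨x ∧ y⟩` of `PG(V ∧ V)`. -/
def lineGrassmann (U : Submodule F V) : Submodule F (⋀[F]^2 V) :=
  Submodule.span F {w | ∃ x ∈ U, ∃ y ∈ U, w = exteriorPower.ιMulti F 2 ![x, y]}

/-- The Grassmann embedding of `Γ` induced by a projective embedding `ε` of the dual of `Γ`: a
point `p` is mapped to the image of the line `ε(L(p))` of `PG(V)` in `PG(V ∧ V)`. -/
def grassmannEmbedding (Γ : PointLineGeometry P) (ε : Γ.lines → Submodule F V) (p : P) :
    Submodule F (⋀[F]^2 V) :=
  lineGrassmann (sSup (ε '' {l : Γ.lines | p ∈ l.1}))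

end Grassmann

end GrassmannVeronese

end

/-! A totally isotropic line of F⁴ has Plücker coordinates with p₀₁ = -p₂₃, and the Plücker relation
then becomes `parabolic v = 0`: the lines of W(3, F) are the points of a parabolic quadric. Dually,
a point ⟨x⟩ becomes a line of the quadric, whose own Plücker coordinates are quadratic in x
(`spinMatrix`). Quadratic maps factor linearly through the veronesean, so there is a linear map
`symToWedge` between the two 10-dimensional spaces. Up to sign it permutes eight coordinates, and it
sends the other two, t₀₁ and t₂₃, to t₀₁ + t₂₃ and t₀₁ - t₂₃. It is injective if 2 ≠ 0 and has a
1-dimensional kernel if 2 = 0. By `exists_hyperbolic_basis` every admissible χ is a multiple of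
`parabolic`, so this applies to the given ε.

For an arbitrary projection π the domain is the whole symmetrized square and the image is ⟨ε^gr(P)⟩.
Rank-nullity for semilinear maps therefore gives Ker(π) the same dimension as the kernel of
`symToWedge`.

In characteristic 2 the kernel has to be located. Let β be the polar form of the veronesean map; it
is alternating. The conic of ⟨x, y⟩ has nucleus ⟨β(x, y)⟩, and on isotropic pairs β(x, y) is a
combination of the five vectors `polarBasis` with the Plücker coordinates as coefficients. So the
nuclei form the quadric `parabolic = 0` of a 5-dimensional space, with nucleus spanned by the last
vector of `polarBasis`.

Let r ≠ 0 lie in the radical of the polar form of χ. A projection maps the conic of a line l onto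
the conic of all ⟨u ∧ w⟩ with ⟨u, w⟩ a line of the quadric through ε(l) = ⟨u⟩, and it must map
nucleus to nucleus, which is ⟨u ∧ r⟩ (`IsProjection.map_polar`). Thus the 5-dimensional span of the
nuclei goes into r ∧ V, of dimension at most 4, and some nonzero c in it is killed. As ⟨u⟩ ↦ ⟨u ∧ r⟩
is injective on singular points, no line through ⟨c⟩ meets the quadric of nuclei twice. Hence c is
orthogonal to every singular vector and spans the nucleus (`IsProjection.ker_eq`). -/

namespace GrassmannVeronese

/-! ### Semilinear rank-nullity; points and lines of projective spaces -/

section Generic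

variable {F : Type*} [Field F] {V : Type*} [AddCommGroup V] [Module F V]

/-- Projections are only semilinear. The additive bijection from V ⧸ Ker f to the range is
compatible with the bijection σ of scalars, which is enough to preserve the rank. -/
theorem finrank_ker_add_finrank_range_semilinear {V' : Type*} [AddCommGroup V'] [Module F V']
    [Module.Finite F V] {σ : F →+* F} [RingHomSurjective σ] (f : V →ₛₗ[σ] V') :
    Module.finrank F (LinearMap.ker f) + Module.finrank F (LinearMap.range f) =
      Module.finrank F V := by
  let g : V ⧸ LinearMap.ker f →ₛₗ[σ] V' := (LinearMap.ker f).liftQ f le_rfl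
  have hg : Function.Injective g := by
    rw [← LinearMap.ker_eq_bot]
    exact Submodule.ker_liftQ_eq_bot _ _ _ le_rfl
  let j : V ⧸ LinearMap.ker f →+ LinearMap.range f :=
    { toFun := fun x => ⟨g x, by
        induction x using Submodule.Quotient.induction_on with
        | _ x => exact ⟨x, rfl⟩⟩
      map_zero' := by ext; simp
      map_add' := fun x y => by ext; simp }
  have hj : Function.Bijective j := by
    refine ⟨fun x y h => hg (congrArg Subtype.val h), ?_⟩
    rintro ⟨_, x, rfl⟩
    exact ⟨Submodule.Quotient.mk x, rfl⟩
  have h := lift_rank_eq_of_equiv_equiv σ (AddEquiv.ofBijective j hj)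
    ⟨σ.injective, RingHomSurjective.is_surjective⟩ (fun r m => by
      ext; exact map_smulₛₗ g r m)
  have h2 : Module.finrank F (V ⧸ LinearMap.ker f) = Module.finrank F (LinearMap.range f) := by
    have := congrArg Cardinal.toNat h
    simpa [Module.finrank] using this
  rw [← h2, add_comm, Submodule.finrank_quotient_add_finrank]

theorem finrank_eq_one_iff_span {U : Submodule F V} :
    Module.finrank F U = 1 ↔ ∃ v, v ≠ 0 ∧ U = Submodule.span F {v} := by
  constructor
  · intro h
    obtain ⟨v, hv, hU⟩ := finrank_eq_one_iff'.1 h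
    refine ⟨v, fun h => hv (Subtype.ext h), le_antisymm (fun w hw => ?_) ?_⟩
    · obtain ⟨c, hc⟩ := hU ⟨w, hw⟩
      exact Submodule.mem_span_singleton.2 ⟨c, congrArg Subtype.val hc⟩
    · simp
  · rintro ⟨v, hv, rfl⟩
    exact finrank_span_singleton hv

theorem span_singleton_mem_projPoints {U : Submodule F V} {v : V} (hv : v ≠ 0) (h : v ∈ U) :
    Submodule.span F {v} ∈ projPoints U :=
  ⟨finrank_span_singleton hv, by simpa using h⟩

theorem mem_projPoints_iff {U x : Submodule F V} :
    x ∈ projPoints U ↔ ∃ v ∈ U, v ≠ 0 ∧ x = Submodule.span F {v} := by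
  constructor
  · rintro ⟨h1, h2⟩
    obtain ⟨v, hv, rfl⟩ := finrank_eq_one_iff_span.1 h1
    exact ⟨v, by simpa using h2, hv, rfl⟩
  · rintro ⟨v, hv, h0, rfl⟩
    exact span_singleton_mem_projPoints h0 hv

theorem sSup_projPoints (U : Submodule F V) : sSup (projPoints U) = U := by
  refine le_antisymm (sSup_le fun x hx => hx.2) fun v hv => ?_
  by_cases h : v = 0
  · simp [h]
  · exact le_sSup (span_singleton_mem_projPoints h hv) (Submodule.mem_span_singleton_self v)

theorem projPoints_injective : Function.Injective (projPoints : Submodule F V → _) :=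
  fun U U' h => by rw [← sSup_projPoints U, h, sSup_projPoints]

theorem finrank_eq_two_iff_span {U : Submodule F V} :
    Module.finrank F U = 2 ↔
      ∃ v w, LinearIndependent F ![v, w] ∧ U = Submodule.span F {v, w} := by
  constructor
  · intro h
    have : Module.Finite F U := Module.finite_of_finrank_pos (by omega)
    let b := Module.finBasisOfFinrankEq F U h
    refine ⟨b 0, b 1, ?_, ?_⟩
    · have h2 : ![(b 0 : V), b 1] = U.subtype ∘ b := by
        ext i; fin_cases i <;> rfl
      rw [h2]
      exact b.linearIndependent.map' U.subtype (by simp)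
    · have := congrArg (Submodule.map U.subtype) b.span_eq
      rw [Submodule.map_span, Submodule.map_subtype_top, ← Set.range_comp] at this
      refine this.symm.trans (congrArg _ ?_)
      ext x
      simp [Fin.exists_fin_two, eq_comm]
  · rintro ⟨v, w, h, rfl⟩
    have h1 := finrank_span_eq_card h
    have h2 : Set.range ![v, w] = {v, w} := by
      ext x
      simp [eq_comm, or_comm]
    rw [h2] at h1
    simpa using h1

end Generic

/-! ### Uniqueness of the nucleus of a quadric -/

section Nucleus

variable {F : Type*} [Field F] {V : Type*} [AddCommGroup V] [Module F V]

theorem eq_zero_iff_of_image_singularPoints {S : Set (Submodule F V)}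
    {q : QuadraticForm F (sSup S : Submodule F V)}
    (h : S = Submodule.map (sSup S).subtype '' singularPoints q)
    {v : (sSup S : Submodule F V)} (hv : v ≠ 0) :
    q v = 0 ↔ Submodule.span F {(v : V)} ∈ S := by
  have key : Submodule.span F {(v : V)} =
      (Submodule.span F {v}).map (sSup S).subtype := by
    rw [Submodule.map_span, Set.image_singleton]; rfl
  have h' : Submodule.map (sSup S).subtype (Submodule.span F {v}) ∈ S ↔
      Submodule.map (sSup S).subtype (Submodule.span F {v}) ∈
        Submodule.map (sSup S).subtype '' singularPoints q := by
    rw [← h]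
  rw [key, h', (Submodule.map_injective_of_injective (sSup S).injective_subtype).mem_set_image]
  constructor
  · intro hq
    refine ⟨finrank_span_singleton hv, fun u hu => ?_⟩
    obtain ⟨c, rfl⟩ := Submodule.mem_span_singleton.1 hu
    rw [QuadraticMap.map_smul, hq, smul_zero]
  · intro hq
    exact hq.2 v (Submodule.mem_span_singleton_self v)

theorem span_singular_eq_top {S : Set (Submodule F V)}
    {q : QuadraticForm F (sSup S : Submodule F V)}
    (h : S = Submodule.map (sSup S).subtype '' singularPoints q) :
    Submodule.span F {v | q v = 0} = ⊤ := by
  apply Submodule.map_injective_of_injective (sSup S).injective_subtype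
  rw [Submodule.map_subtype_top]
  refine le_antisymm (Submodule.map_subtype_le _ _) (sSup_le fun x hx => ?_)
  rw [h] at hx
  obtain ⟨y, hy, rfl⟩ := hx
  exact Submodule.map_mono fun u hu => Submodule.subset_span (hy.2 u hu)

/-- Orthogonality of a singular v to w can be read off the singular points of ⟨v, w⟩: it holds
exactly when this line is totally singular or has no singular point besides ⟨v⟩. -/
theorem polar_ne_zero_of_same_singular {q q' : QuadraticForm F V}
    (h : ∀ v, q v = 0 ↔ q' v = 0) {v w : V} (hv : q v = 0)
    (hp : QuadraticMap.polar q v w ≠ 0) : QuadraticMap.polar q' v w ≠ 0 := by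
  have hv' := (h v).1 hv
  by_cases hw : q w = 0
  · have hw' := (h w).1 hw
    have h1 : q (v + w) ≠ 0 := by
      rw [QuadraticMap.map_add q, hv, hw]; simpa using hp
    have h2 := mt (h _).2 h1
    rw [QuadraticMap.map_add q', hv', hw'] at h2
    simpa using h2
  · have hw' := mt (h w).2 hw
    set t := - QuadraticMap.polar q v w / q w with ht
    have ht0 : t ≠ 0 := div_ne_zero (neg_ne_zero.2 hp) hw
    have h1 : q (v + t • w) = 0 := by
      rw [QuadraticMap.map_add q, hv, QuadraticMap.map_smul, QuadraticMap.polar_smul_right, ht]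
      simp only [smul_eq_mul]; field_simp; ring
    have h2 := (h _).1 h1
    rw [QuadraticMap.map_add q', hv', QuadraticMap.map_smul, QuadraticMap.polar_smul_right] at h2
    intro h3
    rw [h3] at h2
    simp [ht0, hw'] at h2

/-- A quadric spans its space, so the radical of the polar form consists of the vectors orthogonal
to all singular ones. By `polar_ne_zero_of_same_singular` this depends on the point set alone. -/
theorem IsNucleus.unique {S : Set (Submodule F V)} {N N' : Submodule F V}
    (h : IsNucleus S N) (h' : IsNucleus S N') : N = N' := by
  obtain ⟨q, -, hq, rfl⟩ := h
  obtain ⟨q', -, hq', rfl⟩ := h'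
  have hqq : ∀ v, q v = 0 ↔ q' v = 0 := by
    intro v
    by_cases hv : v = 0
    · simp [hv]
    · rw [eq_zero_iff_of_image_singularPoints hq hv, eq_zero_iff_of_image_singularPoints hq' hv]
  have key : ∀ (q q' : QuadraticForm F (sSup S : Submodule F V)),
      S = Submodule.map (sSup S).subtype '' singularPoints q' → (∀ v, q v = 0 ↔ q' v = 0) →
      LinearMap.ker q.polarBilin ≤ LinearMap.ker q'.polarBilin := by
    intro q q' hS h w hw
    rw [LinearMap.mem_ker] at hw ⊢
    refine LinearMap.ext_on_range (v := ((↑) : {v | q' v = 0} → (sSup S : Submodule F V)))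
      (by simpa using span_singular_eq_top hS) ?_
    rintro ⟨v, hv⟩
    have h1 : QuadraticMap.polar q v w = 0 := by
      rw [QuadraticMap.polar_comm, ← QuadraticMap.polarBilin_apply_apply, hw]; rfl
    simp only [QuadraticMap.polarBilin_apply_apply, LinearMap.zero_apply]
    rw [QuadraticMap.polar_comm]
    by_contra h2
    exact polar_ne_zero_of_same_singular (fun v => (h v).symm) hv h2 h1
  rw [le_antisymm (key q q' hq' hqq) (key q' q hq fun v => (hqq v).symm)]

end Nucleus

/-! ### Exterior squares and decomposable bivectors -/

section Wedge

variable {F : Type*} [Field F] {V : Type*} [AddCommGroup V] [Module F V]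

/-- The exterior product `x ∧ y` of two vectors. -/
noncomputable def wedge : V →ₗ[F] V →ₗ[F] ⋀[F]^2 V :=
  LinearMap.mk₂ F (fun x y => exteriorPower.ιMulti F 2 ![x, y])
    (fun x x' y => by
      have := (exteriorPower.ιMulti F 2 (M := V)).map_update_add ![0, y] 0 x x'
      have h : ∀ z, Function.update ![0, y] 0 z = ![z, y] := fun z => by
        ext i; fin_cases i <;> simp
      simpa only [h] using this)
    (fun c x y => by
      have := (exteriorPower.ιMulti F 2 (M := V)).map_update_smul ![0, y] 0 c x
      have h : ∀ z, Function.update ![0, y] 0 z = ![z, y] := fun z => by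
        ext i; fin_cases i <;> simp
      simpa only [h] using this)
    (fun x y y' => by
      have := (exteriorPower.ιMulti F 2 (M := V)).map_update_add ![x, 0] 1 y y'
      have h : ∀ z, Function.update ![x, 0] 1 z = ![x, z] := fun z => by
        ext i; fin_cases i <;> simp
      simpa only [h] using this)
    (fun c x y => by
      have := (exteriorPower.ιMulti F 2 (M := V)).map_update_smul ![x, 0] 1 c y
      have h : ∀ z, Function.update ![x, 0] 1 z = ![x, z] := fun z => by
        ext i; fin_cases i <;> simp
      simpa only [h] using this)

theorem wedge_apply (x y : V) : wedge x y = exteriorPower.ιMulti F 2 ![x, y] := rfl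

@[simp] theorem wedge_self (x : V) : wedge (F := F) x x = 0 :=
  (exteriorPower.ιMulti F 2 (M := V)).map_eq_zero_of_eq ![x, x] (i := 0) (j := 1) rfl (by simp)

theorem wedge_swap (x y : V) : wedge (F := F) y x = - wedge x y := by
  have h := wedge_self (F := F) (x + y)
  simp only [map_add, LinearMap.add_apply, wedge_self, zero_add, add_zero] at h
  exact eq_neg_of_add_eq_zero_left h

/-- The linear functional on `V ∧ V` defined by two linear functionals on `V`. -/
noncomputable def wedgeDual (f g : Module.Dual F V) : Module.Dual F (⋀[F]^2 V) :=
  exteriorPower.alternatingMapToDual F V 2 ![f, g]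

@[simp] theorem wedgeDual_wedge (f g : Module.Dual F V) (x y : V) :
    wedgeDual f g (wedge x y) = f x * g y - g x * f y := by
  simp [wedgeDual, wedge_apply, Matrix.det_fin_two]

theorem mem_span_of_wedge_eq_zero {u w : V} (hu : u ≠ 0) (h : wedge (F := F) u w = 0) :
    w ∈ Submodule.span F {u} := by
  obtain ⟨f, hf⟩ := Module.Projective.exists_dual_eq_one F hu
  refine Submodule.mem_span_singleton.2 ⟨f w, ?_⟩
  rw [← sub_eq_zero, ← Module.forall_dual_apply_eq_zero_iff F]
  intro g
  have := wedgeDual_wedge f g u w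
  rw [h, map_zero, hf] at this
  rw [map_sub, map_smul, smul_eq_mul]
  linear_combination this

theorem lineGrassmann_span_pair (u w : V) :
    lineGrassmann (Submodule.span F {u, w}) = Submodule.span F {wedge u w} := by
  refine le_antisymm (Submodule.span_le.2 ?_) ?_
  · rintro _ ⟨x, hx, y, hy, rfl⟩
    obtain ⟨a, b, rfl⟩ := Submodule.mem_span_pair.1 hx
    obtain ⟨c, d, rfl⟩ := Submodule.mem_span_pair.1 hy
    rw [← wedge_apply]
    refine Submodule.mem_span_singleton.2 ⟨a * d - b * c, ?_⟩
    simp only [map_add, map_smul, LinearMap.add_apply, LinearMap.smul_apply, wedge_self,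
      wedge_swap u w]
    module
  · rw [Submodule.span_singleton_le_iff_mem]
    exact Submodule.subset_span ⟨u, Submodule.subset_span (by simp), w,
      Submodule.subset_span (by simp), rfl⟩

end Wedge

/-! ### Normal form of the quadratic form χ -/

section HyperbolicBasis

variable {F : Type*} [Field F] {V : Type*} [AddCommGroup V] [Module F V]

theorem IsNonsingular.exists_polar_ne_zero {χ : QuadraticForm F V} (hχ : IsNonsingular χ) {u : V}
    (hu : u ≠ 0) (hs : χ u = 0) : ∃ y, QuadraticMap.polar χ u y ≠ 0 := by
  by_contra! h
  have : u ∈ χ.radical := ⟨hs, LinearMap.ext h⟩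
  rw [hχ] at this
  exact hu this

/-- Some y is orthogonal to z but not to u: otherwise the functional of u would be a multiple of
that of z, and a nonzero singular combination of u and z would lie in the radical. Scaling y and
adding a multiple of u then makes it singular. -/
theorem IsNonsingular.exists_polar_eq_one {χ : QuadraticForm F V} (hχ : IsNonsingular χ) {u z : V}
    (h : LinearIndependent F ![u, z]) (hu : χ u = 0) (hz : χ z = 0)
    (huz : QuadraticMap.polar χ u z = 0) :
    ∃ y, χ y = 0 ∧ QuadraticMap.polar χ u y = 1 ∧ QuadraticMap.polar χ z y = 0 := by
  rw [LinearIndependent.pair_iff] at h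
  have hz0 : z ≠ 0 := fun h0 => by simpa using h 0 1 (by simp [h0])
  obtain ⟨y0, hy0⟩ := hχ.exists_polar_ne_zero hz0 hz
  have h1 : ∃ y, QuadraticMap.polar χ z y = 0 ∧ QuadraticMap.polar χ u y ≠ 0 := by
    by_contra! hc
    set t := QuadraticMap.polar χ u y0 / QuadraticMap.polar χ z y0 with ht
    have hne : u - t • z ≠ 0 := fun h0 => by
      simpa using (h 1 (-t) (by rw [← h0]; module)).1
    have hs : χ (u - t • z) = 0 := by
      rw [sub_eq_add_neg, ← neg_smul, QuadraticMap.map_add χ, QuadraticMap.map_smul,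
        QuadraticMap.polar_smul_right, hu, hz, huz]
      simp
    obtain ⟨y, hy⟩ := hχ.exists_polar_ne_zero hne hs
    apply hy
    have := hc (y - (QuadraticMap.polar χ z y / QuadraticMap.polar χ z y0) • y0) (by
      rw [QuadraticMap.polar_sub_right, QuadraticMap.polar_smul_right, smul_eq_mul,
        div_mul_cancel₀ _ hy0, sub_self])
    rw [QuadraticMap.polar_sub_right, QuadraticMap.polar_smul_right, smul_eq_mul] at this
    rw [QuadraticMap.polar_sub_left, QuadraticMap.polar_smul_left, smul_eq_mul, ht]
    rw [← this]
    field_simp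
  obtain ⟨y, hy1, hy2⟩ := h1
  set a := QuadraticMap.polar χ u y
  have huu : QuadraticMap.polar χ u u = 0 := by simp [hu]
  have hzu : QuadraticMap.polar χ z u = 0 := by rw [QuadraticMap.polar_comm, huz]
  refine ⟨a⁻¹ • y + (-(a⁻¹ * a⁻¹ * χ y)) • u, ?_, ?_, ?_⟩
  · rw [QuadraticMap.map_add χ, QuadraticMap.map_smul, QuadraticMap.map_smul, hu,
      QuadraticMap.polar_smul_right, QuadraticMap.polar_smul_left, QuadraticMap.polar_comm χ y u]
    simp only [smul_eq_mul]
    change _ + _ + _ * (a⁻¹ * a) = 0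
    rw [inv_mul_cancel₀ hy2]
    ring
  · rw [QuadraticMap.polar_add_right, QuadraticMap.polar_smul_right,
      QuadraticMap.polar_smul_right, huu, smul_eq_mul, smul_zero, add_zero]
    exact inv_mul_cancel₀ hy2
  · rw [QuadraticMap.polar_add_right, QuadraticMap.polar_smul_right,
      QuadraticMap.polar_smul_right, hzu, hy1, smul_zero, smul_zero, add_zero]

/-- If u lies in the totally singular 2-space U, all of U is orthogonal to u; otherwise the vectors
orthogonal to u meet U nontrivially. -/
theorem exists_orthogonal_singular {χ : QuadraticForm F V}
    (hW : ∃ U : Submodule F V, IsTotallySingular χ U ∧ Module.finrank F U = 2) {u : V}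
    (hu : u ≠ 0) :
    ∃ z, LinearIndependent F ![u, z] ∧ χ z = 0 ∧ QuadraticMap.polar χ u z = 0 := by
  obtain ⟨U, hU, h2⟩ := hW
  obtain ⟨z₁, z₂, hz, rfl⟩ := finrank_eq_two_iff_span.1 h2
  have m1 : z₁ ∈ Submodule.span F {z₁, z₂} := Submodule.subset_span (by simp)
  have m2 : z₂ ∈ Submodule.span F {z₁, z₂} := Submodule.subset_span (by simp)
  have hpol : ∀ v ∈ Submodule.span F {z₁, z₂}, ∀ w ∈ Submodule.span F {z₁, z₂},
      QuadraticMap.polar χ v w = 0 := fun v hv w hw => by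
    rw [QuadraticMap.polar, hU _ hv, hU _ hw, hU _ (add_mem hv hw)]; simp
  by_cases hmem : u ∈ Submodule.span F {z₁, z₂}
  · by_cases hi : LinearIndependent F ![u, z₁]
    · exact ⟨z₁, hi, hU _ m1, hpol _ hmem _ m1⟩
    · refine ⟨z₂, ?_, hU _ m2, hpol _ hmem _ m2⟩
      rw [LinearIndependent.pair_iff' hu] at hi ⊢
      push Not at hi
      obtain ⟨a, ha⟩ := hi
      intro b hb
      rw [LinearIndependent.pair_iff] at hz
      have h1 := hz b (-a) (by rw [← ha, ← hb, smul_smul, smul_smul]; module)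
      rw [← ha, ← hb, h1.1] at hz
      simpa using hz 0 1 (by simp)
  · have hi : ∀ z ∈ Submodule.span F {z₁, z₂}, z ≠ 0 → LinearIndependent F ![u, z] := by
      intro z hz hz0
      rw [LinearIndependent.pair_iff' hu]
      rintro a rfl
      have ha : a ≠ 0 := by rintro rfl; simp at hz0
      exact hmem ((Submodule.smul_mem_iff _ ha).1 hz)
    rw [LinearIndependent.pair_iff] at hz
    by_cases h1 : QuadraticMap.polar χ u z₁ = 0
    · exact ⟨z₁, hi _ m1 (fun h0 => by simpa using hz 1 0 (by simp [h0])), hU _ m1, h1⟩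
    · have m3 : QuadraticMap.polar χ u z₂ • z₁ - QuadraticMap.polar χ u z₁ • z₂ ∈
          Submodule.span F {z₁, z₂} :=
        sub_mem (Submodule.smul_mem _ _ m1) (Submodule.smul_mem _ _ m2)
      refine ⟨_, hi _ m3 (fun h0 => ?_), hU _ m3, ?_⟩
      · have := (hz (QuadraticMap.polar χ u z₂) (-QuadraticMap.polar χ u z₁)
          (by rw [← h0, neg_smul, sub_eq_add_neg])).2
        exact h1 (neg_eq_zero.1 this)
      · rw [QuadraticMap.polar_sub_right, QuadraticMap.polar_smul_right,
          QuadraticMap.polar_smul_right, smul_eq_mul, smul_eq_mul]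
        ring

/-- Two orthogonal hyperbolic pairs (u, y) and (z, x) leave a vector r orthogonal to both, and r is
not singular because it would otherwise lie in the radical. Prescribing the first basis vector
allows coordinates adapted to any singular point. -/
theorem exists_hyperbolic_basis (hV : Module.finrank F V = 5) {χ : QuadraticForm F V}
    (hχ : IsNonsingular χ)
    (hW : ∃ U : Submodule F V, IsTotallySingular χ U ∧ Module.finrank F U = 2) {u : V}
    (hu : u ≠ 0) (hs : χ u = 0) :
    ∃ (b : Module.Basis (Fin 5) F V) (c : F), c ≠ 0 ∧ b 0 = u ∧
      ∀ v : Fin 5 → F, χ (∑ i, v i • b i) = c * (v 0 * v 1 + v 2 * v 3 - v 4 ^ 2) := by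
  obtain ⟨z, hi, hz, huz⟩ := exists_orthogonal_singular hW hu
  have hi' : LinearIndependent F ![z, u] := LinearIndependent.pair_symm_iff.1 hi
  have hzu : QuadraticMap.polar χ z u = 0 := by rw [QuadraticMap.polar_comm, huz]
  obtain ⟨y, hy, huy, hzy⟩ := hχ.exists_polar_eq_one hi hs hz huz
  obtain ⟨x', hx', hzx', hux'⟩ := hχ.exists_polar_eq_one hi' hz hs hzu
  have hyu : QuadraticMap.polar χ y u = 1 := by rw [QuadraticMap.polar_comm, huy]
  have hyz : QuadraticMap.polar χ y z = 0 := by rw [QuadraticMap.polar_comm, hzy]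
  have hx'u : QuadraticMap.polar χ x' u = 0 := by rw [QuadraticMap.polar_comm, hux']
  have huu : QuadraticMap.polar χ u u = 0 := by simp [hs]
  have hzz : QuadraticMap.polar χ z z = 0 := by simp [hz]
  have hyy : QuadraticMap.polar χ y y = 0 := by simp [hy]
  obtain ⟨x, hx, hux, hyx, hzx⟩ : ∃ x, χ x = 0 ∧ QuadraticMap.polar χ u x = 0 ∧
      QuadraticMap.polar χ y x = 0 ∧ QuadraticMap.polar χ z x = 1 := by
    -- The multiple of u makes x' orthogonal to y; the result stays singular since u is singular and
    -- orthogonal to x'.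
    refine ⟨x' + (-QuadraticMap.polar χ y x') • u, ?_, ?_, ?_, ?_⟩
    · rw [QuadraticMap.map_add χ, QuadraticMap.map_smul, QuadraticMap.polar_smul_right, hx', hx'u,
        hs]
      simp
    all_goals
      rw [QuadraticMap.polar_add_right, QuadraticMap.polar_smul_right]
      simp [*]
  have hxu : QuadraticMap.polar χ x u = 0 := by rw [QuadraticMap.polar_comm, hux]
  have hxy : QuadraticMap.polar χ x y = 0 := by rw [QuadraticMap.polar_comm, hyx]
  have hxz : QuadraticMap.polar χ x z = 1 := by rw [QuadraticMap.polar_comm, hzx]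
  have hxx : QuadraticMap.polar χ x x = 0 := by simp [hx]
  have hfin : Module.Finite F V := Module.finite_of_finrank_pos (by omega)
  obtain ⟨r₀, hr₀⟩ : ∃ r₀, r₀ ∉ Submodule.span F (Set.range ![u, y, z, x]) := by
    by_contra! h
    have h1 : Submodule.span F (Set.range ![u, y, z, x]) = ⊤ := eq_top_iff.2 fun v _ => h v
    have h2 := finrank_range_le_card (R := F) ![u, y, z, x]
    rw [Set.finrank, h1, finrank_top, hV] at h2
    simp at h2
  obtain ⟨r, hr0, hru, hry, hrz, hrx⟩ : ∃ r, r ≠ 0 ∧ QuadraticMap.polar χ r u = 0 ∧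
      QuadraticMap.polar χ r y = 0 ∧ QuadraticMap.polar χ r z = 0 ∧
      QuadraticMap.polar χ r x = 0 := by
    -- Orthogonal projection along the two hyperbolic planes: the coefficient at each vector is the
    -- pairing with its partner.
    refine ⟨r₀ - (QuadraticMap.polar χ r₀ y • u + QuadraticMap.polar χ r₀ u • y +
      QuadraticMap.polar χ r₀ x • z + QuadraticMap.polar χ r₀ z • x), fun h0 => hr₀ ?_, ?_, ?_,
      ?_, ?_⟩
    · rw [sub_eq_zero] at h0
      rw [h0]
      refine add_mem (add_mem (add_mem ?_ ?_) ?_) ?_ <;>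
        refine Submodule.smul_mem _ _ (Submodule.subset_span ?_)
      exacts [⟨0, rfl⟩, ⟨1, rfl⟩, ⟨2, rfl⟩, ⟨3, rfl⟩]
    all_goals
      simp only [QuadraticMap.polar_sub_left, QuadraticMap.polar_add_left,
        QuadraticMap.polar_smul_left, smul_eq_mul, *]
      ring
  have hur : QuadraticMap.polar χ u r = 0 := by rw [QuadraticMap.polar_comm, hru]
  have hyr : QuadraticMap.polar χ y r = 0 := by rw [QuadraticMap.polar_comm, hry]
  have hzr : QuadraticMap.polar χ z r = 0 := by rw [QuadraticMap.polar_comm, hrz]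
  have hxr : QuadraticMap.polar χ x r = 0 := by rw [QuadraticMap.polar_comm, hrx]
  have hli : LinearIndependent F ![u, y, z, x, r] := by
    rw [Fintype.linearIndependent_iff]
    intro g hg
    have hp : ∀ w, QuadraticMap.polar χ (∑ i, g i • ![u, y, z, x, r] i) w = 0 := by
      intro w; rw [hg]; simp [QuadraticMap.polar]
    simp only [Fin.sum_univ_five, QuadraticMap.polar_add_left, QuadraticMap.polar_smul_left] at hp
    simp only [Matrix.cons_val] at hp
    have h0 := hp y
    have h1 := hp u
    have h2 := hp x
    have h3 := hp z
    simp only [*, smul_eq_mul, mul_zero, mul_one, zero_add, add_zero] at h0 h1 h2 h3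
    simp only [Fin.sum_univ_five, h0, h1, h2, h3] at hg
    simp [hr0] at hg
    intro i
    fin_cases i <;> assumption
  let b₀ := basisOfLinearIndependentOfCardEqFinrank hli (by simp [hV])
  have hb₀ : ⇑b₀ = ![u, y, z, x, r] := coe_basisOfLinearIndependentOfCardEqFinrank _ _
  have hform : ∀ v : Fin 5 → F, χ (∑ i, v i • b₀ i) =
      v 0 * v 1 + v 2 * v 3 + χ r * v 4 ^ 2 := by
    intro v
    rw [hb₀]
    simp only [Fin.sum_univ_five, QuadraticMap.map_add χ, QuadraticMap.polar_add_left,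
      QuadraticMap.polar_smul_left, QuadraticMap.polar_smul_right, QuadraticMap.map_smul]
    simp only [Matrix.cons_val, *, smul_eq_mul]
    ring
  have ha : χ r ≠ 0 := by
    intro ha
    have : r ∈ χ.radical := by
      rw [QuadraticMap.mem_radical_iff']
      refine ⟨ha, fun n => ?_⟩
      have h1 : r + n = ∑ i, (b₀.repr n + Finsupp.single 4 1 : Fin 5 →₀ F) i • b₀ i := by
        simp only [Finsupp.add_apply, add_smul, Finset.sum_add_distrib, b₀.sum_repr]
        rw [add_comm]
        congr 1
        simp [Fin.sum_univ_five, hb₀]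
      conv_rhs => rw [← b₀.sum_repr n]
      rw [h1, hform, hform, ha]
      simp
    rw [hχ] at this
    exact hr0 this
  -- Scaling y and x by -χ r lets this factor be taken out of the whole form.
  have hw : ∀ i, IsUnit ((![1, -χ r, 1, -χ r, 1] : Fin 5 → F) i) := by
    intro i
    fin_cases i <;> simp [ha]
  refine ⟨b₀.isUnitSMul hw, -χ r, by simpa using ha, ?_, fun v => ?_⟩
  · simp [Module.Basis.isUnitSMul_apply, hb₀]
  · simp only [Module.Basis.isUnitSMul_apply, smul_smul]
    rw [hform fun i => v i * (![1, -χ r, 1, -χ r, 1] : Fin 5 → F) i]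
    simp only [Matrix.cons_val]
    ring

end HyperbolicBasis

/-! ### Points of Γ as lines of the quadric -/

section DualEmbedding

variable {F : Type*} [Field F] {V : Type*} [AddCommGroup V] [Module F V] {P : Type*}

/-- The subspace spanned by the images of the lines through `p`. -/
noncomputable def pencilSpan (Γ : PointLineGeometry P) (ε : Γ.lines → Submodule F V) (p : P) :
    Submodule F V :=
  sSup (ε '' {l : Γ.lines | p ∈ l.1})

variable {Γ : PointLineGeometry P} {χ : QuadraticForm F V} {ε : Γ.lines → Submodule F V}

theorem image_pencil (hε : IsProjectiveEmbedding Γ.dual ε) (p : P) :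
    ε '' {l : Γ.lines | p ∈ l.1} = projPoints (pencilSpan Γ ε p) :=
  hε.full _ ⟨p, rfl⟩

theorem mem_iff_le_pencilSpan (hε : IsProjectiveEmbedding Γ.dual ε) {p : P} {l : Γ.lines} :
    p ∈ l.1 ↔ ε l ≤ pencilSpan Γ ε p := by
  refine ⟨fun h => le_sSup ⟨l, h, rfl⟩, fun h => ?_⟩
  have h1 : ε l ∈ projPoints (pencilSpan Γ ε p) := ⟨hε.isPoint l, h⟩
  rw [← image_pencil hε] at h1
  obtain ⟨l', hl', h2⟩ := h1
  rw [hε.injective h2] at hl'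
  exact hl'

theorem pencilSpan_mem_singularLines (hε : IsProjectiveEmbedding Γ.dual ε)
    (hεχ : HasImage Γ.dual ε (singularPoints χ) (singularLines χ)) (p : P) :
    pencilSpan Γ ε p ∈ singularLines χ := by
  have h : ε '' {l : Γ.lines | p ∈ l.1} ∈ projPoints '' singularLines χ := by
    rw [← hεχ.2]
    exact ⟨_, ⟨p, rfl⟩, rfl⟩
  obtain ⟨U, hU, h⟩ := h
  rw [image_pencil hε] at h
  rwa [← projPoints_injective h]

theorem exists_pencilSpan_eq (hε : IsProjectiveEmbedding Γ.dual ε)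
    (hεχ : HasImage Γ.dual ε (singularPoints χ) (singularLines χ)) {U : Submodule F V}
    (hU : U ∈ singularLines χ) : ∃ p, pencilSpan Γ ε p = U := by
  have h : projPoints U ∈ projPoints '' singularLines χ := ⟨U, hU, rfl⟩
  rw [← hεχ.2] at h
  obtain ⟨_, ⟨p, rfl⟩, h⟩ := h
  refine ⟨p, projPoints_injective ?_⟩
  rw [← image_pencil hε]
  exact h

theorem exists_line_eq_span (hεχ : HasImage Γ.dual ε (singularPoints χ) (singularLines χ)) {v : V}
    (hv : v ≠ 0) (hs : χ v = 0) : ∃ l, ε l = Submodule.span F {v} := by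
  have : Submodule.span F {v} ∈ singularPoints χ := by
    refine ⟨finrank_span_singleton hv, fun u hu => ?_⟩
    obtain ⟨c, rfl⟩ := Submodule.mem_span_singleton.1 hu
    rw [QuadraticMap.map_smul, hs, smul_zero]
  rw [← hεχ.1] at this
  exact this

theorem exists_singular_span_eq (hεχ : HasImage Γ.dual ε (singularPoints χ) (singularLines χ))
    (l : Γ.lines) : ∃ v, v ≠ 0 ∧ χ v = 0 ∧ ε l = Submodule.span F {v} := by
  have : ε l ∈ singularPoints χ := by rw [← hεχ.1]; exact ⟨l, rfl⟩
  obtain ⟨v, hv, h⟩ := finrank_eq_one_iff_span.1 this.1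
  exact ⟨v, hv, this.2 v (by rw [h]; exact Submodule.mem_span_singleton_self v), h⟩

/-- The subspace orthogonal to x has dimension at least 3, so it contains some y outside ⟨x, x'⟩;
the isotropic line ⟨x, y⟩ then passes through ⟨x⟩ but misses ⟨x'⟩. -/
theorem IsSymplecticQuadrangle.point_ext (hΓ : IsSymplecticQuadrangle F Γ) {p p' : P}
    (h : ∀ l ∈ Γ.lines, p ∈ l → p' ∈ l) : p = p' := by
  obtain ⟨α, e, halt, hnd, hinj, himg⟩ := hΓ
  by_contra hne
  have hpt : ∀ p, ∃ x, x ≠ 0 ∧ e p = Submodule.span F {x} := fun p => by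
    have : e p ∈ isotropicPoints α := by rw [← himg.1]; exact ⟨p, rfl⟩
    exact finrank_eq_one_iff_span.1 this.1
  obtain ⟨x, hx, hxe⟩ := hpt p
  obtain ⟨x', hx', hxe'⟩ := hpt p'
  have hxx' : x' ∉ Submodule.span F {x} := fun hm => hne <| hinj <| by
    rw [hxe, hxe']
    refine (Submodule.eq_of_le_of_finrank_eq ?_ ?_).symm
    · simpa using hm
    · rw [finrank_span_singleton hx, finrank_span_singleton hx']
  obtain ⟨y, hy, hyn⟩ : ∃ y ∈ LinearMap.ker (α x), y ∉ Submodule.span F {x, x'} := by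
    by_contra! hc
    have h1 : Module.finrank F (LinearMap.ker (α x)) ≤ 2 :=
      (Submodule.finrank_mono hc).trans (by
        classical
        have := finrank_span_finset_le_card (R := F) ({x, x'} : Finset (Fin 4 → F))
        rw [Finset.coe_pair] at this
        exact this.trans Finset.card_le_two)
    have h2 := LinearMap.finrank_range_add_finrank_ker (α x)
    have h3 := Submodule.finrank_le (LinearMap.range (α x))
    simp at h2 h3
    omega
  rw [LinearMap.mem_ker] at hy
  have hli : LinearIndependent F ![x, y] := by
    rw [LinearIndependent.pair_iff' hx]
    rintro a rfl
    exact hyn (Submodule.smul_mem _ _ (Submodule.subset_span (by simp)))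
  have hyx : α y x = 0 := by rw [← halt.neg_eq, hy, neg_zero]
  have hU : Submodule.span F {x, y} ∈ isotropicLines α := by
    refine ⟨finrank_eq_two_iff_span.2 ⟨x, y, hli, rfl⟩, fun u hu v hv => ?_⟩
    obtain ⟨a, b, rfl⟩ := Submodule.mem_span_pair.1 hu
    obtain ⟨c, d, rfl⟩ := Submodule.mem_span_pair.1 hv
    simp [hy, hyx, halt.self_eq_zero]
  have hl : projPoints (Submodule.span F {x, y}) ∈ projPoints '' isotropicLines α := ⟨_, hU, rfl⟩
  rw [← himg.2] at hl
  obtain ⟨l, hl, hle⟩ := hl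
  have hmem : ∀ p, p ∈ l ↔ e p ≤ Submodule.span F {x, y} := by
    intro p
    have : e p ∈ e '' l ↔ e p ∈ projPoints (Submodule.span F {x, y}) := by
      rw [← hle]
    rw [hinj.mem_set_image] at this
    rw [this]
    obtain ⟨x, hx, hxe⟩ := hpt p
    exact ⟨fun h => h.2, fun h => ⟨by rw [hxe]; exact finrank_span_singleton hx, h⟩⟩
  have h1 := (hmem p').1 (h l hl ((hmem p).2 (by
    rw [hxe]; exact Submodule.span_mono (by simp))))
  rw [hxe', Submodule.span_singleton_le_iff_mem] at h1
  obtain ⟨a, b, hab⟩ := Submodule.mem_span_pair.1 h1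
  have hb : b ≠ 0 := by
    rintro rfl
    exact hxx' (Submodule.mem_span_singleton.2 ⟨a, by simpa using hab⟩)
  refine hyn (Submodule.mem_span_pair.2 ⟨-(b⁻¹ * a), b⁻¹, ?_⟩)
  rw [← hab, smul_add, smul_smul, smul_smul, inv_mul_cancel₀ hb]
  module

/-- Only here does the isomorphism of Γ with W(3, F) enter. All other incidences are recovered from
ε, which does not by itself exclude two points on the same set of lines. -/
theorem pencilSpan_injective (hΓ : IsSymplecticQuadrangle F Γ)
    (hε : IsProjectiveEmbedding Γ.dual ε) : Function.Injective (pencilSpan Γ ε) := by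
  intro p p' h
  refine hΓ.point_ext fun l hl hp => ?_
  rw [mem_iff_le_pencilSpan hε (l := ⟨l, hl⟩)] at hp
  rw [h] at hp
  exact (mem_iff_le_pencilSpan hε (l := ⟨l, hl⟩)).2 hp

end DualEmbedding

/-! ### The veronesean as a quadratic map -/

section VeroneseMap

variable {F : Type*} [Field F] {V₀ : Type*} [AddCommGroup V₀] [Module F V₀] {n : ℕ}

/-- The veronesean map as a quadratic map. -/
noncomputable def veroneseMap (E : Module.Basis (Fin n) F V₀)
    (E' : Module.Basis {ij : Fin n × Fin n // ij.1 ≤ ij.2} F (SymSquare F V₀)) :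
    QuadraticMap F V₀ (SymSquare F V₀) :=
  ∑ ij, (LinearMap.toSpanSingleton F _ (E' ij)).compQuadraticMap
    (QuadraticMap.linMulLin (E.coord ij.1.1) (E.coord ij.1.2))

variable (E : Module.Basis (Fin n) F V₀)
  (E' : Module.Basis {ij : Fin n × Fin n // ij.1 ≤ ij.2} F (SymSquare F V₀))

theorem veroneseMap_eq_veronese : ⇑(veroneseMap E E') = veronese E E' := by
  ext1 x
  simp [veroneseMap, veronese]

theorem veroneseMap_apply (x : V₀) :
    veroneseMap E E' x = ∑ ij, (E.repr x ij.1.1 * E.repr x ij.1.2) • E' ij := by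
  rw [veroneseMap_eq_veronese]; rfl

theorem polar_veroneseMap (x y : V₀) : QuadraticMap.polar (veroneseMap E E') x y =
    ∑ ij, (E.repr x ij.1.1 * E.repr y ij.1.2 + E.repr y ij.1.1 * E.repr x ij.1.2) • E' ij := by
  simp only [QuadraticMap.polar, veroneseMap_apply, ← Finset.sum_sub_distrib, ← sub_smul]
  refine Finset.sum_congr rfl fun ij _ => ?_
  congr 1
  simp only [map_add, Finsupp.add_apply]
  ring

/-- Diagonal basis vectors are values of the veronesean at basis vectors, and the others are values
of its polar form, so no assumption on the size or characteristic of F is needed. -/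
theorem basis_mem_span_range_veroneseMap (ij : {ij : Fin n × Fin n // ij.1 ≤ ij.2}) :
    E' ij ∈ Submodule.span F (Set.range (veroneseMap E E')) := by
  have hη : ∀ x, veroneseMap E E' x ∈ Submodule.span F (Set.range (veroneseMap E E')) :=
    fun x => Submodule.subset_span ⟨x, rfl⟩
  obtain ⟨⟨i, j⟩, hij⟩ := ij
  rcases (show i ≤ j from hij).eq_or_lt with rfl | hlt
  · convert hη (E i)
    rw [veroneseMap_apply, Finset.sum_eq_single ⟨(i, i), hij⟩]
    · simp
    · rintro ⟨⟨k, l⟩, hkl⟩ - hne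
      have : ¬ (k = i ∧ l = i) := by
        rintro ⟨rfl, rfl⟩; exact hne rfl
      rw [not_and_or] at this
      rcases this with h | h <;> simp [Finsupp.single_apply, Ne.symm h]
    · simp
  · have h : QuadraticMap.polar (veroneseMap E E') (E i) (E j) ∈
        Submodule.span F (Set.range (veroneseMap E E')) :=
      sub_mem (sub_mem (hη _) (hη _)) (hη _)
    convert h
    rw [polar_veroneseMap, Finset.sum_eq_single ⟨(i, j), hij⟩]
    · simp [hlt.ne, hlt.ne']
    · rintro ⟨⟨k, l⟩, hkl⟩ - hne
      have h1 : ¬ (i = k ∧ j = l) := by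
        rintro ⟨rfl, rfl⟩; exact hne rfl
      have h2 : ¬ (j = k ∧ i = l) := by
        rintro ⟨rfl, rfl⟩; exact absurd hkl (not_le.2 hlt)
      simp only [Module.Basis.repr_self, Finsupp.single_apply]
      rw [not_and_or] at h1 h2
      rcases h1 with h1 | h1 <;> rcases h2 with h2 | h2 <;> simp [h1, h2]
    · simp

theorem span_range_veroneseMap : Submodule.span F (Set.range (veroneseMap E E')) = ⊤ := by
  rw [← top_le_iff, ← E'.span_eq, Submodule.span_le]
  rintro _ ⟨ij, rfl⟩
  exact basis_mem_span_range_veroneseMap E E' ij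

theorem veroneseEmbedding_of_span {P : Type*} {ε₀ : P → Submodule F V₀} {p : P} {x : V₀}
    (h : ε₀ p = Submodule.span F {x}) :
    veroneseEmbedding E E' ε₀ p = Submodule.span F {veroneseMap E E' x} := by
  rw [veroneseEmbedding, h, ← veroneseMap_eq_veronese]
  refine le_antisymm (Submodule.span_le.2 ?_) (Submodule.span_mono ?_)
  · rintro _ ⟨y, hy, rfl⟩
    obtain ⟨c, rfl⟩ := Submodule.mem_span_singleton.1 hy
    rw [QuadraticMap.map_smul]
    exact Submodule.smul_mem _ _ (Submodule.mem_span_singleton_self _)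
  · rintro _ rfl
    exact ⟨x, Submodule.mem_span_singleton_self x, rfl⟩

theorem sSup_range_veroneseEmbedding {P : Type*} {ε₀ : P → Submodule F V₀}
    (h : ∀ x, x ≠ 0 → ∃ p, ε₀ p = Submodule.span F {x}) :
    sSup (Set.range (veroneseEmbedding E E' ε₀)) = ⊤ := by
  rw [← top_le_iff, ← span_range_veroneseMap E E', Submodule.span_le]
  rintro _ ⟨x, rfl⟩
  by_cases hx : x = 0
  · simp [hx]
  · obtain ⟨p, hp⟩ := h x hx
    refine (le_sSup (Set.mem_range_self p) : veroneseEmbedding E E' ε₀ p ≤ _) ?_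
    rw [veroneseEmbedding_of_span E E' hp]
    exact Submodule.mem_span_singleton_self _

end VeroneseMap

/-! ### Functionals on the symmetrized square -/

section SymDual

variable {F : Type*} [Field F] {V₀ : Type*} [AddCommGroup V₀] [Module F V₀]

theorem sum_fin_four_le {M : Type*} [AddCommMonoid M]
    (f : {ij : Fin 4 × Fin 4 // ij.1 ≤ ij.2} → M) :
    ∑ ij, f ij = f ⟨(0, 0), by decide⟩ + f ⟨(0, 1), by decide⟩ + f ⟨(0, 2), by decide⟩ +
      f ⟨(0, 3), by decide⟩ + f ⟨(1, 1), by decide⟩ + f ⟨(1, 2), by decide⟩ +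
      f ⟨(1, 3), by decide⟩ + f ⟨(2, 2), by decide⟩ + f ⟨(2, 3), by decide⟩ +
      f ⟨(3, 3), by decide⟩ := by
  have h1 : ∑ ij, f ij = ∑ p : Fin 4 × Fin 4, if h : p.1 ≤ p.2 then f ⟨p, h⟩ else 0 := by
    rw [Finset.sum_dite]
    simp only [Finset.sum_const_zero, add_zero]
    refine Finset.sum_bij' (fun p _ => ⟨p.1, by simpa using p.2⟩)
      (fun p _ => ⟨p.1, (Finset.mem_filter.1 p.2).2⟩) ?_ ?_ ?_ ?_ ?_ <;> simp
  rw [h1, Fintype.sum_prod_type]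
  simp only [Fin.sum_univ_four]
  simp only [show ¬ ((1 : Fin 4) ≤ 0) by decide, show ¬ ((2 : Fin 4) ≤ 0) by decide,
    show ¬ ((3 : Fin 4) ≤ 0) by decide, show ¬ ((2 : Fin 4) ≤ 1) by decide,
    show ¬ ((3 : Fin 4) ≤ 1) by decide, show ¬ ((3 : Fin 4) ≤ 2) by decide,
    show ((0 : Fin 4) ≤ 0) by decide, show ((0 : Fin 4) ≤ 1) by decide,
    show ((0 : Fin 4) ≤ 2) by decide, show ((0 : Fin 4) ≤ 3) by decide,
    show ((1 : Fin 4) ≤ 1) by decide, show ((1 : Fin 4) ≤ 2) by decide,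
    show ((1 : Fin 4) ≤ 3) by decide, show ((2 : Fin 4) ≤ 2) by decide,
    show ((2 : Fin 4) ≤ 3) by decide, show ((3 : Fin 4) ≤ 3) by decide,
    dif_pos, dif_neg, not_false_eq_true, zero_add]
  abel

variable (E : Module.Basis (Fin 4) F V₀)
  (E' : Module.Basis {ij : Fin 4 × Fin 4 // ij.1 ≤ ij.2} F (SymSquare F V₀))

/-- The product of two linear functionals, as a functional on the symmetrized tensor square. -/
noncomputable def symDual (f g : Module.Dual F V₀) : Module.Dual F (SymSquare F V₀) :=
  E'.constr F fun ij => if ij.1.1 = ij.1.2 then f (E ij.1.1) * g (E ij.1.1) else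
    f (E ij.1.1) * g (E ij.1.2) + f (E ij.1.2) * g (E ij.1.1)

@[simp] theorem symDual_veroneseMap (f g : Module.Dual F V₀) (x : V₀) :
    symDual E E' f g (veroneseMap E E' x) = f x * g x := by
  have hf : ∀ f : Module.Dual F V₀, f x = ∑ i, E.repr x i * f (E i) := fun f =>
    calc f x = f (∑ i, E.repr x i • E i) := by rw [E.sum_repr]
      _ = _ := by simp only [map_sum, map_smul, smul_eq_mul]
  rw [hf f, hf g, veroneseMap_apply, sum_fin_four_le]
  simp only [map_add, map_smul, symDual, Module.Basis.constr_basis, Fin.sum_univ_four,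
    smul_eq_mul]
  simp only [Fin.reduceEq, if_true, if_false]
  ring

-- These functionals extract single coefficients from combinations of values of the veronesean map
-- and its polar form, which gives the linear independence statements below.
@[simp] theorem symDual_polar (f g : Module.Dual F V₀) (x y : V₀) :
    symDual E E' f g (QuadraticMap.polar (veroneseMap E E') x y) = f x * g y + f y * g x := by
  simp only [QuadraticMap.polar, map_sub, symDual_veroneseMap, map_add]
  ring

end SymDual

/-! ### Morphisms of embeddings as maps of ambient spaces -/

section Morphism

variable {F : Type*} [Field F] {V V' : Type*} [AddCommGroup V] [Module F V]
  [AddCommGroup V'] [Module F V'] {P : Type*} {ε₁ : P → Submodule F V} {ε₂ : P → Submodule F V'}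

theorem IsMorphism.exists_extension {σ : F →+* F} [RingHomSurjective σ]
    {f : (sSup (Set.range ε₁) : Submodule F V) →ₛₗ[σ] (sSup (Set.range ε₂) : Submodule F V')}
    (h : IsMorphism ε₁ ε₂ f) (htop : sSup (Set.range ε₁) = ⊤) :
    ∃ g : V →ₛₗ[σ] V', (∀ x : (sSup (Set.range ε₁) : Submodule F V), g x = f x) ∧
      ∀ p, (ε₁ p).map g = ε₂ p := by
  let i : V →ₗ[F] (sSup (Set.range ε₁) : Submodule F V) :=
    LinearMap.codRestrict _ LinearMap.id fun x => by rw [htop]; trivial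
  refine ⟨(sSup (Set.range ε₂)).subtype.comp (f.comp i), fun x => rfl, fun p => ?_⟩
  have hp := congrArg (Submodule.map (sSup (Set.range ε₂)).subtype) (h p)
  rw [Submodule.map_comap_subtype, inf_eq_right.2 (le_sSup (Set.mem_range_self p))] at hp
  rw [← hp]
  ext y
  simp only [Submodule.mem_map, Submodule.mem_comap]
  constructor
  · rintro ⟨x, hx, rfl⟩
    exact ⟨_, ⟨i x, hx, rfl⟩, rfl⟩
  · rintro ⟨_, ⟨x, hx, rfl⟩, rfl⟩
    exact ⟨x, hx, rfl⟩

theorem exists_isMorphism_of_map (g : V →ₗ[F] V') (hg : ∀ p, (ε₁ p).map g = ε₂ p) :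
    ∃ f : (sSup (Set.range ε₁) : Submodule F V) →ₗ[F] (sSup (Set.range ε₂) : Submodule F V'),
      IsMorphism ε₁ ε₂ f := by
  have hle : sSup (Set.range ε₁) ≤ (sSup (Set.range ε₂)).comap g := by
    refine sSup_le ?_
    rintro _ ⟨p, rfl⟩
    rw [← Submodule.map_le_iff_le_comap, hg]
    exact le_sSup (Set.mem_range_self p)
  refine ⟨g.restrict hle, fun p => ?_⟩
  apply Submodule.map_injective_of_injective (sSup (Set.range ε₂)).injective_subtype
  rw [Submodule.map_comap_subtype, inf_eq_right.2 (le_sSup (Set.mem_range_self p)), ← hg]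
  ext y
  simp only [Submodule.mem_map, Submodule.mem_comap]
  constructor
  · rintro ⟨_, ⟨x, hx, rfl⟩, rfl⟩
    exact ⟨x, hx, rfl⟩
  · rintro ⟨x, hx, rfl⟩
    exact ⟨_, ⟨⟨x, (le_sSup (Set.mem_range_self p) : ε₁ p ≤ _) hx⟩, hx, rfl⟩, rfl⟩

theorem range_eq_sSup_of_map {σ : F →+* F} [RingHomSurjective σ] {g : V →ₛₗ[σ] V'}
    (hg : ∀ p, (ε₁ p).map g = ε₂ p) (htop : sSup (Set.range ε₁) = ⊤) :
    LinearMap.range g = sSup (Set.range ε₂) := by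
  rw [LinearMap.range_eq_map, ← htop, sSup_range, sSup_range, Submodule.map_iSup]
  simp only [hg]

end Morphism

/-! ### The duality between W(3, F) and the parabolic quadric, in coordinates -/

section Incidence

variable {F : Type*} [Field F]

/-- The alternating form `x₀y₁ - x₁y₀ + x₂y₃ - x₃y₂` of `F⁴`. -/
def omega (x y : Fin 4 → F) : F := x 0 * y 1 - x 1 * y 0 + x 2 * y 3 - x 3 * y 2

/-- The quadratic form `v₀v₁ + v₂v₃ - v₄²` of `F⁵`. -/
def parabolic (v : Fin 5 → F) : F := v 0 * v 1 + v 2 * v 3 - v 4 ^ 2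

/-- Plücker coordinates of a totally isotropic line `⟨x, y⟩` of `F⁴`; the coordinates `p₀₁` and
`p₂₃` are opposite. -/
def plucker (x y : Fin 4 → F) : Fin 5 → F :=
  ![x 2 * y 0 - x 0 * y 2, x 1 * y 3 - x 3 * y 1, x 0 * y 3 - x 3 * y 0, x 1 * y 2 - x 2 * y 1,
    x 0 * y 1 - x 1 * y 0]

/-- The point `⟨x⟩` lies on the line with Plücker coordinates `v`. -/
def Incident (x : Fin 4 → F) (v : Fin 5 → F) : Prop :=
  x 0 * v 3 + x 1 * v 0 + x 2 * v 4 = 0 ∧ x 0 * v 1 - x 1 * v 2 + x 3 * v 4 = 0 ∧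
    x 0 * v 4 + x 2 * v 2 + x 3 * v 0 = 0 ∧ x 1 * v 4 + x 2 * v 1 - x 3 * v 3 = 0

theorem Incident.add_left {x y : Fin 4 → F} {v : Fin 5 → F} (hx : Incident x v)
    (hy : Incident y v) : Incident (x + y) v := by
  obtain ⟨h1, h2, h3, h4⟩ := hx
  obtain ⟨k1, k2, k3, k4⟩ := hy
  simp only [Incident, Pi.add_apply]
  exact ⟨by linear_combination h1 + k1, by linear_combination h2 + k2,
    by linear_combination h3 + k3, by linear_combination h4 + k4⟩

theorem Incident.smul_left {x : Fin 4 → F} {v : Fin 5 → F} (hx : Incident x v) (a : F) :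
    Incident (a • x) v := by
  obtain ⟨h1, h2, h3, h4⟩ := hx
  simp only [Incident, Pi.smul_apply, smul_eq_mul]
  exact ⟨by linear_combination a * h1, by linear_combination a * h2,
    by linear_combination a * h3, by linear_combination a * h4⟩

theorem Incident.add_right {x : Fin 4 → F} {v w : Fin 5 → F} (hv : Incident x v)
    (hw : Incident x w) : Incident x (v + w) := by
  obtain ⟨h1, h2, h3, h4⟩ := hv
  obtain ⟨k1, k2, k3, k4⟩ := hw
  simp only [Incident, Pi.add_apply]
  exact ⟨by linear_combination h1 + k1, by linear_combination h2 + k2,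
    by linear_combination h3 + k3, by linear_combination h4 + k4⟩

theorem Incident.smul_right {x : Fin 4 → F} {v : Fin 5 → F} (hv : Incident x v) (a : F) :
    Incident x (a • v) := by
  obtain ⟨h1, h2, h3, h4⟩ := hv
  simp only [Incident, Pi.smul_apply, smul_eq_mul]
  exact ⟨by linear_combination a * h1, by linear_combination a * h2,
    by linear_combination a * h3, by linear_combination a * h4⟩

theorem incident_zero_right (x : Fin 4 → F) : Incident x 0 := by simp [Incident]

theorem incident_zero_left (v : Fin 5 → F) : Incident 0 v := by simp [Incident]

theorem exists_ne_zero_fin_four {x : Fin 4 → F} (hx : x ≠ 0) :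
    x 0 ≠ 0 ∨ x 1 ≠ 0 ∨ x 2 ≠ 0 ∨ x 3 ≠ 0 := by
  by_contra! h
  apply hx
  ext i
  fin_cases i <;> simp [h]

/-- Incidence says x ∧ L = 0 for the bivector L of F⁴ with coordinates v, and a bivector annihilated
by a nonzero vector is decomposable. Concretely, each coordinate of x times the Plücker relation is
a combination of the four equations. -/
theorem Incident.parabolic_eq_zero {x : Fin 4 → F} {v : Fin 5 → F} (h : Incident x v)
    (hx : x ≠ 0) : parabolic v = 0 := by
  obtain ⟨h1, h2, h3, h4⟩ := h
  unfold parabolic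
  rcases exists_ne_zero_fin_four hx with h | h | h | h <;> apply mul_left_cancel₀ h
  · linear_combination v 0 * h2 + v 2 * h1 - v 4 * h3
  · linear_combination v 1 * h1 - v 3 * h2 - v 4 * h4
  · linear_combination v 3 * h3 + v 0 * h4 - v 4 * h1
  · linear_combination v 1 * h3 - v 2 * h4 - v 4 * h2

theorem incident_plucker_left {x y : Fin 4 → F} (h : omega x y = 0) :
    Incident x (plucker x y) := by
  unfold omega at h
  simp only [Incident, plucker, Matrix.cons_val]
  refine ⟨by ring, by ring, ?_, ?_⟩
  · linear_combination x 0 * h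
  · linear_combination x 1 * h

theorem incident_plucker_right {x y : Fin 4 → F} (h : omega x y = 0) :
    Incident y (plucker x y) := by
  unfold omega at h
  simp only [Incident, plucker, Matrix.cons_val]
  refine ⟨by ring, by ring, ?_, ?_⟩
  · linear_combination y 0 * h
  · linear_combination y 1 * h

theorem linearIndependent_of_plucker_ne_zero {x y : Fin 4 → F} (h : plucker x y ≠ 0) :
    LinearIndependent F ![x, y] := by
  have hx : x ≠ 0 := by
    rintro rfl
    apply h
    ext i
    fin_cases i <;> simp [plucker]
  rw [LinearIndependent.pair_iff' hx]
  rintro a rfl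
  apply h
  ext i
  fin_cases i <;> simp [plucker] <;> ring

/-- For isotropic pairs the five coordinates account for all six 2 × 2 minors up to sign; if these
vanish, then y i • x = x i • y for every i. -/
theorem plucker_ne_zero {x y : Fin 4 → F} (h : LinearIndependent F ![x, y])
    (hω : omega x y = 0) : plucker x y ≠ 0 := by
  intro h0
  rw [LinearIndependent.pair_iff] at h
  have hx : x ≠ 0 := by
    rintro rfl
    simpa using h 1 0 (by simp)
  have e0 : x 2 * y 0 - x 0 * y 2 = 0 := congrFun h0 0
  have e1 : x 1 * y 3 - x 3 * y 1 = 0 := congrFun h0 1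
  have e2 : x 0 * y 3 - x 3 * y 0 = 0 := congrFun h0 2
  have e3 : x 1 * y 2 - x 2 * y 1 = 0 := congrFun h0 3
  have e4 : x 0 * y 1 - x 1 * y 0 = 0 := congrFun h0 4
  unfold omega at hω
  have key : ∀ i, y i • x + (-x i) • y = 0 := by
    intro i
    ext j
    simp only [Pi.add_apply, Pi.smul_apply, smul_eq_mul, Pi.zero_apply]
    fin_cases i <;> fin_cases j <;> simp only [Fin.reduceFinMk, Fin.zero_eta, Fin.mk_one]
    · ring
    · linear_combination -e4
    · linear_combination e0
    · linear_combination -e2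
    · linear_combination e4
    · ring
    · linear_combination -e3
    · linear_combination -e1
    · linear_combination -e0
    · linear_combination e3
    · ring
    · linear_combination e4 - hω
    · linear_combination e2
    · linear_combination e1
    · linear_combination hω - e4
    · ring
  rcases exists_ne_zero_fin_four hx with h1 | h1 | h1 | h1 <;>
    exact h1 (neg_eq_zero.1 (h _ _ (key _)).2)

/-- The witnesses are two rows of the skew-symmetric 4 × 4 matrix (pᵢⱼ) rebuilt from v, one of them
divided by a nonzero entry pᵢⱼ. The coordinate v 4 cannot be the only nonzero one, because its
square is v 0 v 1 + v 2 v 3. -/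
theorem exists_plucker_eq {v : Fin 5 → F} (hv : v ≠ 0) (hq : parabolic v = 0) :
    ∃ x y, LinearIndependent F ![x, y] ∧ omega x y = 0 ∧ plucker x y = v := by
  unfold parabolic at hq
  suffices h : ∃ x y, omega x y = 0 ∧ plucker x y = v by
    obtain ⟨x, y, h1, h2⟩ := h
    exact ⟨x, y, linearIndependent_of_plucker_ne_zero (h2 ▸ hv), h1, h2⟩
  by_cases h0 : v 0 = 0
  · by_cases h1 : v 1 = 0
    · by_cases h2 : v 2 = 0
      · by_cases h3 : v 3 = 0
        · have h4 : v 4 = 0 := by simpa [h0, h2] using hq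
          refine absurd ?_ hv
          ext i
          fin_cases i <;> assumption
        · refine ⟨(v 3)⁻¹ • ![-v 4, 0, v 3, v 1], ![v 0, -v 3, 0, -v 4], ?_, ?_⟩
          · simp [omega]; field_simp; ring
          · ext i
            fin_cases i <;> simp [plucker] <;> field_simp <;> linear_combination -hq
      · refine ⟨(v 2)⁻¹ • ![0, v 4, -v 0, v 2], ![-v 2, -v 1, v 4, 0], ?_, ?_⟩
        · simp [omega]; field_simp; ring
        · ext i
          fin_cases i <;> simp [plucker] <;> field_simp <;> linear_combination -hq
    · refine ⟨(v 1)⁻¹ • ![-v 4, 0, v 3, v 1], ![-v 2, -v 1, v 4, 0], ?_, ?_⟩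
      · simp [omega]; field_simp; ring
      · ext i
        fin_cases i <;> simp [plucker] <;> field_simp <;> linear_combination -hq
  · refine ⟨(-v 0)⁻¹ • ![0, v 4, -v 0, v 2], ![v 0, -v 3, 0, -v 4], ?_, ?_⟩
    · simp [omega]; field_simp; ring
    · ext i
      fin_cases i <;> simp [plucker] <;> field_simp <;> linear_combination -hq

/-- Incidence makes all 3 × 3 minors of (x, y, z) vanish, so Cramer's rule with a nonzero 2 × 2
minor of (x, y) expresses z. -/
theorem Incident.mem_span {x y z : Fin 4 → F} (h : LinearIndependent F ![x, y])
    (hω : omega x y = 0) (hz : Incident z (plucker x y)) : z ∈ Submodule.span F {x, y} := by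
  have hne := plucker_ne_zero h hω
  obtain ⟨h1, h2, h3, h4⟩ := hz
  unfold omega at hω
  simp only [plucker, Matrix.cons_val] at h1 h2 h3 h4
  have key : ∀ i j, (x i * y j - x j * y i) • z =
      (z i * y j - z j * y i) • x + (x i * z j - x j * z i) • y := by
    intro i j
    ext k
    simp only [Pi.add_apply, Pi.smul_apply, smul_eq_mul]
    rw [← sub_eq_zero]
    fin_cases i <;> fin_cases j <;> fin_cases k <;>
      simp only [Fin.reduceFinMk, Fin.zero_eta, Fin.mk_one] <;>
      first
        | ring1
        | linear_combination h1
        | linear_combination -h1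
        | linear_combination h2
        | linear_combination -h2
        | linear_combination z 0 * hω - h3
        | linear_combination h3 - z 0 * hω
        | linear_combination z 1 * hω - h4
        | linear_combination h4 - z 1 * hω
  have : ∃ i j, x i * y j - x j * y i ≠ 0 := by
    by_contra! hc
    apply hne
    ext i
    fin_cases i
    exacts [hc 2 0, hc 1 3, hc 0 3, hc 1 2, hc 0 1]
  obtain ⟨i, j, hij⟩ := this
  rw [← Submodule.smul_mem_iff _ hij, key]
  exact Submodule.mem_span_pair.2 ⟨_, _, rfl⟩

theorem omega_eq_zero_of_incident {x y : Fin 4 → F} {v : Fin 5 → F} (hv : v ≠ 0)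
    (hx : Incident x v) (hy : Incident y v) : omega x y = 0 ∧ ∃ c : F, plucker x y = c • v := by
  by_cases hx0 : x = 0
  · subst hx0
    refine ⟨by simp [omega], 0, ?_⟩
    ext i
    fin_cases i <;> simp [plucker]
  obtain ⟨x₁, y₁, hi, hω, rfl⟩ := exists_plucker_eq hv (hx.parabolic_eq_zero hx0)
  obtain ⟨a, b, rfl⟩ := Submodule.mem_span_pair.1 (hx.mem_span hi hω)
  obtain ⟨c, d, rfl⟩ := Submodule.mem_span_pair.1 (hy.mem_span hi hω)
  refine ⟨?_, a * d - b * c, ?_⟩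
  · simp only [omega, Pi.add_apply, Pi.smul_apply, smul_eq_mul] at hω ⊢
    linear_combination (a * d - b * c) * hω
  · ext i
    fin_cases i <;> simp [plucker] <;> ring

/-- Two lines of PG(3, F) meet if the determinant of their four spanning vectors vanishes. By
Laplace expansion along pairs of rows, for isotropic lines this determinant is the polar form of
`parabolic` at the Plücker vectors. -/
theorem exists_incident_of_orthogonal {v w : Fin 5 → F} (hv : v ≠ 0) (hw : w ≠ 0)
    (hqv : parabolic v = 0) (hqw : parabolic w = 0) (hvw : parabolic (v + w) = 0) :
    ∃ x, x ≠ 0 ∧ Incident x v ∧ Incident x w := by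
  obtain ⟨x₁, y₁, hi₁, hω₁, rfl⟩ := exists_plucker_eq hv hqv
  obtain ⟨x₂, y₂, hi₂, hω₂, rfl⟩ := exists_plucker_eq hw hqw
  have hdet : Matrix.det (Matrix.of ![x₁, y₁, x₂, y₂]) = 0 := by
    have key : Matrix.det (Matrix.of ![x₁, y₁, x₂, y₂]) =
        (x₁ 0 * y₁ 1 - x₁ 1 * y₁ 0) * (x₂ 2 * y₂ 3 - x₂ 3 * y₂ 2) -
        (x₁ 0 * y₁ 2 - x₁ 2 * y₁ 0) * (x₂ 1 * y₂ 3 - x₂ 3 * y₂ 1) +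
        (x₁ 0 * y₁ 3 - x₁ 3 * y₁ 0) * (x₂ 1 * y₂ 2 - x₂ 2 * y₂ 1) +
        (x₁ 1 * y₁ 2 - x₁ 2 * y₁ 1) * (x₂ 0 * y₂ 3 - x₂ 3 * y₂ 0) -
        (x₁ 1 * y₁ 3 - x₁ 3 * y₁ 1) * (x₂ 0 * y₂ 2 - x₂ 2 * y₂ 0) +
        (x₁ 2 * y₁ 3 - x₁ 3 * y₁ 2) * (x₂ 0 * y₂ 1 - x₂ 1 * y₂ 0) := by
      rw [Matrix.det_succ_row_zero]
      simp [Fin.sum_univ_succ, Matrix.det_fin_three, Fin.succAbove]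
      ring
    rw [key]
    simp only [parabolic, plucker, Pi.add_apply, Matrix.cons_val] at hqv hqw hvw
    unfold omega at hω₁ hω₂
    linear_combination hvw - hqv - hqw + (x₁ 0 * y₁ 1 - x₁ 1 * y₁ 0) * hω₂ +
      (x₂ 0 * y₂ 1 - x₂ 1 * y₂ 0) * hω₁
  -- A relation between the four rows, split in two halves, gives a vector common to both lines.
  obtain ⟨g, hg, h⟩ := Matrix.exists_vecMul_eq_zero_iff.2 hdet
  have hsum : (g 0 • x₁ + g 1 • y₁) + (g 2 • x₂ + g 3 • y₂) = 0 := by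
    rw [← h]
    ext j
    simp [Matrix.vecMul, dotProduct, Fin.sum_univ_four]
    ring
  refine ⟨g 0 • x₁ + g 1 • y₁, fun h0 => ?_, ?_, ?_⟩
  · rw [h0, zero_add] at hsum
    rw [LinearIndependent.pair_iff] at hi₁ hi₂
    have h1 := hi₁ _ _ h0
    have h2 := hi₂ _ _ hsum
    apply hg
    ext i
    fin_cases i
    exacts [h1.1, h1.2, h2.1, h2.2]
  · exact ((incident_plucker_left hω₁).smul_left _).add_left
      ((incident_plucker_right hω₁).smul_left _)
  · have h1 : g 0 • x₁ + g 1 • y₁ = (-g 2) • x₂ + (-g 3) • y₂ := by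
      rw [eq_neg_of_add_eq_zero_left hsum]; module
    rw [h1]
    exact ((incident_plucker_left hω₂).smul_left _).add_left
      ((incident_plucker_right hω₂).smul_left _)

/-- Plücker coordinates of the line of the quadric incident with `x`. -/
def spinMatrix (x : Fin 4 → F) : Fin 5 → Fin 5 → F :=
  ![![0, x 0 * x 1 + x 2 * x 3, x 0 ^ 2, x 2 ^ 2, -(x 0 * x 2)],
    ![-(x 0 * x 1 + x 2 * x 3), 0, x 3 ^ 2, x 1 ^ 2, x 1 * x 3],
    ![-x 0 ^ 2, -x 3 ^ 2, 0, x 0 * x 1 - x 2 * x 3, x 0 * x 3],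
    ![-x 2 ^ 2, -x 1 ^ 2, -(x 0 * x 1 - x 2 * x 3), 0, x 1 * x 2],
    ![x 0 * x 2, -(x 1 * x 3), -(x 0 * x 3), -(x 1 * x 2), 0]]

theorem incident_spinMatrix (x : Fin 4 → F) (i : Fin 5) : Incident x (spinMatrix x i) := by
  fin_cases i <;> simp only [Incident, spinMatrix, Fin.reduceFinMk, Fin.zero_eta, Fin.mk_one,
    Matrix.cons_val] <;> refine ⟨?_, ?_, ?_, ?_⟩ <;> ring

theorem spinMatrix_skew (x : Fin 4 → F) (i j : Fin 5) :
    spinMatrix x i j = -spinMatrix x j i := by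
  fin_cases i <;> fin_cases j <;> simp [spinMatrix]

/-- The square of every coordinate of x is an entry of the matrix, so x ≠ 0 supplies a pivot m i j.
The identity shows that rows i and j span all v incident with x. -/
theorem exists_spinMatrix_ne_zero {x : Fin 4 → F} (hx : x ≠ 0) :
    ∃ i j, spinMatrix x i j ≠ 0 ∧ ∀ v, Incident x v →
      spinMatrix x i j • v = v j • spinMatrix x i - v i • spinMatrix x j := by
  rcases exists_ne_zero_fin_four hx with h | h | h | h
  · refine ⟨0, 2, pow_ne_zero 2 h, fun v ⟨h1, h2, h3, h4⟩ => ?_⟩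
    ext k
    fin_cases k <;> simp [spinMatrix]
    · ring
    · linear_combination x 0 * h2 - x 3 * h3
    · ring
    · linear_combination x 0 * h1 - x 2 * h3
    · linear_combination x 0 * h3
  · refine ⟨1, 3, pow_ne_zero 2 h, fun v ⟨h1, h2, h3, h4⟩ => ?_⟩
    ext k
    fin_cases k <;> simp [spinMatrix]
    · linear_combination x 1 * h1 - x 2 * h4
    · ring
    · linear_combination x 3 * h4 - x 1 * h2
    · ring
    · linear_combination x 1 * h4
  · refine ⟨0, 3, pow_ne_zero 2 h, fun v ⟨h1, h2, h3, h4⟩ => ?_⟩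
    ext k
    fin_cases k <;> simp [spinMatrix]
    · ring
    · linear_combination x 2 * h4 - x 1 * h1
    · linear_combination x 2 * h3 - x 0 * h1
    · ring
    · linear_combination x 2 * h1
  · refine ⟨1, 2, pow_ne_zero 2 h, fun v ⟨h1, h2, h3, h4⟩ => ?_⟩
    ext k
    fin_cases k <;> simp [spinMatrix]
    · linear_combination x 3 * h3 - x 0 * h2
    · ring
    · ring
    · linear_combination x 1 * h2 - x 3 * h4
    · linear_combination x 3 * h2

end Incidence

/-! ### Coordinates of bivectors -/

section Bivector

variable {F : Type*} [Field F] {V : Type*} [AddCommGroup V] [Module F V]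
  (b : Module.Basis (Fin 5) F V)

/-- The bivector with coordinates `m i j`, `i < j`. -/
noncomputable def bivector (m : Fin 5 → Fin 5 → F) : ⋀[F]^2 V :=
  m 0 1 • wedge (b 0) (b 1) + m 0 2 • wedge (b 0) (b 2) + m 0 3 • wedge (b 0) (b 3) +
  m 0 4 • wedge (b 0) (b 4) + m 1 2 • wedge (b 1) (b 2) + m 1 3 • wedge (b 1) (b 3) +
  m 1 4 • wedge (b 1) (b 4) + m 2 3 • wedge (b 2) (b 3) + m 2 4 • wedge (b 2) (b 4) +
  m 3 4 • wedge (b 3) (b 4)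

theorem wedge_sum_eq_bivector (v w : Fin 5 → F) :
    wedge (∑ i, v i • b i) (∑ i, w i • b i) = bivector b fun i j => v i * w j - v j * w i := by
  simp only [Fin.sum_univ_five, map_add, map_smul, LinearMap.add_apply, LinearMap.smul_apply,
    wedge_self, bivector]
  rw [wedge_swap (b 0) (b 1), wedge_swap (b 0) (b 2), wedge_swap (b 0) (b 3),
    wedge_swap (b 0) (b 4), wedge_swap (b 1) (b 2), wedge_swap (b 1) (b 3),
    wedge_swap (b 1) (b 4), wedge_swap (b 2) (b 3), wedge_swap (b 2) (b 4),
    wedge_swap (b 3) (b 4)]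
  module

theorem wedgeDual_bivector (m : Fin 5 → Fin 5 → F) {i j : Fin 5} (hij : i < j) :
    wedgeDual (b.coord i) (b.coord j) (bivector b m) = m i j := by
  simp only [bivector, map_add, map_smul, wedgeDual_wedge, Module.Basis.coord_apply,
    Module.Basis.repr_self, smul_eq_mul]
  fin_cases i <;> fin_cases j <;> first | (exact absurd hij (by decide)) | simp

end Bivector

/-! ### The duality as a correspondence between V₀ and V -/

section Correspondence

variable {F : Type*} [Field F] {V V₀ : Type*} [AddCommGroup V] [Module F V] [AddCommGroup V₀]
  [Module F V₀] (b : Module.Basis (Fin 5) F V) (E : Module.Basis (Fin 4) F V₀)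

/-- The line of the quadric corresponding to a vector of `V₀`. -/
def quadricLine (x : V₀) : Submodule F V where
  carrier := {w | Incident (E.equivFun x) (b.equivFun w)}
  add_mem' hv hw := by simpa using hv.add_right hw
  zero_mem' := by simp [incident_zero_right]
  smul_mem' a v hv := by simpa using hv.smul_right a

/-- The totally isotropic line corresponding to a singular vector. -/
def symplecticLine (v : V) : Submodule F V₀ where
  carrier := {x | Incident (E.equivFun x) (b.equivFun v)}
  add_mem' hv hw := by simpa using hv.add_left hw
  zero_mem' := by simp [incident_zero_left]
  smul_mem' a v hv := by simpa using hv.smul_left a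

/-- The standard alternating form with respect to a basis. -/
noncomputable def standardAlt : LinearMap.BilinForm F V₀ :=
  LinearMap.mk₂ F (fun x y => omega (E.equivFun x) (E.equivFun y))
    (fun x x' y => by simp [omega]; ring) (fun c x y => by simp [omega]; ring)
    (fun x y y' => by simp [omega]; ring) (fun c x y => by simp [omega]; ring)

theorem standardAlt_apply (x y : V₀) :
    standardAlt E x y = omega (E.equivFun x) (E.equivFun y) := rfl

theorem standardAlt_isAlt : (standardAlt E).IsAlt := fun x => by
  rw [standardAlt_apply, omega]; ring

theorem standardAlt_nondegenerate : (standardAlt E).Nondegenerate := by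
  refine (LinearMap.IsRefl.nondegenerate_iff_separatingLeft
    (LinearMap.IsAlt.isRefl (standardAlt_isAlt E))).2 fun x hx => ?_
  rw [← E.equivFun.map_eq_zero_iff]
  ext i
  have h0 := hx (E 0)
  have h1 := hx (E 1)
  have h2 := hx (E 2)
  have h3 := hx (E 3)
  simp [standardAlt_apply, omega] at h0 h1 h2 h3
  fin_cases i <;> simp [*]

variable {χ : QuadraticForm F V} {c : F}

theorem apply_eq_parabolic (hform : ∀ v : Fin 5 → F, χ (∑ i, v i • b i) = c * parabolic v) (v : V) :
    χ v = c * parabolic (b.equivFun v) := by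
  rw [← hform, b.sum_equivFun]

theorem linearIndependent_equivFun_pair {n : ℕ} {W : Type*} [AddCommGroup W] [Module F W]
    (e : Module.Basis (Fin n) F W) {x y : W} :
    LinearIndependent F ![e.equivFun x, e.equivFun y] ↔ LinearIndependent F ![x, y] := by
  simp only [LinearIndependent.pair_iff, ← map_smul, ← map_add, LinearEquiv.map_eq_zero_iff]

/-- The pivot rows i and j form a frame. Applying the pivot identity to the rows themselves gives m
i k m j l - m i l m j k = m i j m k l, so the wedge of the frame is the pivot times the bivector of
m. -/
theorem quadricLine_spec {x : V₀} (hx : x ≠ 0) :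
    ∃ v w, LinearIndependent F ![v, w] ∧ quadricLine b E x = Submodule.span F {v, w} ∧
      ∃ a : F, a ≠ 0 ∧ wedge v w = a • bivector b (spinMatrix (E.equivFun x)) := by
  have hx' : E.equivFun x ≠ 0 := by simpa using hx
  obtain ⟨i, j, hij, h⟩ := exists_spinMatrix_ne_zero hx'
  set m := spinMatrix (E.equivFun x) with hm
  have hdiag : ∀ i, m i i = 0 := fun i => by fin_cases i <;> rfl
  have hskew : ∀ i j, m i j = -m j i := spinMatrix_skew _
  refine ⟨b.equivFun.symm (m i), b.equivFun.symm (m j), ?_, ?_, m i j, hij, ?_⟩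
  · rw [← linearIndependent_equivFun_pair b, LinearIndependent.pair_iff]
    intro s t hst
    simp only [LinearEquiv.apply_symm_apply] at hst
    have h1 := congrFun hst j
    have h2 := congrFun hst i
    simp only [Pi.add_apply, Pi.smul_apply, smul_eq_mul, Pi.zero_apply, hdiag] at h1 h2
    rw [hskew j i] at h2
    constructor
    · simpa [hij] using h1
    · simpa [hij] using h2
  · apply le_antisymm
    · intro v hv
      have h1 : m i j • v = b.equivFun v j • b.equivFun.symm (m i) -
          b.equivFun v i • b.equivFun.symm (m j) := by
        apply b.equivFun.injective
        simpa only [map_smul, map_sub, LinearEquiv.apply_symm_apply] using h _ hv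
      rw [← Submodule.smul_mem_iff _ hij, h1]
      exact sub_mem (Submodule.smul_mem _ _ (Submodule.subset_span (by simp)))
        (Submodule.smul_mem _ _ (Submodule.subset_span (by simp)))
    · rw [Submodule.span_le]
      rintro v (rfl | rfl) <;>
      · change Incident _ _
        rw [LinearEquiv.apply_symm_apply]
        exact incident_spinMatrix _ _
  · rw [b.equivFun_symm_apply, b.equivFun_symm_apply, wedge_sum_eq_bivector]
    have key : ∀ k l, m i k * m j l - m i l * m j k = m i j * m k l := by
      intro k l
      have := congrFun (h _ (incident_spinMatrix (E.equivFun x) k)) l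
      simp only [← hm, Pi.sub_apply, Pi.smul_apply, smul_eq_mul] at this
      rw [this, hskew k j, hskew k i]
      ring
    simp only [key, bivector]
    module

theorem quadricLine_mem_singularLines
    (hform : ∀ v : Fin 5 → F, χ (∑ i, v i • b i) = c * parabolic v) {x : V₀} (hx : x ≠ 0) :
    quadricLine b E x ∈ singularLines χ := by
  obtain ⟨v, w, hi, h, -⟩ := quadricLine_spec b E hx
  refine ⟨finrank_eq_two_iff_span.2 ⟨v, w, hi, h⟩, fun u hu => ?_⟩
  rw [apply_eq_parabolic b hform, Incident.parabolic_eq_zero hu (by simpa using hx), mul_zero]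

theorem lineGrassmann_quadricLine {x : V₀} (hx : x ≠ 0) :
    lineGrassmann (quadricLine b E x) =
      Submodule.span F {bivector b (spinMatrix (E.equivFun x))} := by
  obtain ⟨v, w, hi, h, a, ha, hw⟩ := quadricLine_spec b E hx
  rw [h, lineGrassmann_span_pair, hw]
  exact Submodule.span_singleton_smul_eq (IsUnit.mk0 a ha) _

/-- Two vectors spanning U are singular and orthogonal, so they correspond to isotropic lines with a
common point ⟨x⟩; then U is contained in the line of x, and dimensions agree. -/
theorem exists_eq_quadricLine
    (hform : ∀ v : Fin 5 → F, χ (∑ i, v i • b i) = c * parabolic v) (hc : c ≠ 0)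
    {U : Submodule F V} (hU : U ∈ singularLines χ) : ∃ x : V₀, x ≠ 0 ∧ U = quadricLine b E x := by
  obtain ⟨v, w, hi, rfl⟩ := finrank_eq_two_iff_span.1 hU.1
  have hv : v ∈ Submodule.span F {v, w} := Submodule.subset_span (by simp)
  have hw : w ∈ Submodule.span F {v, w} := Submodule.subset_span (by simp)
  have hq : ∀ u ∈ Submodule.span F {v, w}, parabolic (b.equivFun u) = 0 := fun u hu => by
    simpa [apply_eq_parabolic b hform, hc] using hU.2 u hu
  rw [LinearIndependent.pair_iff] at hi
  have hv0 : v ≠ 0 := fun h => by simpa using hi 1 0 (by simp [h])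
  have hw0 : w ≠ 0 := fun h => by simpa using hi 0 1 (by simp [h])
  obtain ⟨x, hx, hxv, hxw⟩ := exists_incident_of_orthogonal (by simpa using hv0)
    (by simpa using hw0) (hq v hv) (hq w hw) (by rw [← map_add]; exact hq _ (add_mem hv hw))
  have hx0 : E.equivFun.symm x ≠ 0 := (LinearEquiv.map_ne_zero_iff _).2 hx
  have hle : Submodule.span F {v, w} ≤ quadricLine b E (E.equivFun.symm x) := by
    rw [Submodule.span_le]
    rintro u (rfl | rfl) <;>
    · change Incident _ _
      rwa [LinearEquiv.apply_symm_apply]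
  have h2 := (quadricLine_mem_singularLines b E hform hx0).1
  have : Module.Finite F (quadricLine b E (E.equivFun.symm x)) :=
    Module.finite_of_finrank_pos (by omega)
  exact ⟨_, hx0, Submodule.eq_of_le_of_finrank_eq hle (by rw [hU.1, h2])⟩

/-- If x and y were independent, their Plücker vector would be a multiple of both of two independent
vectors of the common line, hence zero. -/
theorem mem_span_of_quadricLine_eq {x y : V₀} (hx : x ≠ 0)
    (h : quadricLine b E x = quadricLine b E y) : y ∈ Submodule.span F {x} := by
  by_contra hy
  have hi : LinearIndependent F ![x, y] := by
    rw [LinearIndependent.pair_iff' hx]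
    rintro a rfl
    exact hy (Submodule.mem_span_singleton.2 ⟨a, rfl⟩)
  obtain ⟨v, w, hvw, hl, -⟩ := quadricLine_spec b E hx
  have hv : v ∈ quadricLine b E x := by rw [hl]; exact Submodule.subset_span (by simp)
  have hw : w ∈ quadricLine b E x := by rw [hl]; exact Submodule.subset_span (by simp)
  have hv' := hv
  have hw' := hw
  rw [h] at hv' hw'
  rw [← linearIndependent_equivFun_pair b, LinearIndependent.pair_iff] at hvw
  have hv0 : b.equivFun v ≠ 0 := fun h => by simpa using hvw 1 0 (by simp [h])
  have hw0 : b.equivFun w ≠ 0 := fun h => by simpa using hvw 0 1 (by simp [h])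
  obtain ⟨hω, s, hs⟩ := omega_eq_zero_of_incident hv0 hv hv'
  obtain ⟨-, t, ht⟩ := omega_eq_zero_of_incident hw0 hw hw'
  have hne := plucker_ne_zero ((linearIndependent_equivFun_pair E).2 hi) hω
  have h3 := hvw s (-t) (by rw [← hs, neg_smul, ← ht, add_neg_cancel])
  rw [hs, h3.1, zero_smul] at hne
  exact hne rfl

theorem symplecticLine_mem_isotropicLines {v : V} (hv : v ≠ 0)
    (hq : parabolic (b.equivFun v) = 0) :
    (symplecticLine b E v) ∈ isotropicLines (standardAlt E) := by
  have hv' : b.equivFun v ≠ 0 := by simpa using hv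
  refine ⟨?_, fun x hx y hy => (omega_eq_zero_of_incident hv' hx hy).1⟩
  obtain ⟨x, y, hi, hω, hp⟩ := exists_plucker_eq hv' hq
  refine finrank_eq_two_iff_span.2 ⟨E.equivFun.symm x, E.equivFun.symm y, ?_, ?_⟩
  · rw [← linearIndependent_equivFun_pair E]
    simpa only [LinearEquiv.apply_symm_apply] using hi
  · apply le_antisymm
    · intro z hz
      change Incident _ _ at hz
      rw [← hp] at hz
      obtain ⟨s, t, hst⟩ := Submodule.mem_span_pair.1 (hz.mem_span hi hω)
      refine Submodule.mem_span_pair.2 ⟨s, t, ?_⟩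
      apply E.equivFun.injective
      simpa only [map_smul, map_add, LinearEquiv.apply_symm_apply] using hst
    · rw [Submodule.span_le]
      rintro u (rfl | rfl) <;> change Incident _ _ <;> rw [LinearEquiv.apply_symm_apply, ← hp]
      · exact incident_plucker_left hω
      · exact incident_plucker_right hω

theorem exists_eq_symplecticLine {T : Submodule F V₀} (hT : T ∈ isotropicLines (standardAlt E)) :
    ∃ v : V, v ≠ 0 ∧ parabolic (b.equivFun v) = 0 ∧ T = symplecticLine b E v := by
  obtain ⟨x, y, hi, rfl⟩ := finrank_eq_two_iff_span.1 hT.1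
  have hω : omega (E.equivFun x) (E.equivFun y) = 0 :=
    hT.2 x (Submodule.subset_span (by simp)) y (Submodule.subset_span (by simp))
  have hi' := (linearIndependent_equivFun_pair E).2 hi
  have hne := plucker_ne_zero hi' hω
  have hx := incident_plucker_left hω
  have hy := incident_plucker_right hω
  set v := b.equivFun.symm (plucker (E.equivFun x) (E.equivFun y)) 
  have hbv : b.equivFun v = plucker (E.equivFun x) (E.equivFun y) :=
    LinearEquiv.apply_symm_apply _ _
  rw [← hbv] at hx hy hne
  have hv0 : v ≠ 0 := by simpa using hne
  rw [LinearIndependent.pair_iff] at hi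
  have hx0 : x ≠ 0 := fun h => by simpa using hi 1 0 (by simp [h])
  have hq := hx.parabolic_eq_zero (by simpa using hx0)
  have hle : Submodule.span F {x, y} ≤ symplecticLine b E v := by
    rw [Submodule.span_le]
    rintro u (rfl | rfl)
    exacts [hx, hy]
  have h2 := (symplecticLine_mem_isotropicLines b E hv0 hq).1
  have : Module.Finite F (symplecticLine b E v) := Module.finite_of_finrank_pos (by omega)
  exact ⟨v, hv0, hq, Submodule.eq_of_le_of_finrank_eq hle (by rw [hT.1, h2])⟩

end Correspondence

/-! ### The explicit linear projection and its kernel -/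

section SymToWedge

variable {F : Type*} [Field F] {V V₀ : Type*} [AddCommGroup V] [Module F V] [AddCommGroup V₀]
  [Module F V₀] (b : Module.Basis (Fin 5) F V)
  (E : Module.Basis (Fin 4) F V₀)
  (E' : Module.Basis {ij : Fin 4 × Fin 4 // ij.1 ≤ ij.2} F (SymSquare F V₀))

/-- The linear map from the symmetrized tensor square of `V₀` to `V ∧ V` mapping the image of `x`
under the veronesean map to the bivector of the line of the quadric corresponding to `x`. -/
noncomputable def symToWedge : SymSquare F V₀ →ₗ[F] ⋀[F]^2 V :=
  E'.constr F fun ij => (![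
    ![wedge (b 0) (b 2), wedge (b 0) (b 1) + wedge (b 2) (b 3), -wedge (b 0) (b 4),
      wedge (b 2) (b 4)],
    ![0, wedge (b 1) (b 3), wedge (b 3) (b 4), wedge (b 1) (b 4)],
    ![0, 0, wedge (b 0) (b 3), wedge (b 0) (b 1) - wedge (b 2) (b 3)],
    ![0, 0, 0, wedge (b 1) (b 2)]] : Fin 4 → Fin 4 → ⋀[F]^2 V) ij.1.1 ij.1.2

theorem symToWedge_sum (t : {ij : Fin 4 × Fin 4 // ij.1 ≤ ij.2} → F) :
    symToWedge b E' (∑ ij, t ij • E' ij) = bivector b ![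
      ![0, t ⟨(0, 1), by decide⟩ + t ⟨(2, 3), by decide⟩, t ⟨(0, 0), by decide⟩,
        t ⟨(2, 2), by decide⟩, -t ⟨(0, 2), by decide⟩],
      ![0, 0, t ⟨(3, 3), by decide⟩, t ⟨(1, 1), by decide⟩, t ⟨(1, 3), by decide⟩],
      ![0, 0, 0, t ⟨(0, 1), by decide⟩ - t ⟨(2, 3), by decide⟩, t ⟨(0, 3), by decide⟩],
      ![0, 0, 0, 0, t ⟨(1, 2), by decide⟩],
      ![0, 0, 0, 0, 0]] := by
  rw [sum_fin_four_le]
  simp only [map_add, map_smul, symToWedge, Module.Basis.constr_basis, bivector,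
    Matrix.cons_val]
  module

theorem symToWedge_veroneseMap (x : V₀) :
    symToWedge b E' (veroneseMap E E' x) = bivector b (spinMatrix (E.equivFun x)) := by
  rw [veroneseMap_apply, symToWedge_sum b E' fun ij => E.repr x ij.1.1 * E.repr x ij.1.2]
  simp only [bivector, spinMatrix, Matrix.cons_val, Module.Basis.equivFun_apply]
  module

/-- Every coordinate of t except those at (0, 1) and (2, 3) appears alone, up to sign, as a
coordinate of the image; these two appear only through their sum and difference. -/
theorem repr_of_symToWedge_eq_zero {t : SymSquare F V₀} (ht : symToWedge b E' t = 0) :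
    E'.repr t ⟨(0, 1), by decide⟩ + E'.repr t ⟨(2, 3), by decide⟩ = 0 ∧
    E'.repr t ⟨(0, 1), by decide⟩ - E'.repr t ⟨(2, 3), by decide⟩ = 0 ∧
    t = E'.repr t ⟨(0, 1), by decide⟩ • E' ⟨(0, 1), by decide⟩ +
      E'.repr t ⟨(2, 3), by decide⟩ • E' ⟨(2, 3), by decide⟩ := by
  have h := symToWedge_sum b E' (E'.repr t)
  rw [E'.sum_repr, ht] at h
  have hm := fun (i j : Fin 5) (hij : i < j) => congrArg (wedgeDual (b.coord i) (b.coord j)) h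
  have h01 := hm 0 1 (by decide)
  have h02 := hm 0 2 (by decide)
  have h03 := hm 0 3 (by decide)
  have h04 := hm 0 4 (by decide)
  have h12 := hm 1 2 (by decide)
  have h13 := hm 1 3 (by decide)
  have h14 := hm 1 4 (by decide)
  have h23 := hm 2 3 (by decide)
  have h24 := hm 2 4 (by decide)
  have h34 := hm 3 4 (by decide)
  rw [wedgeDual_bivector b _ (by decide), map_zero] at h01 h02 h03 h04 h12 h13 h14 h23 h24 h34
  simp only [Matrix.cons_val] at h01 h02 h03 h04 h12 h13 h14 h23 h24 h34
  refine ⟨h01.symm, h23.symm, ?_⟩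
  conv_lhs => rw [← E'.sum_repr t, sum_fin_four_le]
  rw [← h02, ← h03, neg_eq_zero.1 h04.symm, ← h12, ← h13, ← h14, ← h24, ← h34]
  module

theorem symToWedge_injective (h2 : (2 : F) ≠ 0) : Function.Injective (symToWedge b E') := by
  rw [← LinearMap.ker_eq_bot, LinearMap.ker_eq_bot']
  intro t ht
  obtain ⟨h1, h3, h4⟩ := repr_of_symToWedge_eq_zero b E' ht
  have e1 : 2 * E'.repr t ⟨(0, 1), by decide⟩ = 0 := by linear_combination h1 + h3
  have e2 : 2 * E'.repr t ⟨(2, 3), by decide⟩ = 0 := by linear_combination h1 - h3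
  rw [mul_eq_zero, or_iff_right h2] at e1 e2
  rw [h4, e1, e2, zero_smul, zero_smul, add_zero]

theorem finrank_ker_symToWedge (h2 : (2 : F) = 0) :
    Module.finrank F (LinearMap.ker (symToWedge b E')) = 1 := by
  refine finrank_eq_one_iff_span.2
    ⟨E' ⟨(0, 1), by decide⟩ + E' ⟨(2, 3), by decide⟩, fun h => ?_, le_antisymm ?_ ?_⟩
  · have := congrArg (fun t => E'.repr t ⟨(0, 1), by decide⟩) h
    simp at this
  · intro t ht
    obtain ⟨h1, h3, h4⟩ := repr_of_symToWedge_eq_zero b E' ht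
    refine Submodule.mem_span_singleton.2 ⟨E'.repr t ⟨(0, 1), by decide⟩, ?_⟩
    conv_rhs => rw [h4]
    rw [smul_add, sub_eq_zero.1 h3]
  · rw [Submodule.span_singleton_le_iff_mem, LinearMap.mem_ker, map_add]
    simp only [symToWedge, Module.Basis.constr_basis, Matrix.cons_val]
    calc _ = (2 : F) • wedge (b 0) (b 1) := by module
      _ = 0 := by rw [h2, zero_smul]

end SymToWedge

/-! ### Construction of a symplectic embedding -/

section Existence

variable {F : Type*} [Field F] {P : Type*} {Γ : PointLineGeometry P} {V V₀ : Type*}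
  [AddCommGroup V] [Module F V] [AddCommGroup V₀] [Module F V₀]

theorem IsSymplecticEmbedding.exists_point {α : LinearMap.BilinForm F V₀} {ε₀ : P → Submodule F V₀}
    (h : IsSymplecticEmbedding Γ α ε₀) {x : V₀} (hx : x ≠ 0) :
    ∃ p, ε₀ p = Submodule.span F {x} := by
  have : Submodule.span F {x} ∈ isotropicPoints α := 
    ⟨finrank_span_singleton hx, fun u _ => h.isAlt u⟩
  rw [← h.image.1] at this
  exact this

theorem finrank_symSquare
    (E' : Module.Basis {ij : Fin 4 × Fin 4 // ij.1 ≤ ij.2} F (SymSquare F V₀)) :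
    Module.finrank F (SymSquare F V₀) = 10 := by
  rw [Module.finrank_eq_card_basis E']
  decide

theorem isSymplecticEmbedding_of_points {α : LinearMap.BilinForm F V₀} (halt : α.IsAlt)
    (hnd : α.Nondegenerate) {ε₀ : P → Submodule F V₀} (hinj : Function.Injective ε₀)
    (hrange : Set.range ε₀ = {x : Submodule F V₀ | Module.finrank F x = 1})
    (hlines : (fun l : Set P => ε₀ '' l) '' Γ.lines = projPoints '' isotropicLines α) :
    IsSymplecticEmbedding Γ α ε₀ := by
  have hl : ∀ l ∈ Γ.lines, ∃ T ∈ isotropicLines α, ε₀ '' l = projPoints T := by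
    intro l hl
    have : ε₀ '' l ∈ projPoints '' isotropicLines α := by rw [← hlines]; exact ⟨l, hl, rfl⟩
    obtain ⟨T, hT, h⟩ := this
    exact ⟨T, hT, h.symm⟩
  refine ⟨halt, hnd, ⟨⟨fun p => ?_, hinj, fun l hl' => ?_, fun l hl' => ?_, ?_⟩, fun l hl' => ?_⟩,
    ?_, hlines⟩
  · have : ε₀ p ∈ Set.range ε₀ := ⟨p, rfl⟩
    rw [hrange] at this
    exact this
  · obtain ⟨T, hT, h⟩ := hl l hl'
    rw [h, sSup_projPoints, hT.1]
  · obtain ⟨T, hT, h⟩ := hl l hl'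
    rw [h, sSup_projPoints, hrange]
    exact Set.inter_eq_left.2 fun x hx => hx.1
  · have : {x : Submodule F V₀ | Module.finrank F x = 1} = projPoints ⊤ := by
      ext x; simp [projPoints]
    rw [hrange, this, sSup_projPoints]
  · obtain ⟨T, hT, h⟩ := hl l hl'
    rw [h, sSup_projPoints]
  · rw [hrange]
    ext x
    exact ⟨fun h => ⟨h, fun u _ => halt u⟩, fun h => h.1⟩

/-- A point p goes to the ⟨x⟩ whose quadric line is ε(L(p)). With ε(l) = ⟨v⟩, both p ∈ l and x ∈
`symplecticLine b E v` express the single relation `Incident`, read in its two arguments; hence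
lines go to isotropic lines. -/
theorem exists_symplecticEmbedding (hΓ : IsSymplecticQuadrangle F Γ) {χ : QuadraticForm F V}
    {ε : Γ.lines → Submodule F V} (hε : IsProjectiveEmbedding Γ.dual ε)
    (hεχ : HasImage Γ.dual ε (singularPoints χ) (singularLines χ))
    (b : Module.Basis (Fin 5) F V) {c : F} (hc : c ≠ 0)
    (hform : ∀ v : Fin 5 → F, χ (∑ i, v i • b i) = c * parabolic v)
    (E : Module.Basis (Fin 4) F V₀)
    (E' : Module.Basis {ij : Fin 4 × Fin 4 // ij.1 ≤ ij.2} F (SymSquare F V₀)) :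
    ∃ ε₀ : P → Submodule F V₀, IsSymplecticEmbedding Γ (standardAlt E) ε₀ ∧
      ∀ p, (veroneseEmbedding E E' ε₀ p).map (symToWedge b E') = grassmannEmbedding Γ ε p := by
  have hX : ∀ p, ∃ x : V₀, x ≠ 0 ∧ pencilSpan Γ ε p = quadricLine b E x := fun p =>
    exists_eq_quadricLine b E hform hc (pencilSpan_mem_singularLines hε hεχ p)
  choose X hX0 hX using hX
  have hrange : Set.range (fun p => Submodule.span F {X p}) =
      {x : Submodule F V₀ | Module.finrank F x = 1} := by
    ext U
    constructor
    · rintro ⟨p, rfl⟩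
      exact finrank_span_singleton (hX0 p)
    · intro hU
      obtain ⟨x, hx, rfl⟩ := finrank_eq_one_iff_span.1 hU
      obtain ⟨p, hp⟩ := exists_pencilSpan_eq hε hεχ (quadricLine_mem_singularLines b E hform hx)
      refine ⟨p, Submodule.eq_of_le_of_finrank_eq ?_ ?_⟩
      · rw [Submodule.span_singleton_le_iff_mem]
        exact mem_span_of_quadricLine_eq b E hx (by rw [← hp, hX])
      · rw [finrank_span_singleton hx, finrank_span_singleton (hX0 p)]
  have himage : ∀ (l : Γ.lines) (v : V), ε l = Submodule.span F {v} →
      (fun p => Submodule.span F {X p}) '' l.1 = projPoints (symplecticLine b E v) := by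
    intro l v hv
    have hmem : ∀ p, p ∈ l.1 ↔ X p ∈ symplecticLine b E v := fun p => by
      rw [mem_iff_le_pencilSpan hε, hX, hv, Submodule.span_singleton_le_iff_mem]
      rfl
    ext U
    constructor
    · rintro ⟨p, hp, rfl⟩
      exact span_singleton_mem_projPoints (hX0 p) ((hmem p).1 hp)
    · rintro ⟨h1, h2⟩
      have : U ∈ Set.range (fun p => Submodule.span F {X p}) := by rw [hrange]; exact h1
      obtain ⟨p, rfl⟩ := this
      exact ⟨p, (hmem p).2 (h2 (Submodule.mem_span_singleton_self _)), rfl⟩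
  refine ⟨fun p => Submodule.span F {X p}, isSymplecticEmbedding_of_points (standardAlt_isAlt E)
    (standardAlt_nondegenerate E) ?_ hrange ?_, fun p => ?_⟩
  · intro p p' h
    apply pencilSpan_injective hΓ hε
    rw [hX, hX]
    have h1 : X p' ∈ Submodule.span F {X p} := by
      have h : Submodule.span F {X p} = Submodule.span F {X p'} := h
      rw [h]; exact Submodule.mem_span_singleton_self _
    obtain ⟨a, ha⟩ := Submodule.mem_span_singleton.1 h1
    have ha0 : a ≠ 0 := by
      rintro rfl
      exact hX0 p' (by rw [← ha, zero_smul])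
    ext v
    constructor
    · intro hv
      change Incident _ _
      rw [← ha, map_smul]
      exact hv.smul_left a
    · intro hv
      have h2 : X p = a⁻¹ • X p' := by rw [← ha, smul_smul, inv_mul_cancel₀ ha0, one_smul]
      change Incident _ _
      rw [h2, map_smul]
      exact hv.smul_left _
  · ext S
    constructor
    · rintro ⟨l, hl, rfl⟩
      obtain ⟨v, hv0, hv, hlv⟩ := exists_singular_span_eq hεχ ⟨l, hl⟩
      refine ⟨_, symplecticLine_mem_isotropicLines b E hv0 ?_, (himage ⟨l, hl⟩ v hlv).symm⟩
      simpa [apply_eq_parabolic b hform, hc] using hv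
    · rintro ⟨T, hT, rfl⟩
      obtain ⟨v, hv0, hv, rfl⟩ := exists_eq_symplecticLine b E hT
      obtain ⟨l, hl⟩ := exists_line_eq_span hεχ hv0
        (by rw [apply_eq_parabolic b hform, hv, mul_zero])
      exact ⟨l.1, l.2, himage l v hl⟩
  · rw [veroneseEmbedding_of_span E E' (ε₀ := fun p => Submodule.span F {X p}) (p := p) rfl,
      Submodule.map_span, Set.image_singleton,
      symToWedge_veroneseMap, ← lineGrassmann_quadricLine b E (hX0 p), ← hX]
    rfl

end Existence

/-! ### Computing a nucleus in coordinates -/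

section NucleusOfBasis

variable {F : Type*} [Field F] {M : Type*} [AddCommGroup M] [Module F M]

theorem isNucleus_of_linearIndependent {S : Set (Submodule F M)} {n : ℕ} {w : Fin n → M}
    (hw : LinearIndependent F w) (hspan : sSup S = Submodule.span F (Set.range w))
    (hpt : ∀ U ∈ S, Module.finrank F U = 1) (Q : QuadraticForm F (Fin n → F))
    (hQ : IsNonsingular Q)
    (hS : ∀ c, c ≠ 0 → (Q c = 0 ↔ Submodule.span F {∑ i, c i • w i} ∈ S)) :
    IsNucleus S ((LinearMap.ker Q.polarBilin).map (Fintype.linearCombination F w)) := by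
  let e₀ : Module.Basis (Fin n) F (Submodule.span F (Set.range w)) := Module.Basis.span hw
  let e : (sSup S : Submodule F M) ≃ₗ[F] (Fin n → F) :=
    (LinearEquiv.ofEq _ _ hspan).trans e₀.equivFun
  have he : ∀ v : (sSup S : Submodule F M), (v : M) = ∑ i, e v i • w i := by
    intro v
    have h1 := congrArg Subtype.val (e₀.sum_equivFun (LinearEquiv.ofEq _ _ hspan v))
    rw [AddSubmonoidClass.coe_finsetSum] at h1
    simp only [Submodule.coe_smul, e₀, Module.Basis.span_apply] at h1
    exact h1.symm
  have hpolar : ∀ v v', QuadraticMap.polar (Q.comp e.toLinearMap) v v' =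
      QuadraticMap.polar Q (e v) (e v') := fun v v' => by
    simp [QuadraticMap.polar]
  refine ⟨Q.comp e.toLinearMap, ?_, ?_, ?_⟩
  · rw [IsNonsingular, eq_bot_iff]
    rintro v ⟨h1, h2⟩
    have : e v ∈ Q.radical := by
      refine ⟨h1, LinearMap.ext fun c => ?_⟩
      have h3 := LinearMap.congr_fun h2 (e.symm c)
      rw [QuadraticMap.polarBilin_apply_apply, hpolar, e.apply_symm_apply] at h3
      exact h3
    rw [hQ] at this
    exact e.map_eq_zero_iff.1 this
  · ext U
    constructor
    · intro hU
      obtain ⟨u, hu, rfl⟩ := finrank_eq_one_iff_span.1 (hpt U hU)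
      have hmem : u ∈ sSup S := (le_sSup hU) (Submodule.mem_span_singleton_self u)
      have hne : (⟨u, hmem⟩ : (sSup S : Submodule F M)) ≠ 0 := fun h =>
        hu (congrArg Subtype.val h)
      refine ⟨Submodule.span F {⟨u, hmem⟩}, ⟨finrank_span_singleton hne, fun v hv => ?_⟩, ?_⟩
      · obtain ⟨a, rfl⟩ := Submodule.mem_span_singleton.1 hv
        have h1 : Q (e ⟨u, hmem⟩) = 0 := by
          rw [hS _ ((LinearEquiv.map_ne_zero_iff _).2 hne), ← he]
          exact hU
        rw [QuadraticMap.map_smul, QuadraticMap.comp_apply]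
        simp [h1]
      · rw [Submodule.map_span, Set.image_singleton]; rfl
    · rintro ⟨U', ⟨h1, h2⟩, rfl⟩
      obtain ⟨v, hv, rfl⟩ := finrank_eq_one_iff_span.1 h1
      have h3 : Q (e v) = 0 := h2 v (Submodule.mem_span_singleton_self v)
      rw [hS _ ((LinearEquiv.map_ne_zero_iff _).2 hv), ← he] at h3
      rw [Submodule.map_span, Set.image_singleton]
      exact h3
  · ext u
    constructor
    · rintro ⟨c, hc, rfl⟩
      refine ⟨e.symm c, ?_, ?_⟩
      · refine LinearMap.mem_ker.2 (LinearMap.ext fun v => ?_)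
        rw [QuadraticMap.polarBilin_apply_apply, hpolar, e.apply_symm_apply]
        exact LinearMap.congr_fun hc (e v)
      · rw [Submodule.subtype_apply, he, e.apply_symm_apply, Fintype.linearCombination_apply]
    · rintro ⟨v, hv, rfl⟩
      refine ⟨e v, ?_, ?_⟩
      · refine LinearMap.mem_ker.2 (LinearMap.ext fun c => ?_)
        have h3 := LinearMap.congr_fun hv (e.symm c)
        rw [QuadraticMap.polarBilin_apply_apply, hpolar, e.apply_symm_apply] at h3
        exact h3
      · rw [Submodule.subtype_apply, he v, Fintype.linearCombination_apply]

theorem map_linearCombination_span_single {n : ℕ} (w : Fin n → M) (i : Fin n) :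
    (Submodule.span F {Pi.single i (1 : F)}).map (Fintype.linearCombination F w) =
      Submodule.span F {w i} := by
  rw [Submodule.map_span, Set.image_singleton, Fintype.linearCombination_apply_single, one_smul]

end NucleusOfBasis

/-! ### Conics on the veronesean -/

section Conics

variable {F : Type*} [Field F] {V₀ : Type*} [AddCommGroup V₀] [Module F V₀]
  (E : Module.Basis (Fin 4) F V₀)
  (E' : Module.Basis {ij : Fin 4 × Fin 4 // ij.1 ≤ ij.2} F (SymSquare F V₀))

theorem exists_dual_pair {x y : V₀} (h : LinearIndependent F ![x, y]) :
    ∃ f g : Module.Dual F V₀, f x = 1 ∧ f y = 0 ∧ g x = 0 ∧ g y = 1 := by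
  have key : ∀ {x y : V₀}, LinearIndependent F ![x, y] →
      ∃ f : Module.Dual F V₀, f x = 1 ∧ f y = 0 := by
    intro x y h
    rw [LinearIndependent.pair_iff] at h
    have hx : x ∉ Submodule.span F {y} := fun hx => by
      obtain ⟨a, rfl⟩ := Submodule.mem_span_singleton.1 hx
      simpa using h 1 (-a) (by module)
    obtain ⟨f, hf, hp⟩ := Submodule.exists_dual_map_eq_bot_of_notMem hx inferInstance
    have hy : f y = 0 := by
      have : f y ∈ (Submodule.span F {y}).map f := ⟨y, Submodule.mem_span_singleton_self y, rfl⟩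
      rwa [hp, Submodule.mem_bot] at this
    exact ⟨(f x)⁻¹ • f, by simp [hf], by simp [hy]⟩
  obtain ⟨f, hf⟩ := key h
  obtain ⟨g, hg⟩ := key (LinearIndependent.pair_symm_iff.1 h)
  exact ⟨f, g, hf.1, hf.2, hg.2, hg.1⟩

/-- For f, g dual to x, y, the functionals of f·f, g·g and f·g isolate the three coefficients. -/
theorem linearIndependent_conic {x y : V₀} (h : LinearIndependent F ![x, y]) :
    LinearIndependent F ![veroneseMap E E' x, veroneseMap E E' y,
      QuadraticMap.polar (veroneseMap E E') x y] := by
  obtain ⟨f, g, hfx, hfy, hgx, hgy⟩ := exists_dual_pair h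
  rw [Fintype.linearIndependent_iff]
  intro c hc
  have h1 := congrArg (symDual E E' f f) hc
  have h2 := congrArg (symDual E E' g g) hc
  have h3 := congrArg (symDual E E' f g) hc
  simp [Fin.sum_univ_three, hfx, hfy, hgx, hgy] at h1 h2 h3
  intro i
  fin_cases i <;> assumption

theorem veroneseMap_combination (x y : V₀) (s t : F) :
    veroneseMap E E' (s • x + t • y) = (s ^ 2) • veroneseMap E E' x +
      (t ^ 2) • veroneseMap E E' y + (s * t) • QuadraticMap.polar (veroneseMap E E') x y := by
  rw [QuadraticMap.map_add (veroneseMap E E'), QuadraticMap.map_smul, QuadraticMap.map_smul,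
    QuadraticMap.polar_smul_left, QuadraticMap.polar_smul_right, smul_smul, pow_two, pow_two]

/-- The conic `Z² - XY`. -/
noncomputable def conicForm : QuadraticForm F (Fin 3 → F) :=
  QuadraticMap.linMulLin (LinearMap.proj 2) (LinearMap.proj 2) -
    QuadraticMap.linMulLin (LinearMap.proj 0) (LinearMap.proj 1)

theorem conicForm_apply (c : Fin 3 → F) : conicForm c = c 2 * c 2 - c 0 * c 1 := rfl

theorem ker_polarBilin_conicForm (h2 : (2 : F) = 0) :
    LinearMap.ker (conicForm (F := F)).polarBilin = Submodule.span F {Pi.single 2 1} := by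
  have hp : ∀ c d : Fin 3 → F, QuadraticMap.polar conicForm c d = -(c 0 * d 1 + c 1 * d 0) := by
    intro c d
    simp only [QuadraticMap.polar, conicForm_apply, Pi.add_apply]
    linear_combination (c 2 * d 2) * h2
  ext c
  rw [LinearMap.mem_ker, Submodule.mem_span_singleton]
  constructor
  · intro h
    have h0 := LinearMap.congr_fun h (Pi.single 0 1)
    have h1 := LinearMap.congr_fun h (Pi.single 1 1)
    simp [hp] at h0 h1
    refine ⟨c 2, ?_⟩
    ext i
    fin_cases i <;> simp [h0, h1]
  · rintro ⟨a, rfl⟩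
    ext i
    simp [hp]

theorem isNonsingular_conicForm (h2 : (2 : F) = 0) : IsNonsingular (conicForm (F := F)) := by
  rw [IsNonsingular, eq_bot_iff]
  rintro c ⟨h1, h3⟩
  rw [← LinearMap.mem_ker, ker_polarBilin_conicForm h2, Submodule.mem_span_singleton] at h3
  obtain ⟨a, rfl⟩ := h3
  simp [conicForm_apply] at h1
  simp [h1]

/-- The image of s x + t y has coordinates (s², t², s t), so the points form the conic Z² = XY, and
in characteristic 2 the radical of its polar form is the Z-axis. -/
theorem isNucleus_conic (h2 : (2 : F) = 0) {x y : V₀} (h : LinearIndependent F ![x, y]) :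
    IsNucleus {U | ∃ z ∈ Submodule.span F {x, y}, z ≠ 0 ∧
      U = Submodule.span F {veroneseMap E E' z}}
      (Submodule.span F {QuadraticMap.polar (veroneseMap E E') x y}) := by
  set S := {U | ∃ z ∈ Submodule.span F {x, y}, z ≠ 0 ∧
      U = Submodule.span F {veroneseMap E E' z}} with hSdef
  have hw := linearIndependent_conic E E' h
  set w := ![veroneseMap E E' x, veroneseMap E E' y,
      QuadraticMap.polar (veroneseMap E E') x y] with hwdef
  have hsum : ∀ s t, veroneseMap E E' (s • x + t • y) =
      ∑ i, (![s ^ 2, t ^ 2, s * t] : Fin 3 → F) i • w i := fun s t => by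
    rw [veroneseMap_combination]; simp [Fin.sum_univ_three, hwdef]
  have hη : ∀ z ∈ Submodule.span F {x, y}, veroneseMap E E' z ∈ sSup S := by
    intro z hz
    by_cases hz0 : z = 0
    · simp [hz0]
    · exact (le_sSup ⟨z, hz, hz0, rfl⟩ : Submodule.span F {veroneseMap E E' z} ≤ sSup S)
        (Submodule.mem_span_singleton_self _)
  have hx : x ∈ Submodule.span F {x, y} := Submodule.subset_span (by simp)
  have hy : y ∈ Submodule.span F {x, y} := Submodule.subset_span (by simp)
  have hnz : ∀ z, z ≠ 0 → veroneseMap E E' z ≠ 0 := by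
    intro z hz h0
    obtain ⟨f, hf⟩ := Module.Projective.exists_dual_eq_one F hz
    have := symDual_veroneseMap E E' f f z
    rw [h0, hf] at this
    simp at this
  have key := isNucleus_of_linearIndependent (S := S) hw ?_ ?_ conicForm
    (isNonsingular_conicForm h2) ?_
  · rw [ker_polarBilin_conicForm h2, map_linearCombination_span_single] at key
    exact key
  · refine le_antisymm (sSup_le ?_) (Submodule.span_le.2 ?_)
    · rintro _ ⟨z, hz, -, rfl⟩
      obtain ⟨s, t, rfl⟩ := Submodule.mem_span_pair.1 hz
      rw [Submodule.span_singleton_le_iff_mem, hsum]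
      exact Submodule.sum_mem _ fun i _ => Submodule.smul_mem _ _ (Submodule.subset_span ⟨i, rfl⟩)
    · rintro _ ⟨i, rfl⟩
      fin_cases i
      exacts [hη x hx, hη y hy, sub_mem (sub_mem (hη _ (add_mem hx hy)) (hη x hx)) (hη y hy)]
  · rintro _ ⟨z, -, hz, rfl⟩
    exact finrank_span_singleton (hnz z hz)
  · intro c hc
    rw [conicForm_apply]
    constructor
    · intro hq
      -- On the conic, c 0 = 0 forces c 2 = 0 and leaves the image of y. Otherwise the parameters
      -- (s, t) = (c 0, c 2) give c 0 • c, because c 2² = c 0 c 1.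
      by_cases h0 : c 0 = 0
      · have h2 : c 2 = 0 := by simpa [h0] using hq
        have h1 : c 1 ≠ 0 := fun h1 => hc (by ext i; fin_cases i <;> assumption)
        refine ⟨c 1 • y, Submodule.smul_mem _ _ hy, smul_ne_zero h1 ?_, ?_⟩
        · rintro rfl
          rw [LinearIndependent.pair_iff] at h
          simpa using h 0 1 (by simp)
        · have h3 : veroneseMap E E' (c 1 • y) = c 1 • ∑ i, c i • w i := by
            rw [QuadraticMap.map_smul]; simp [Fin.sum_univ_three, h0, h2, hwdef, smul_smul]
          rw [h3, Submodule.span_singleton_smul_eq (IsUnit.mk0 _ h1)]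
      · refine ⟨c 0 • x + c 2 • y, add_mem (Submodule.smul_mem _ _ hx) (Submodule.smul_mem _ _ hy),
          fun h3 => h0 ?_, ?_⟩
        · rw [LinearIndependent.pair_iff] at h
          exact (h _ _ h3).1
        · have h3 : veroneseMap E E' (c 0 • x + c 2 • y) = c 0 • ∑ i, c i • w i := by
            rw [hsum]
            simp only [Fin.sum_univ_three, Matrix.cons_val, smul_add, smul_smul, pow_two]
            rw [sub_eq_zero.1 hq]
          rw [h3, Submodule.span_singleton_smul_eq (IsUnit.mk0 _ h0)]
    · rintro ⟨z, hz, -, hz2⟩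
      obtain ⟨s, t, rfl⟩ := Submodule.mem_span_pair.1 hz
      have h3 : ∑ i, c i • w i ∈ Submodule.span F {veroneseMap E E' (s • x + t • y)} := by
        rw [← hz2]; exact Submodule.mem_span_singleton_self _
      obtain ⟨a, ha⟩ := Submodule.mem_span_singleton.1 h3
      rw [hsum, Finset.smul_sum] at ha
      simp only [smul_smul] at ha
      have h4 := fun i => congrFun (hw.fintypeLinearCombination_injective
        (a₁ := fun i => a * (![s ^ 2, t ^ 2, s * t] : Fin 3 → F) i) (a₂ := c)
        (by simpa [Fintype.linearCombination_apply] using ha)) i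
      rw [← h4 0, ← h4 1, ← h4 2]
      simp only [Matrix.cons_val]
      ring

end Conics

/-! ### Symplectic bases -/

section SymplecticBasis

variable {F : Type*} [Field F] {V₀ : Type*} [AddCommGroup V₀] [Module F V₀]

theorem exists_symplectic_basis (h4 : Module.finrank F V₀ = 4) {α : LinearMap.BilinForm F V₀}
    (halt : α.IsAlt) (hnd : α.Nondegenerate) :
    ∃ e : Module.Basis (Fin 4) F V₀, ∀ x y, α x y = omega (e.equivFun x) (e.equivFun y) := by
  have hfin : Module.Finite F V₀ := Module.finite_of_finrank_pos (by omega)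
  have hone : ∀ x, x ≠ 0 → ∃ y, α x y = 1 := by
    intro x hx
    have : ∃ y, α x y ≠ 0 := by
      by_contra! h
      exact hx (hnd.1 x h)
    obtain ⟨y, hy⟩ := this
    exact ⟨(α x y)⁻¹ • y, by simp [hy]⟩
  have hneg : ∀ x y, α y x = -α x y := fun x y => by rw [halt.neg_eq]
  have hself : ∀ x, α x x = 0 := halt.self_eq_zero
  have : Nontrivial V₀ := Module.nontrivial_of_finrank_pos (R := F) (by omega)
  obtain ⟨x, hx⟩ := exists_ne (0 : V₀)
  obtain ⟨y, hxy⟩ := hone x hx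
  obtain ⟨z, hz, hxz, hyz⟩ : ∃ z, z ≠ 0 ∧ α x z = 0 ∧ α y z = 0 := by
    have h1 := LinearMap.finrank_range_add_finrank_ker ((α x).prod (α y))
    have h2 := Submodule.finrank_le (LinearMap.range ((α x).prod (α y)))
    simp only [Module.finrank_prod, Module.finrank_self] at h2
    have h3 : Nontrivial (LinearMap.ker ((α x).prod (α y))) :=
      Module.nontrivial_of_finrank_pos (R := F) (by omega)
    obtain ⟨⟨z, hz⟩, hz0⟩ := exists_ne (0 : LinearMap.ker ((α x).prod (α y)))
    have hz' : (α x z, α y z) = (0 : F × F) := hz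
    rw [Prod.mk_eq_zero] at hz'
    exact ⟨z, fun h => hz0 (Subtype.ext h), hz'.1, hz'.2⟩
  obtain ⟨t₀, ht₀⟩ := hone z hz
  obtain ⟨t, hzt, hxt, hyt⟩ : ∃ t, α z t = 1 ∧ α x t = 0 ∧ α y t = 0 := by
    refine ⟨t₀ - α x t₀ • y + α y t₀ • x, ?_, ?_, ?_⟩
    · simp [ht₀, hneg x z, hneg y z, hxz, hyz]
    · simp [hself, hxy]
    · simp [hself, hneg x y, hxy]
  have hli : LinearIndependent F ![x, y, z, t] := by
    rw [Fintype.linearIndependent_iff]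
    intro g hg
    have h0 := congrArg (α y) hg
    have h1 := congrArg (α x) hg
    have h2 := congrArg (α t) hg
    have h3 := congrArg (α z) hg
    simp [Fin.sum_univ_four, hself, hxy, hxz, hyz, hxt, hyt, hzt, hneg x y, hneg x z, hneg y z,
      hneg x t, hneg y t, hneg z t] at h0 h1 h2 h3
    intro i
    fin_cases i <;> assumption
  let e := basisOfLinearIndependentOfCardEqFinrank hli (by simp [h4])
  have he : ⇑e = ![x, y, z, t] := coe_basisOfLinearIndependentOfCardEqFinrank _ _
  refine ⟨e, fun v w => ?_⟩
  conv_lhs => rw [← e.sum_equivFun v, ← e.sum_equivFun w]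
  simp only [Fin.sum_univ_four, he, map_add, map_smul, LinearMap.add_apply, LinearMap.smul_apply,
    Matrix.cons_val, smul_eq_mul, hself, hxy, hxz, hyz, hxt, hyt, hzt, hneg x y, hneg x z,
    hneg y z, hneg x t, hneg y t, hneg z t, omega]
  ring

end SymplecticBasis

/-! ### The quadric formed by the nuclei -/

section NucleiQuadric

variable {F : Type*} [Field F]

/-- The form `parabolic` as a quadratic form. -/
noncomputable def parabolicForm : QuadraticForm F (Fin 5 → F) :=
  QuadraticMap.linMulLin (LinearMap.proj 0) (LinearMap.proj 1) +
    QuadraticMap.linMulLin (LinearMap.proj 2) (LinearMap.proj 3) -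
    QuadraticMap.linMulLin (LinearMap.proj 4) (LinearMap.proj 4)

theorem parabolicForm_apply (c : Fin 5 → F) : parabolicForm c = parabolic c := by
  rw [parabolic, pow_two]; rfl

theorem polar_parabolicForm (c d : Fin 5 → F) : QuadraticMap.polar parabolicForm c d =
    c 0 * d 1 + c 1 * d 0 + c 2 * d 3 + c 3 * d 2 - 2 * c 4 * d 4 := by
  simp only [QuadraticMap.polar, parabolicForm_apply, parabolic, Pi.add_apply]
  ring

/-- Pairing with the first four basis vectors returns c 1, c 0, c 3 and c 2, in any characteristic.
-/
theorem eq_smul_single_of_polar_eq_zero {c : Fin 5 → F}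
    (h : ∀ i : Fin 5, i ≠ 4 → QuadraticMap.polar parabolicForm c (Pi.single i 1) = 0) :
    c = c 4 • Pi.single 4 1 := by
  have h0 := h 0 (by decide)
  have h1 := h 1 (by decide)
  have h2 := h 2 (by decide)
  have h3 := h 3 (by decide)
  simp [polar_parabolicForm] at h0 h1 h2 h3
  ext i
  fin_cases i <;> simp [h0, h1, h2, h3]

theorem ker_polarBilin_parabolicForm (h2 : (2 : F) = 0) :
    LinearMap.ker (parabolicForm (F := F)).polarBilin = Submodule.span F {Pi.single 4 1} := by
  ext c
  rw [LinearMap.mem_ker, Submodule.mem_span_singleton]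
  constructor
  · intro h
    exact ⟨c 4, (eq_smul_single_of_polar_eq_zero fun i _ =>
      LinearMap.congr_fun h (Pi.single i 1)).symm⟩
  · rintro ⟨a, rfl⟩
    refine LinearMap.ext fun d => ?_
    rw [QuadraticMap.polarBilin_apply_apply, polar_parabolicForm, h2]
    simp

theorem isNonsingular_parabolicForm (h2 : (2 : F) = 0) :
    IsNonsingular (parabolicForm (F := F)) := by
  rw [IsNonsingular, eq_bot_iff]
  rintro c ⟨h1, h3⟩
  rw [← LinearMap.mem_ker, ker_polarBilin_parabolicForm h2, Submodule.mem_span_singleton] at h3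
  obtain ⟨a, rfl⟩ := h3
  simp [parabolicForm_apply, parabolic] at h1
  simp [h1]

variable {V₀ : Type*} [AddCommGroup V₀] [Module F V₀]
  (E : Module.Basis (Fin 4) F V₀)
  (E' : Module.Basis {ij : Fin 4 × Fin 4 // ij.1 ≤ ij.2} F (SymSquare F V₀))

theorem parabolic_plucker {x y : Fin 4 → F} (h : omega x y = 0) : parabolic (plucker x y) = 0 := by
  simp only [omega, parabolic, plucker, Matrix.cons_val] at h ⊢
  linear_combination (-(x 0 * y 1 - x 1 * y 0)) * h

/-- The points corresponding to the totally isotropic lines. -/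
def polarPoints (α : LinearMap.BilinForm F V₀) : Set (Submodule F (SymSquare F V₀)) :=
  {U | ∃ x y, LinearIndependent F ![x, y] ∧ α x y = 0 ∧
    U = Submodule.span F {QuadraticMap.polar (veroneseMap E E') x y}}

/-- A basis of the span of `polarPoints α`, for a symplectic basis `e` of `V₀`. -/
noncomputable def polarBasis (e : Module.Basis (Fin 4) F V₀) : Fin 5 → SymSquare F V₀ :=
  ![QuadraticMap.polar (veroneseMap E E') (e 0) (e 2),
    QuadraticMap.polar (veroneseMap E E') (e 1) (e 3),
    QuadraticMap.polar (veroneseMap E E') (e 0) (e 3),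
    QuadraticMap.polar (veroneseMap E E') (e 1) (e 2),
    QuadraticMap.polar (veroneseMap E E') (e 0) (e 1) +
      QuadraticMap.polar (veroneseMap E E') (e 2) (e 3)]

theorem linearIndependent_polarBasis (e : Module.Basis (Fin 4) F V₀) :
    LinearIndependent F (polarBasis E E' e) := by
  rw [Fintype.linearIndependent_iff]
  intro c hc
  have h0 := congrArg (symDual E E' (e.coord 0) (e.coord 2)) hc
  have h1 := congrArg (symDual E E' (e.coord 1) (e.coord 3)) hc
  have h2 := congrArg (symDual E E' (e.coord 0) (e.coord 3)) hc
  have h3 := congrArg (symDual E E' (e.coord 1) (e.coord 2)) hc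
  have h4 := congrArg (symDual E E' (e.coord 0) (e.coord 1)) hc
  simp [Fin.sum_univ_five, polarBasis] at h0 h1 h2 h3 h4
  intro i
  fin_cases i <;> assumption

theorem polar_self_of_two_eq_zero (h2 : (2 : F) = 0) (x : V₀) :
    QuadraticMap.polar (veroneseMap E E') x x = 0 := by
  rw [QuadraticMap.polar_self, ← Nat.cast_smul_eq_nsmul F]
  simp [h2]

theorem polar_combination (h2 : (2 : F) = 0) (x y : V₀) (a b c d : F) :
    QuadraticMap.polar (veroneseMap E E') (a • x + b • y) (c • x + d • y) =
      (a * d - b * c) • QuadraticMap.polar (veroneseMap E E') x y := by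
  have hneg : ∀ b : F, -b = b := fun b => by linear_combination -b * h2
  simp only [QuadraticMap.polar_add_left, QuadraticMap.polar_add_right,
    QuadraticMap.polar_smul_left, QuadraticMap.polar_smul_right,
    polar_self_of_two_eq_zero E E' h2, QuadraticMap.polar_comm _ y x, sub_eq_add_neg, hneg]
  module

/-- In characteristic 2 the polar form is alternating and expands like an exterior product. Isotropy
gives p₀₁ = p₂₃, which merges two of the six terms and leaves five. -/
theorem polar_eq_sum_plucker (h2 : (2 : F) = 0) (e : Module.Basis (Fin 4) F V₀) {x y : V₀}
    (h : omega (e.equivFun x) (e.equivFun y) = 0) :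
    QuadraticMap.polar (veroneseMap E E') x y =
      ∑ i, plucker (e.equivFun x) (e.equivFun y) i • polarBasis E E' e i := by
  conv_lhs => rw [← e.sum_equivFun x, ← e.sum_equivFun y]
  set X := e.equivFun x
  set Y := e.equivFun y
  have hneg : ∀ b : F, -b = b := fun b => by linear_combination -b * h2
  have h' : X 2 * Y 3 + X 3 * Y 2 = X 0 * Y 1 + X 1 * Y 0 := by
    unfold omega at h
    linear_combination h + (X 3 * Y 2 - X 0 * Y 1) * h2
  simp only [Fin.sum_univ_four, Fin.sum_univ_five, QuadraticMap.polar_add_left,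
    QuadraticMap.polar_add_right, QuadraticMap.polar_smul_left, QuadraticMap.polar_smul_right,
    polar_self_of_two_eq_zero E E' h2, plucker, polarBasis, Matrix.cons_val, sub_eq_add_neg, hneg]
  rw [QuadraticMap.polar_comm _ (e 1) (e 0), QuadraticMap.polar_comm _ (e 2) (e 0),
    QuadraticMap.polar_comm _ (e 3) (e 0), QuadraticMap.polar_comm _ (e 2) (e 1),
    QuadraticMap.polar_comm _ (e 3) (e 1), QuadraticMap.polar_comm _ (e 3) (e 2), smul_add]
  rw [← sub_eq_zero]
  calc _ = (X 2 * Y 3 + X 3 * Y 2 - (X 0 * Y 1 + X 1 * Y 0)) •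
        QuadraticMap.polar (veroneseMap E E') (e 2) (e 3) := by module
    _ = 0 := by rw [h', sub_self, zero_smul]

variable {α : LinearMap.BilinForm F V₀}

theorem exists_polar_eq_sum (h2 : (2 : F) = 0) {e : Module.Basis (Fin 4) F V₀}
    (he : ∀ x y, α x y = omega (e.equivFun x) (e.equivFun y)) {c : Fin 5 → F} (hc : c ≠ 0)
    (hq : parabolic c = 0) : ∃ x y, LinearIndependent F ![x, y] ∧ α x y = 0 ∧
      QuadraticMap.polar (veroneseMap E E') x y = ∑ i, c i • polarBasis E E' e i := by
  obtain ⟨x, y, hi, hω, rfl⟩ := exists_plucker_eq hc hq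
  refine ⟨e.equivFun.symm x, e.equivFun.symm y, ?_, ?_, ?_⟩
  · rw [← linearIndependent_equivFun_pair e]
    simpa only [LinearEquiv.apply_symm_apply] using hi
  · simpa only [he, LinearEquiv.apply_symm_apply] using hω
  · rw [polar_eq_sum_plucker E E' h2 e] <;> simp only [LinearEquiv.apply_symm_apply, hω]

theorem polar_mem_sSup_polarPoints {x y : V₀} (hi : LinearIndependent F ![x, y])
    (h : α x y = 0) : QuadraticMap.polar (veroneseMap E E') x y ∈ sSup (polarPoints E E' α) :=
  (le_sSup ⟨x, y, hi, h, rfl⟩ :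
    Submodule.span F {QuadraticMap.polar (veroneseMap E E') x y} ≤ sSup (polarPoints E E' α))
    (Submodule.mem_span_singleton_self _)

theorem sSup_polarPoints (h2 : (2 : F) = 0) {e : Module.Basis (Fin 4) F V₀}
    (he : ∀ x y, α x y = omega (e.equivFun x) (e.equivFun y)) :
    sSup (polarPoints E E' α) = Submodule.span F (Set.range (polarBasis E E' e)) := by
  apply le_antisymm
  · refine sSup_le ?_
    rintro _ ⟨x, y, -, h, rfl⟩
    rw [Submodule.span_singleton_le_iff_mem, polar_eq_sum_plucker E E' h2 e (by rw [← he, h])]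
    exact Submodule.sum_mem _ fun i _ => Submodule.smul_mem _ _ (Submodule.subset_span ⟨i, rfl⟩)
  · have hmem : ∀ c : Fin 5 → F, c ≠ 0 → parabolic c = 0 →
        ∑ i, c i • polarBasis E E' e i ∈ sSup (polarPoints E E' α) := by
      intro c hc hq
      obtain ⟨x, y, hi, h, hxy⟩ := exists_polar_eq_sum E E' h2 he hc hq
      rw [← hxy]
      exact polar_mem_sSup_polarPoints E E' hi h
    have hsingle : ∀ i : Fin 5, i ≠ 4 → polarBasis E E' e i ∈ sSup (polarPoints E E' α) := by
      intro i hi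
      have := hmem (Pi.single i 1) (by simp) (by fin_cases i <;> simp_all [parabolic])
      simpa [Pi.single_apply] using this
    rw [Submodule.span_le]
    rintro _ ⟨i, rfl⟩
    by_cases hi : i = 4
    · subst hi
      -- The last basis vector is not singular itself; it is reached from the singular vector (1, 1,
      -- 0, 0, 1).
      have h5 := hmem ![1, 1, 0, 0, 1] (fun h => by simpa using congrFun h 0) (by simp [parabolic])
      have h6 : polarBasis E E' e 4 = ∑ i, (![1, 1, 0, 0, 1] : Fin 5 → F) i • polarBasis E E' e i -
          polarBasis E E' e 0 - polarBasis E E' e 1 := by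
        simp only [Fin.sum_univ_five, Matrix.cons_val]; module
      rw [h6]
      exact sub_mem (sub_mem h5 (hsingle 0 (by decide))) (hsingle 1 (by decide))
    · exact hsingle i hi

theorem isNucleus_polarPoints (h2 : (2 : F) = 0) {e : Module.Basis (Fin 4) F V₀}
    (he : ∀ x y, α x y = omega (e.equivFun x) (e.equivFun y)) :
    IsNucleus (polarPoints E E' α) (Submodule.span F {polarBasis E E' e 4}) := by
  have hw := linearIndependent_polarBasis E E' e
  have key := isNucleus_of_linearIndependent hw (sSup_polarPoints E E' h2 he) ?_ parabolicForm
    (isNonsingular_parabolicForm h2) ?_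
  · rwa [ker_polarBilin_parabolicForm h2, map_linearCombination_span_single] at key
  · rintro _ ⟨x, y, hi, -, rfl⟩
    refine finrank_span_singleton fun h0 => ?_
    exact (linearIndependent_conic E E' hi).ne_zero 2 h0
  · intro c hc
    rw [parabolicForm_apply]
    constructor
    · intro hq
      obtain ⟨x, y, hi, h, hxy⟩ := exists_polar_eq_sum E E' h2 he hc hq
      exact ⟨x, y, hi, h, by rw [hxy]⟩
    · rintro ⟨x, y, hi, h, hxy⟩
      have h3 : ∑ i, c i • polarBasis E E' e i ∈
          Submodule.span F {QuadraticMap.polar (veroneseMap E E') x y} := by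
        rw [← hxy]; exact Submodule.mem_span_singleton_self _
      rw [he] at h
      obtain ⟨a, ha⟩ := Submodule.mem_span_singleton.1 h3
      rw [polar_eq_sum_plucker E E' h2 e h, Finset.smul_sum] at ha
      simp only [smul_smul] at ha
      have h4 := hw.fintypeLinearCombination_injective
        (a₁ := fun i => a * plucker (e.equivFun x) (e.equivFun y) i) (a₂ := c)
        (by simpa only [Fintype.linearCombination_apply] using ha)
      rw [← h4, ← parabolicForm_apply]
      have h5 := parabolic_plucker h
      rw [← parabolicForm_apply] at h5
      change parabolicForm (a • plucker (e.equivFun x) (e.equivFun y)) = 0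
      rw [QuadraticMap.map_smul, h5, smul_zero]

end NucleiQuadric

/-! ### Action of a projection on a single conic -/

section Projection

variable {F : Type*} [Field F] {P : Type*} {Γ : PointLineGeometry P} {V V₀ : Type*}
  [AddCommGroup V] [Module F V] [AddCommGroup V₀] [Module F V₀]

theorem wedge_ne_zero {u w : V} (h : LinearIndependent F ![u, w]) : wedge (F := F) u w ≠ 0 := by
  rw [LinearIndependent.pair_iff] at h
  have hu : u ≠ 0 := fun h0 => by simpa using h 1 0 (by simp [h0])
  intro h0
  obtain ⟨a, rfl⟩ := Submodule.mem_span_singleton.1 (mem_span_of_wedge_eq_zero hu h0)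
  simpa using h a (-1) (by simp)

theorem span_pair_mem_singularLines {χ : QuadraticForm F V} {u w : V}
    (h : LinearIndependent F ![u, w]) (hu : χ u = 0) (hw : χ w = 0)
    (huw : QuadraticMap.polar χ u w = 0) : Submodule.span F {u, w} ∈ singularLines χ := by
  refine ⟨finrank_eq_two_iff_span.2 ⟨u, w, h, rfl⟩, fun v hv => ?_⟩
  obtain ⟨a, b, rfl⟩ := Submodule.mem_span_pair.1 hv
  rw [QuadraticMap.map_add χ, QuadraticMap.map_smul, QuadraticMap.map_smul,
    QuadraticMap.polar_smul_left, QuadraticMap.polar_smul_right, hu, hw, huw]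
  simp

/-- The semilinear map `g` on the symmetrized tensor square maps the veronesean embedding of `Γ`
induced by a symplectic embedding to the Grassmann embedding. -/
structure IsProjection (Γ : PointLineGeometry P) (χ : QuadraticForm F V)
    (ε : Γ.lines → Submodule F V) (E : Module.Basis (Fin 4) F V₀)
    (E' : Module.Basis {ij : Fin 4 × Fin 4 // ij.1 ≤ ij.2} F (SymSquare F V₀))
    (α : LinearMap.BilinForm F V₀) (ε₀ : P → Submodule F V₀) {σ : F →+* F} [RingHomSurjective σ]
    (g : SymSquare F V₀ →ₛₗ[σ] ⋀[F]^2 V) : Prop where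
  dualEmbedding : IsProjectiveEmbedding Γ.dual ε
  dualImage : HasImage Γ.dual ε (singularPoints χ) (singularLines χ)
  symplectic : IsSymplecticEmbedding Γ α ε₀
  map_eq : ∀ p, (veroneseEmbedding E E' ε₀ p).map g = grassmannEmbedding Γ ε p

variable {χ : QuadraticForm F V} {ε : Γ.lines → Submodule F V} {E : Module.Basis (Fin 4) F V₀}
  {E' : Module.Basis {ij : Fin 4 × Fin 4 // ij.1 ≤ ij.2} F (SymSquare F V₀)}
  {α : LinearMap.BilinForm F V₀} {ε₀ : P → Submodule F V₀} {σ : F →+* F} [RingHomSurjective σ]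
  {g : SymSquare F V₀ →ₛₗ[σ] ⋀[F]^2 V}

/-- A quadric line ⟨u, w⟩ through ε(l) is the pencil of some point p of Γ, and containing ε(l) puts
p on l. So every ⟨u ∧ w⟩ of this kind is the image of a point of the conic of l. -/
theorem IsProjection.exists_point (h : IsProjection Γ χ ε E E' α ε₀ g) {l : Γ.lines}
    {T : Submodule F V₀} (hT : ε₀ '' l.1 = projPoints T) {u w : V}
    (hl : ε l = Submodule.span F {u}) (hi : LinearIndependent F ![u, w]) (hu : χ u = 0)
    (hw : χ w = 0) (huw : QuadraticMap.polar χ u w = 0) :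
    ∃ z ∈ T, z ≠ 0 ∧ ∃ a : F, a ≠ 0 ∧ g (veroneseMap E E' z) = a • wedge u w := by
  obtain ⟨p, hp⟩ := exists_pencilSpan_eq h.dualEmbedding h.dualImage
    (span_pair_mem_singularLines hi hu hw huw)
  have hpl : p ∈ l.1 := by
    rw [mem_iff_le_pencilSpan h.dualEmbedding, hl, hp]
    exact Submodule.span_mono (by simp)
  have h1 : ε₀ p ∈ projPoints T := by rw [← hT]; exact ⟨p, hpl, rfl⟩
  obtain ⟨z, hz, hz0, hpz⟩ := mem_projPoints_iff.1 h1
  have h2 := h.map_eq p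
  rw [veroneseEmbedding_of_span E E' hpz, Submodule.map_span, Set.image_singleton] at h2
  change _ = lineGrassmann (pencilSpan Γ ε p) at h2
  rw [hp, lineGrassmann_span_pair] at h2
  have h3 : g (veroneseMap E E' z) ∈ Submodule.span F {wedge u w} := by
    rw [← h2]; exact Submodule.mem_span_singleton_self _
  obtain ⟨a, ha⟩ := Submodule.mem_span_singleton.1 h3
  refine ⟨z, hz, hz0, a, ?_, ha.symm⟩
  rintro rfl
  rw [← ha, zero_smul, Submodule.span_zero_singleton, eq_comm,
    Submodule.span_singleton_eq_bot] at h2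
  exact wedge_ne_zero hi h2

theorem linearIndependent_of_polar {u w w' : V} (hu : u ≠ 0)
    (h : QuadraticMap.polar χ u w' = 0) (h' : QuadraticMap.polar χ w w' ≠ 0) :
    LinearIndependent F ![u, w] := by
  rw [LinearIndependent.pair_iff' hu]
  rintro a rfl
  rw [QuadraticMap.polar_smul_left, h, smul_zero] at h'
  exact h' rfl

/-- In characteristic 2 every line through the nucleus of a conic is a tangent. The image u ∧ w of
the nucleus therefore cannot lie on a line meeting the image conic twice, which forces w to be
orthogonal to each w₁. -/
theorem IsProjection.polar_eq_zero (h : IsProjection Γ χ ε E E' α ε₀ g) (h2 : (2 : F) = 0)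
    {l : Γ.lines} {x y : V₀} (hT : ε₀ '' l.1 = projPoints (Submodule.span F {x, y}))
    (hg : ∀ a b d : F, g (a • veroneseMap E E' x + b • veroneseMap E E' y +
      d • QuadraticMap.polar (veroneseMap E E') x y) = 0 → a = 0 ∧ b = 0 ∧ d = 0)
    {u w w₁ : V} (hl : ε l = Submodule.span F {u}) (hu0 : u ≠ 0) (hu : χ u = 0)
    (hw : g (QuadraticMap.polar (veroneseMap E E') x y) = wedge u w)
    (huw : QuadraticMap.polar χ u w = 0) (hi : LinearIndependent F ![u, w₁])
    (hw₁ : χ w₁ = 0) (huw₁ : QuadraticMap.polar χ u w₁ = 0) :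
    QuadraticMap.polar χ w w₁ = 0 := by
  by_contra hne
  have hσ : Function.Surjective σ := RingHomSurjective.is_surjective
  have hcoef : ∀ a b d a' b' d' : F, g (a • veroneseMap E E' x + b • veroneseMap E E' y +
      d • QuadraticMap.polar (veroneseMap E E') x y) =
      g (a' • veroneseMap E E' x + b' • veroneseMap E E' y +
      d' • QuadraticMap.polar (veroneseMap E E') x y) → a = a' ∧ b = b' ∧ d = d' := by
    intro a b d a' b' d' heq
    have := hg (a - a') (b - b') (d - d') (by
      rw [← sub_eq_zero, ← map_sub] at heq
      rw [← heq]
      congr 1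
      module)
    simpa only [sub_eq_zero] using this
  -- If w is singular, the nucleus has the same image as a multiple of a conic point, against
  -- injectivity of g on the plane of the conic.
  by_cases hχw : χ w = 0
  · obtain ⟨z, hz, hz0, a, ha, hgz⟩ := h.exists_point hT hl
      (linearIndependent_of_polar hu0 huw₁ hne) hu hχw huw
    obtain ⟨s, t, rfl⟩ := Submodule.mem_span_pair.1 hz
    obtain ⟨k, rfl⟩ := hσ a
    rw [← hw, ← map_smulₛₗ, veroneseMap_combination] at hgz
    obtain ⟨h1, h3, -⟩ := hcoef _ _ _ 0 0 k (by rw [hgz]; congr 1; module)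
    apply hz0
    rw [pow_eq_zero_iff two_ne_zero] at h1 h3
    rw [h1, h3, zero_smul, zero_smul, add_zero]
  · obtain ⟨z, hz, hz0, a, ha, hgz⟩ := h.exists_point hT hl hi hu hw₁ huw₁
    -- This t gives the second singular vector w₁ + t w on the line through w₁ and w; both points
    -- come from the conic.
    set t := -QuadraticMap.polar χ w w₁ / χ w with ht
    have ht0 : t ≠ 0 := div_ne_zero (neg_ne_zero.2 hne) hχw
    have hw₂ : χ (w₁ + t • w) = 0 := by
      rw [QuadraticMap.map_add χ, hw₁, QuadraticMap.map_smul, QuadraticMap.polar_smul_right,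
        QuadraticMap.polar_comm χ w₁ w, ht]
      simp only [smul_eq_mul]; field_simp; ring
    have hne₂ : QuadraticMap.polar χ (w₁ + t • w) w₁ ≠ 0 := by
      rw [QuadraticMap.polar_add_left, QuadraticMap.polar_smul_left, QuadraticMap.polar_self, hw₁]
      simpa [ht0] using hne
    obtain ⟨z', hz', -, a', ha', hgz'⟩ := h.exists_point hT hl
      (linearIndependent_of_polar hu0 huw₁ hne₂) hu hw₂ (by
        rw [QuadraticMap.polar_add_right, QuadraticMap.polar_smul_right, huw, huw₁, smul_zero,
          add_zero])
    obtain ⟨k₁, hk₁⟩ := hσ (a' * a⁻¹)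
    obtain ⟨k₂, hk₂⟩ := hσ (a' * t)
    have hk₂0 : k₂ ≠ 0 := by
      rintro rfl
      rw [map_zero] at hk₂
      exact mul_ne_zero ha' ht0 hk₂.symm
    have heq : g (veroneseMap E E' z') = g (k₁ • veroneseMap E E' z +
        k₂ • QuadraticMap.polar (veroneseMap E E') x y) := by
      rw [map_add, map_smulₛₗ, map_smulₛₗ, hgz', hgz, hw, hk₁, hk₂, map_add, map_smul, smul_smul,
        mul_assoc, inv_mul_cancel₀ ha]
      module
    obtain ⟨s, r, rfl⟩ := Submodule.mem_span_pair.1 hz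
    obtain ⟨s', r', rfl⟩ := Submodule.mem_span_pair.1 hz'
    rw [veroneseMap_combination, veroneseMap_combination] at heq
    obtain ⟨h1, h3, h4⟩ := hcoef _ _ _ (k₁ * s ^ 2) (k₁ * r ^ 2) (k₁ * (s * r) + k₂)
      (by rw [heq]; congr 1; module)
    -- Both points satisfy Z² = XY, but they differ, after scaling, by k₂ in Z alone; in
    -- characteristic 2 this changes Z² by k₂².
    have : k₂ ^ 2 = 0 := by
      linear_combination (s' * r' + k₁ * (s * r) + k₂) * h4 - r' ^ 2 * h1 - k₁ * s ^ 2 * h3 +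
        (k₂ * k₁ * s * r + k₂ ^ 2) * h2
    exact hk₂0 (by simpa using this)

end Projection

/-! ### Images of the conic nuclei -/

section Kernel

variable {F : Type*} [Field F] {P : Type*} {Γ : PointLineGeometry P} {V V₀ : Type*}
  [AddCommGroup V] [Module F V] [AddCommGroup V₀] [Module F V₀]
  {χ : QuadraticForm F V} {ε : Γ.lines → Submodule F V} {E : Module.Basis (Fin 4) F V₀}
  {E' : Module.Basis {ij : Fin 4 × Fin 4 // ij.1 ≤ ij.2} F (SymSquare F V₀)}
  {α : LinearMap.BilinForm F V₀} {ε₀ : P → Submodule F V₀} {σ : F →+* F} [RingHomSurjective σ]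
  {g : SymSquare F V₀ →ₛₗ[σ] ⋀[F]^2 V}

theorem polar_eq_mul_polar_parabolicForm {b : Module.Basis (Fin 5) F V} {c : F}
    (hform : ∀ v : Fin 5 → F, χ (∑ i, v i • b i) = c * parabolic v) (v w : V) :
    QuadraticMap.polar χ v w =
      c * QuadraticMap.polar parabolicForm (b.equivFun v) (b.equivFun w) := by
  simp only [QuadraticMap.polar, apply_eq_parabolic b hform, map_add, parabolicForm_apply]
  ring

theorem span_pair_mem_isotropicLines (halt : α.IsAlt) {x y : V₀}
    (hi : LinearIndependent F ![x, y]) (h : α x y = 0) :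
    Submodule.span F {x, y} ∈ isotropicLines α := by
  have h' : α y x = 0 := by rw [← halt.neg_eq, h, neg_zero]
  refine ⟨finrank_eq_two_iff_span.2 ⟨x, y, hi, rfl⟩, fun u hu v hv => ?_⟩
  obtain ⟨a, b, rfl⟩ := Submodule.mem_span_pair.1 hu
  obtain ⟨c, d, rfl⟩ := Submodule.mem_span_pair.1 hv
  simp [h, h', halt.self_eq_zero]

theorem span_pair_eq_of_mem {T : Submodule F V₀} (hT : Module.finrank F T = 2) {x y : V₀}
    (hi : LinearIndependent F ![x, y]) (hx : x ∈ T) (hy : y ∈ T) :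
    Submodule.span F {x, y} = T := by
  have : Module.Finite F T := Module.finite_of_finrank_pos (by omega)
  refine Submodule.eq_of_le_of_finrank_eq (Submodule.span_le.2 ?_) ?_
  · rintro z (rfl | rfl) <;> assumption
  · rw [hT, finrank_eq_two_iff_span.2 ⟨x, y, hi, rfl⟩]

theorem polar_ne_zero {x y : V₀} (hi : LinearIndependent F ![x, y]) :
    QuadraticMap.polar (veroneseMap E E') x y ≠ 0 :=
  (linearIndependent_conic E E' hi).ne_zero 2

theorem exists_polar_eq_smul (h2 : (2 : F) = 0) {x y x' y' : V₀}
    (hi : LinearIndependent F ![x, y])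
    (h : Submodule.span F {x, y} = Submodule.span F {x', y'}) :
    ∃ k : F, k ≠ 0 ∧ QuadraticMap.polar (veroneseMap E E') x y =
      k • QuadraticMap.polar (veroneseMap E E') x' y' := by
  have hx : x ∈ Submodule.span F {x', y'} := by rw [← h]; exact Submodule.subset_span (by simp)
  have hy : y ∈ Submodule.span F {x', y'} := by rw [← h]; exact Submodule.subset_span (by simp)
  obtain ⟨a, b, rfl⟩ := Submodule.mem_span_pair.1 hx
  obtain ⟨c, d, rfl⟩ := Submodule.mem_span_pair.1 hy
  have hne := polar_ne_zero (E := E) (E' := E') hi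
  refine ⟨a * d - b * c, fun h0 => hne ?_, polar_combination E E' h2 x' y' a b c d⟩
  rw [polar_combination E E' h2, h0, zero_smul]

theorem wedgeDual_coord_zero (b : Module.Basis (Fin 5) F V) {i : Fin 5} (hi : i ≠ 0) (v : V) :
    wedgeDual (b.coord 0) (b.coord i) (wedge (b 0) v) = b.repr v i := by
  simp [hi]

/-- In a hyperbolic basis with first vector u, three points of the image conic determine g on the
conic plane. Tangency against b 2 and b 3, from `IsProjection.polar_eq_zero`, removes the components
along b 3 and b 2, leaving b 4, which is proportional to r. -/
theorem IsProjection.map_polar (h : IsProjection Γ χ ε E E' α ε₀ g) (h2 : (2 : F) = 0)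
    (hV : Module.finrank F V = 5) (hχ : IsNonsingular χ)
    (hW : ∃ U : Submodule F V, IsTotallySingular χ U ∧ Module.finrank F U = 2) {r : V}
    (hr0 : r ≠ 0) (hr : ∀ v, QuadraticMap.polar χ r v = 0) {x y : V₀}
    (hi : LinearIndependent F ![x, y]) (hα : α x y = 0) :
    ∃ (l : Γ.lines) (u : V) (d : F), u ≠ 0 ∧ χ u = 0 ∧ ε l = Submodule.span F {u} ∧ d ≠ 0 ∧
      ε₀ '' l.1 = projPoints (Submodule.span F {x, y}) ∧
      g (QuadraticMap.polar (veroneseMap E E') x y) = d • wedge u r := by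
  have hT := span_pair_mem_isotropicLines h.symplectic.isAlt hi hα
  obtain ⟨l, hl⟩ : ∃ l : Γ.lines, ε₀ '' l.1 = projPoints (Submodule.span F {x, y}) := by
    have : projPoints (Submodule.span F {x, y}) ∈ projPoints '' isotropicLines α := ⟨_, hT, rfl⟩
    rw [← h.symplectic.image.2] at this
    obtain ⟨l, hl, hl'⟩ := this
    exact ⟨⟨l, hl⟩, hl'⟩
  obtain ⟨u, hu0, hu, hlu⟩ := exists_singular_span_eq h.dualImage l
  obtain ⟨b, c, hc, rfl, hform⟩ := exists_hyperbolic_basis hV hχ hW hu0 hu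
  have happ := apply_eq_parabolic b hform
  have hpol := polar_eq_mul_polar_parabolicForm (χ := χ) hform
  have hi2 : LinearIndependent F ![b 0, b 2] :=
    linearIndependent_of_polar (χ := χ) (w' := b 3) hu0 (by simp [hpol, polar_parabolicForm])
      (by simp [hpol, polar_parabolicForm, hc])
  have hi3 : LinearIndependent F ![b 0, b 3] :=
    linearIndependent_of_polar (χ := χ) (w' := b 2) hu0 (by simp [hpol, polar_parabolicForm])
      (by simp [hpol, polar_parabolicForm, hc])
  -- The vector b 2 + b 3 + b 4 is singular since 1 · 1 - 1² = 0, and its b 4-component is what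
  -- makes g injective on the plane.
  have hi5 : LinearIndependent F ![b 0, b 2 + b 3 + b 4] :=
    linearIndependent_of_polar (χ := χ) (w' := b 2) hu0 (by simp [hpol, polar_parabolicForm])
      (by simp [hpol, polar_parabolicForm, hc, parabolicForm_apply, parabolic])
  have hs2 : χ (b 2) = 0 := by simp [happ, parabolic]
  have hs3 : χ (b 3) = 0 := by simp [happ, parabolic]
  have hp2 : QuadraticMap.polar χ (b 0) (b 2) = 0 := by simp [hpol, polar_parabolicForm]
  have hp3 : QuadraticMap.polar χ (b 0) (b 3) = 0 := by simp [hpol, polar_parabolicForm]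
  obtain ⟨z₁, hz₁, hz₁0, a₁, ha₁, hg₁⟩ := h.exists_point hl hlu hi2 hu hs2 hp2
  obtain ⟨z₂, hz₂, hz₂0, a₂, ha₂, hg₂⟩ := h.exists_point hl hlu hi3 hu hs3 hp3
  obtain ⟨z₃, hz₃, hz₃0, c₃, hc₃, hg₃⟩ := h.exists_point hl hlu hi5 hu
    (by simp [happ, parabolic]) (by simp [hpol, polar_parabolicForm])
  have hφ := fun (i : Fin 5) (hi : i ≠ 0) (v : V) => wedgeDual_coord_zero b hi v
  have hi12 : LinearIndependent F ![z₁, z₂] := by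
    rw [LinearIndependent.pair_iff' hz₁0]
    rintro k rfl
    rw [QuadraticMap.map_smul, map_smulₛₗ, hg₁] at hg₂
    have := congrArg (wedgeDual (b.coord 0) (b.coord 3)) hg₂
    simp only [map_smul, hφ 3 (by decide)] at this
    simp [ha₂, eq_comm] at this
  have hspan := span_pair_eq_of_mem hT.1 hi12 hz₁ hz₂
  rw [← hspan] at hz₃
  obtain ⟨s, t, rfl⟩ := Submodule.mem_span_pair.1 hz₃
  have hs : s ≠ 0 := by
    rintro rfl
    rw [zero_smul, zero_add, QuadraticMap.map_smul, map_smulₛₗ, hg₂] at hg₃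
    have := congrArg (wedgeDual (b.coord 0) (b.coord 2)) hg₃
    simp only [map_smul, hφ 2 (by decide)] at this
    simp [hc₃, eq_comm] at this
  have ht : t ≠ 0 := by
    rintro rfl
    rw [zero_smul, add_zero, QuadraticMap.map_smul, map_smulₛₗ, hg₁] at hg₃
    have := congrArg (wedgeDual (b.coord 0) (b.coord 3)) hg₃
    simp only [map_smul, hφ 3 (by decide)] at this
    simp [hc₃, eq_comm] at this
  -- After rescaling, the third point is the image of x' + y', so g of the polar value is a
  -- difference of three known images.
  obtain ⟨x', hx', c₁, hc₁, hgx'⟩ : ∃ x', x' = s • z₁ ∧ ∃ c₁ : F, c₁ ≠ 0 ∧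
      g (veroneseMap E E' x') = c₁ • wedge (b 0) (b 2) :=
    ⟨_, rfl, σ (s * s) * a₁, mul_ne_zero (by simp [hs]) ha₁, by
      rw [QuadraticMap.map_smul, map_smulₛₗ, hg₁, smul_smul]⟩
  obtain ⟨y', hy', c₂, hc₂, hgy'⟩ : ∃ y', y' = t • z₂ ∧ ∃ c₂ : F, c₂ ≠ 0 ∧
      g (veroneseMap E E' y') = c₂ • wedge (b 0) (b 3) :=
    ⟨_, rfl, σ (t * t) * a₂, mul_ne_zero (by simp [ht]) ha₂, by
      rw [QuadraticMap.map_smul, map_smulₛₗ, hg₂, smul_smul]⟩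
  rw [← hx', ← hy'] at hg₃
  have hi' : LinearIndependent F ![x', y'] := by
    rw [LinearIndependent.pair_iff] at hi12 ⊢
    intro p q hpq
    rw [hx', hy', smul_smul, smul_smul] at hpq
    simpa [hs, ht] using hi12 _ _ hpq
  have hspan' : Submodule.span F {x', y'} = Submodule.span F {x, y} :=
    span_pair_eq_of_mem hT.1 hi' (by rw [hx']; exact Submodule.smul_mem _ _ hz₁)
      (by rw [hy']; exact Submodule.smul_mem _ _ hz₂)
  have hgβ : g (QuadraticMap.polar (veroneseMap E E') x' y') =
      wedge (b 0) ((c₃ - c₁) • b 2 + (c₃ - c₂) • b 3 + c₃ • b 4) := by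
    rw [QuadraticMap.polar, map_sub, map_sub, hg₃, hgx', hgy']
    simp only [map_add, map_smul]
    module
  have hinj : ∀ p q d : F, g (p • veroneseMap E E' x' + q • veroneseMap E E' y' +
      d • QuadraticMap.polar (veroneseMap E E') x' y') = 0 → p = 0 ∧ q = 0 ∧ d = 0 := by
    intro p q d h0
    simp only [map_add, map_smulₛₗ, hgx', hgy', hgβ] at h0
    have e4 := congrArg (wedgeDual (b.coord 0) (b.coord 4)) h0
    have e3 := congrArg (wedgeDual (b.coord 0) (b.coord 3)) h0
    have e2 := congrArg (wedgeDual (b.coord 0) (b.coord 2)) h0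
    simp [hc₃] at e4
    simp [e4, hc₂] at e3
    simp [e4, hc₁] at e2
    exact ⟨e2, e3, e4⟩
  rw [← hspan'] at hl
  have htan := fun w₁ => h.polar_eq_zero h2 (w₁ := w₁) hl hinj hlu hu0 hu hgβ
    (by simp [hpol, polar_parabolicForm])
  have h23 := htan _ hi2 hs2 hp2
  have h32 := htan _ hi3 hs3 hp3
  simp [hpol, polar_parabolicForm, hc] at h23 h32
  obtain ⟨ρ, hρ⟩ : ∃ ρ, r = ρ • b 4 := by
    refine ⟨b.equivFun r 4, b.equivFun.injective ?_⟩
    conv_lhs => rw [eq_smul_single_of_polar_eq_zero (c := b.equivFun r) fun i _ => by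
      simpa [hpol, hc, Finsupp.single_eq_pi_single] using hr (b i)]
    simp [Finsupp.single_eq_pi_single]
  have hρ0 : ρ ≠ 0 := by
    rintro rfl
    exact hr0 (by rw [hρ, zero_smul])
  obtain ⟨k, hk, hk'⟩ := exists_polar_eq_smul (E := E) (E' := E') h2 hi hspan'.symm
  refine ⟨l, b 0, σ k * (c₃ * ρ⁻¹), hu0, hu, hlu, mul_ne_zero (by simpa using hk)
    (mul_ne_zero hc₃ (inv_ne_zero hρ0)), by rw [hl, hspan'], ?_⟩
  rw [hk', map_smulₛₗ, hgβ, h23, h32, hρ, map_smul, smul_smul, mul_assoc, mul_assoc,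
    inv_mul_cancel₀ hρ0, mul_one, zero_smul, zero_smul, zero_add, zero_add, map_smul, smul_smul]

end Kernel

/-! ### The kernel in characteristic 2 -/

section Main

variable {F : Type*} [Field F] {P : Type*} {Γ : PointLineGeometry P} {V V₀ : Type*}
  [AddCommGroup V] [Module F V] [AddCommGroup V₀] [Module F V₀]
  {χ : QuadraticForm F V} {ε : Γ.lines → Submodule F V} {E : Module.Basis (Fin 4) F V₀}
  {E' : Module.Basis {ij : Fin 4 × Fin 4 // ij.1 ≤ ij.2} F (SymSquare F V₀)}
  {α : LinearMap.BilinForm F V₀} {ε₀ : P → Submodule F V₀} {σ : F →+* F} [RingHomSurjective σ]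
  {g : SymSquare F V₀ →ₛₗ[σ] ⋀[F]^2 V}

theorem exists_isotropic_span_eq {T : Submodule F V₀}
    (hT : T ∈ isotropicLines α) :
    ∃ x y, LinearIndependent F ![x, y] ∧ α x y = 0 ∧ T = Submodule.span F {x, y} := by
  obtain ⟨x, y, hi, rfl⟩ := finrank_eq_two_iff_span.1 hT.1
  exact ⟨x, y, hi, hT.2 x (Submodule.subset_span (by simp)) y (Submodule.subset_span (by simp)),
    rfl⟩

theorem image_veroneseEmbedding {s : Set P} {T : Submodule F V₀} (h : ε₀ '' s = projPoints T) :
    veroneseEmbedding E E' ε₀ '' s =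
      {U | ∃ z ∈ T, z ≠ 0 ∧ U = Submodule.span F {veroneseMap E E' z}} := by
  ext U
  constructor
  · rintro ⟨p, hp, rfl⟩
    have h1 : ε₀ p ∈ projPoints T := by rw [← h]; exact ⟨p, hp, rfl⟩
    obtain ⟨z, hz, hz0, hpz⟩ := mem_projPoints_iff.1 h1
    exact ⟨z, hz, hz0, veroneseEmbedding_of_span E E' hpz⟩
  · rintro ⟨z, hz, hz0, rfl⟩
    have h1 : Submodule.span F {z} ∈ projPoints T := span_singleton_mem_projPoints hz0 hz
    rw [← h] at h1
    obtain ⟨p, hp, hpz⟩ := h1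
    exact ⟨p, hp, veroneseEmbedding_of_span E E' hpz⟩

theorem conicNuclei_eq_polarPoints (h2 : (2 : F) = 0) (h : IsSymplecticEmbedding Γ α ε₀) :
    conicNuclei Γ (veroneseEmbedding E E' ε₀) = polarPoints E E' α := by
  ext U
  constructor
  · rintro ⟨l, hl, hU⟩
    have : ε₀ '' l ∈ projPoints '' isotropicLines α := by
      rw [← h.image.2]; exact ⟨l, hl, rfl⟩
    obtain ⟨T, hT, hlT⟩ := this
    obtain ⟨x, y, hi, hα, rfl⟩ := exists_isotropic_span_eq hT
    rw [image_veroneseEmbedding hlT.symm] at hU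
    exact ⟨x, y, hi, hα, hU.unique (isNucleus_conic E E' h2 hi)⟩
  · rintro ⟨x, y, hi, hα, rfl⟩
    have : projPoints (Submodule.span F {x, y}) ∈ projPoints '' isotropicLines α :=
      ⟨_, span_pair_mem_isotropicLines h.isAlt hi hα, rfl⟩
    rw [← h.image.2] at this
    obtain ⟨l, hl, hlT⟩ := this
    refine ⟨l, hl, ?_⟩
    rw [image_veroneseEmbedding hlT]
    exact isNucleus_conic E E' h2 hi

theorem IsNonsingular.apply_ne_zero_of_polar (hχ : IsNonsingular χ) {r : V} (hr0 : r ≠ 0)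
    (hr : ∀ v, QuadraticMap.polar χ r v = 0) : χ r ≠ 0 := fun h =>
  let ⟨y, hy⟩ := hχ.exists_polar_ne_zero hr0 h
  hy (hr y)

/-- Equal images d u ∧ r = d' u' ∧ r give d u = d' u' + e r, and applying χ yields e² χ(r) = 0 with
χ(r) ≠ 0. So the two lines of Γ coincide, and the remaining scalar is 1. Equality of vectors, not
merely of points, is what `IsProjection.ker_eq` uses. -/
theorem IsProjection.injOn_polar (h : IsProjection Γ χ ε E E' α ε₀ g) (h2 : (2 : F) = 0)
    (hV : Module.finrank F V = 5) (hχ : IsNonsingular χ)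
    (hW : ∃ U : Submodule F V, IsTotallySingular χ U ∧ Module.finrank F U = 2) {r : V}
    (hr0 : r ≠ 0) (hr : ∀ v, QuadraticMap.polar χ r v = 0) {x y x' y' : V₀}
    (hi : LinearIndependent F ![x, y]) (hα : α x y = 0)
    (hi' : LinearIndependent F ![x', y']) (hα' : α x' y' = 0)
    (heq : g (QuadraticMap.polar (veroneseMap E E') x y) =
      g (QuadraticMap.polar (veroneseMap E E') x' y')) :
    QuadraticMap.polar (veroneseMap E E') x y = QuadraticMap.polar (veroneseMap E E') x' y' := by
  have hχr := hχ.apply_ne_zero_of_polar hr0 hr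
  have hr' : ∀ v, QuadraticMap.polar χ v r = 0 := fun v => by rw [QuadraticMap.polar_comm, hr]
  have hind : ∀ u, u ≠ 0 → χ u = 0 → LinearIndependent F ![u, r] := by
    intro u hu hu'
    rw [LinearIndependent.pair_iff' hu]
    rintro a rfl
    rw [QuadraticMap.map_smul, hu', smul_zero] at hχr
    exact hχr rfl
  obtain ⟨l, u, d, hu0, hu, hlu, hd, hl, hg⟩ := h.map_polar h2 hV hχ hW hr0 hr hi hα
  obtain ⟨l', u', d', hu0', hu', hlu', hd', hl', hg'⟩ := h.map_polar h2 hV hχ hW hr0 hr hi' hα'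
  have hw : wedge (F := F) r (d • u - d' • u') = 0 := by
    rw [wedge_swap, map_sub, LinearMap.sub_apply, map_smul, map_smul, LinearMap.smul_apply,
      LinearMap.smul_apply, ← hg, ← hg', heq, sub_self, neg_zero]
  obtain ⟨e, he⟩ := Submodule.mem_span_singleton.1 (mem_span_of_wedge_eq_zero hr0 hw)
  have he0 : e = 0 := by
    have h1 : d • u = d' • u' + e • r := by rw [he]; module
    have h3 := congrArg χ h1
    rw [QuadraticMap.map_add χ, QuadraticMap.map_smul, QuadraticMap.map_smul,
      QuadraticMap.map_smul, QuadraticMap.polar_smul_left, QuadraticMap.polar_smul_right, hr', hu,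
      hu'] at h3
    simpa [hχr] using h3
  rw [he0, zero_smul, eq_comm, sub_eq_zero] at he
  have hll : l = l' := by
    apply h.dualEmbedding.injective
    rw [hlu, hlu', ← Submodule.span_singleton_smul_eq (IsUnit.mk0 d hd) u, he,
      Submodule.span_singleton_smul_eq (IsUnit.mk0 d' hd')]
  rw [← hll, hl] at hl'
  obtain ⟨k, hk, hk'⟩ := exists_polar_eq_smul (E := E) (E' := E') h2 hi
    (projPoints_injective hl')
  rw [hk', map_smulₛₗ, hg'] at heq
  have hne : d' • wedge (F := F) u' r ≠ 0 := smul_ne_zero hd' (wedge_ne_zero (hind u' hu0' hu'))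
  have hσk : σ k = 1 := by
    have h1 : (σ k - 1) • d' • wedge (F := F) u' r = 0 :=
      (sub_smul _ _ _).trans (sub_eq_zero.2 (heq.trans (one_smul _ _).symm))
    exact sub_eq_zero.1 ((smul_eq_zero.1 h1).resolve_right hne)
  have hk1 : k = 1 := σ.injective (by rw [hσk, map_one])
  rw [hk', hk1, one_smul]

/-- A linear relation among the g (x i) lifts to the x i because σ is surjective. -/
theorem exists_ne_zero_map_sum_eq_zero {F M N : Type*} [Field F] [AddCommGroup M] [Module F M]
    [AddCommGroup N] [Module F N] {σ : F →+* F} [RingHomSurjective σ] (g : M →ₛₗ[σ] N)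
    {ι : Type*} [Fintype ι] {x : ι → M} {R : Submodule F N} [Module.Finite F R]
    (hx : ∀ i, g (x i) ∈ R) (hR : Module.finrank F R < Fintype.card ι) :
    ∃ c : ι → F, c ≠ 0 ∧ g (∑ i, c i • x i) = 0 := by
  by_contra! hcon
  have hli : LinearIndependent F fun i => (⟨g (x i), hx i⟩ : R) := by
    refine Fintype.linearIndependent_iff.2 fun a ha => ?_
    choose τ hτ using (RingHomSurjective.is_surjective : Function.Surjective σ)
    have h1 : g (∑ i, τ (a i) • x i) = 0 := by
      have := congrArg Subtype.val ha
      simpa [map_sum, map_smulₛₗ, hτ] using this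
    by_contra! hne
    obtain ⟨i, hi⟩ := hne
    refine hcon (fun i => τ (a i)) (fun h0 => hi ?_) h1
    rw [← hτ (a i), show τ (a i) = 0 from congrFun h0 i, map_zero]
  exact hR.not_ge hli.fintype_card_le_finrank

theorem IsProjection.ker_eq (h : IsProjection Γ χ ε E E' α ε₀ g) (h2 : (2 : F) = 0)
    (hV : Module.finrank F V = 5) (hχ : IsNonsingular χ)
    (hW : ∃ U : Submodule F V, IsTotallySingular χ U ∧ Module.finrank F U = 2) {r : V}
    (hr0 : r ≠ 0) (hr : ∀ v, QuadraticMap.polar χ r v = 0)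
    {e : Module.Basis (Fin 4) F V₀}
    (he : ∀ x y, α x y = omega (e.equivFun x) (e.equivFun y))
    (hker : Module.finrank F (LinearMap.ker g) = 1) :
    LinearMap.ker g = Submodule.span F {polarBasis E E' e 4} := by
  have hχr := hχ.apply_ne_zero_of_polar hr0 hr
  have hfin : Module.Finite F V := Module.finite_of_finrank_pos (by omega)
  have hli := linearIndependent_polarBasis E E' e
  have hgne : ∀ x y, LinearIndependent F ![x, y] → α x y = 0 →
      g (QuadraticMap.polar (veroneseMap E E') x y) ≠ 0 := by
    intro x y hi hα
    obtain ⟨l, u, d, hu0, hu, -, hd, -, hg⟩ := h.map_polar h2 hV hχ hW hr0 hr hi hα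
    rw [hg]
    refine smul_ne_zero hd (wedge_ne_zero ?_)
    rw [LinearIndependent.pair_iff' hu0]
    rintro a rfl
    rw [QuadraticMap.map_smul, hu, smul_zero] at hχr
    exact hχr rfl
  have hrange : ∀ i, g (polarBasis E E' e i) ∈ LinearMap.range (wedge (F := F) r) := by
    have hle : sSup (polarPoints E E' α) ≤ (LinearMap.range (wedge (F := F) r)).comap g := by
      refine sSup_le ?_
      rintro _ ⟨x, y, hi, hα, rfl⟩
      obtain ⟨l, u, d, -, -, -, -, -, hg⟩ := h.map_polar h2 hV hχ hW hr0 hr hi hα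
      rw [Submodule.span_singleton_le_iff_mem, Submodule.mem_comap, hg]
      exact ⟨-(d • u), by rw [map_neg, map_smul, wedge_swap u r, smul_neg, neg_neg]⟩
    rw [sSup_polarPoints E E' h2 he] at hle
    exact fun i => hle (Submodule.subset_span ⟨i, rfl⟩)
  -- Five vectors are mapped into r ∧ V, whose dimension is at most 4 because r ∧ r = 0.
  obtain ⟨c, hc0, hc⟩ : ∃ c : Fin 5 → F, c ≠ 0 ∧ g (∑ i, c i • polarBasis E E' e i) = 0 := by
    refine exists_ne_zero_map_sum_eq_zero g hrange ?_
    have h6 := LinearMap.finrank_range_add_finrank_ker (wedge (F := F) r)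
    have h7 : 0 < Module.finrank F (LinearMap.ker (wedge (F := F) r)) := by
      rw [Module.finrank_pos_iff]
      exact ⟨⟨⟨r, wedge_self r⟩, 0, fun h0 => hr0 (congrArg Subtype.val h0)⟩⟩
    rw [Fintype.card_fin]
    omega
  have hsum : ∀ c d : Fin 5 → F, ∑ i, (c + d) i • polarBasis E E' e i =
      ∑ i, c i • polarBasis E E' e i + ∑ i, d i • polarBasis E E' e i := fun c d => by
    simp [add_smul, Finset.sum_add_distrib]
  have hsmul : ∀ (t : F) (c : Fin 5 → F), ∑ i, (t • c) i • polarBasis E E' e i =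
      t • ∑ i, c i • polarBasis E E' e i := fun t c => by
    simp [Finset.smul_sum, smul_smul]
  -- A singular c would represent the nucleus of some conic, and those have nonzero image.
  have hqc : parabolicForm c ≠ 0 := by
    intro hq
    rw [parabolicForm_apply] at hq
    obtain ⟨x, y, hi, hα, hxy⟩ := exists_polar_eq_sum E E' h2 he hc0 hq
    exact hgne x y hi hα (by rw [hxy, hc])
  -- If c were not orthogonal to d, the line through them would contain a second singular vector d +
  -- t c with the same image as d, against `IsProjection.injOn_polar`.
  have hpolar : ∀ d : Fin 5 → F, d ≠ 0 → parabolic d = 0 →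
      QuadraticMap.polar parabolicForm c d = 0 := by
    intro d hd0 hd
    by_contra hne
    set t := -QuadraticMap.polar parabolicForm c d / parabolicForm c with ht
    have ht0 : t ≠ 0 := div_ne_zero (neg_ne_zero.2 hne) hqc
    have hq : parabolicForm (d + t • c) = 0 := by
      rw [QuadraticMap.map_add parabolicForm, parabolicForm_apply d, hd, QuadraticMap.map_smul,
        QuadraticMap.polar_smul_right, QuadraticMap.polar_comm _ d c, ht]
      simp only [smul_eq_mul]; field_simp; ring
    have hd0' : d + t • c ≠ 0 := by
      intro h0
      have h1 : d = (-t) • c := by rw [eq_neg_of_add_eq_zero_left h0, neg_smul]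
      rw [← parabolicForm_apply, h1, QuadraticMap.map_smul] at hd
      simp [ht0, hqc] at hd
    rw [parabolicForm_apply] at hq
    obtain ⟨x, y, hi, hα, hxy⟩ := exists_polar_eq_sum E E' h2 he hd0 hd
    obtain ⟨x', y', hi', hα', hxy'⟩ := exists_polar_eq_sum E E' h2 he hd0' hq
    have heq := h.injOn_polar h2 hV hχ hW hr0 hr hi hα hi' hα' (by
      rw [hxy, hxy', hsum, hsmul, map_add, map_smulₛₗ, hc, smul_zero, add_zero])
    rw [hxy, hxy', hsum, hsmul, left_eq_add, smul_eq_zero, or_iff_right ht0] at heq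
    exact hc0 (hli.fintypeLinearCombination_injective (a₁ := c) (a₂ := 0)
      (by simpa [Fintype.linearCombination_apply] using heq))
  have hc4 := eq_smul_single_of_polar_eq_zero (c := c) fun i hi =>
    hpolar _ (by simp) (by fin_cases i <;> simp_all [parabolic])
  have hc4' : c 4 ≠ 0 := fun h0 => hc0 (by rw [hc4, h0, zero_smul])
  have hmem : polarBasis E E' e 4 ∈ LinearMap.ker g := by
    rw [hc4, hsmul, map_smulₛₗ, smul_eq_zero, or_iff_right (by simpa using hc4')] at hc
    simpa [Pi.single_apply] using hc
  have hfin' : Module.Finite F (LinearMap.ker g) := Module.finite_of_finrank_pos (by omega)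
  refine (Submodule.eq_of_le_of_finrank_eq ?_ ?_).symm
  · rwa [Submodule.span_singleton_le_iff_mem]
  · rw [hker, finrank_span_singleton (hli.ne_zero 4)]

theorem exists_polar_radical (h2 : (2 : F) = 0) (hV : Module.finrank F V = 5)
    (hχ : IsNonsingular χ)
    (hW : ∃ U : Submodule F V, IsTotallySingular χ U ∧ Module.finrank F U = 2) :
    ∃ r, r ≠ 0 ∧ ∀ v, QuadraticMap.polar χ r v = 0 := by
  obtain ⟨U, hU, hU2⟩ := hW
  obtain ⟨v, w, hi, rfl⟩ := finrank_eq_two_iff_span.1 hU2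
  obtain ⟨b, c, hc, -, hform⟩ := exists_hyperbolic_basis hV hχ ⟨_, hU, hU2⟩ (hi.ne_zero 0)
    (hU v (Submodule.subset_span (by simp)))
  refine ⟨b 4, b.ne_zero 4, fun v => ?_⟩
  rw [polar_eq_mul_polar_parabolicForm hform, polar_parabolicForm, h2]
  simp

end Main

end GrassmannVeronese

/-! ### The proposition -/

open GrassmannVeronese in
theorem proposition4p1 {F : Type*} [Field F] {P : Type*} (Γ : PointLineGeometry P)
    (hΓ : IsSymplecticQuadrangle F Γ)
    {V : Type*} [AddCommGroup V] [Module F V] (hV : Module.finrank F V = 5)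
    (χ : QuadraticForm F V) (hχ : IsNonsingular χ) (hχ2 : HasWittIndex χ 2)
    (ε : Γ.lines → Submodule F V) (hε : IsProjectiveEmbedding Γ.dual ε)
    (hεχ : HasImage Γ.dual ε (singularPoints χ) (singularLines χ))
    {V₀ : Type*} [AddCommGroup V₀] [Module F V₀] (E : Module.Basis (Fin 4) F V₀)
    (E' : Module.Basis {ij : Fin 4 × Fin 4 // ij.1 ≤ ij.2} F (SymSquare F V₀)) :
    -- a projective embedding of `Γ` and a linear projection exist
    (∃ (α : LinearMap.BilinForm F V₀) (ε₀ : P → Submodule F V₀)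
      (π : (sSup (Set.range (veroneseEmbedding E E' ε₀)) : Submodule F (SymSquare F V₀)) →ₗ[F]
        (sSup (Set.range (grassmannEmbedding Γ ε)) : Submodule F (⋀[F]^2 V))),
      IsSymplecticEmbedding Γ α ε₀ ∧
        IsMorphism (veroneseEmbedding E E' ε₀) (grassmannEmbedding Γ ε) π) ∧
    -- every projection has the required properties
    ∀ (α : LinearMap.BilinForm F V₀) (ε₀ : P → Submodule F V₀),
      IsSymplecticEmbedding Γ α ε₀ →
      ∀ (σ : F →+* F) [RingHomSurjective σ]
        (π : (sSup (Set.range (veroneseEmbedding E E' ε₀)) : Submodule F (SymSquare F V₀)) →ₛₗ[σ]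
          (sSup (Set.range (grassmannEmbedding Γ ε)) : Submodule F (⋀[F]^2 V))),
        IsMorphism (veroneseEmbedding E E' ε₀) (grassmannEmbedding Γ ε) π →
        (ringChar F ≠ 2 → Function.Bijective π) ∧
        (ringChar F = 2 →
          Module.finrank F (LinearMap.ker π) = 1 ∧
          ∀ N : Submodule F (SymSquare F V₀),
            IsNucleus (conicNuclei Γ (veroneseEmbedding E E' ε₀)) N ↔
              N = (LinearMap.ker π).map
                (sSup (Set.range (veroneseEmbedding E E' ε₀))).subtype) := by
  obtain ⟨b, c, hc, hform⟩ : ∃ (b : Module.Basis (Fin 5) F V) (c : F), c ≠ 0 ∧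
      ∀ v : Fin 5 → F, χ (∑ i, v i • b i) = c * parabolic v := by
    obtain ⟨U, hU, hU2⟩ := hχ2.1
    obtain ⟨v, w, hi, rfl⟩ := finrank_eq_two_iff_span.1 hU2
    obtain ⟨b, c, hc, -, hform⟩ := exists_hyperbolic_basis hV hχ hχ2.1 (hi.ne_zero 0)
      (hU v (Submodule.subset_span (by simp)))
    exact ⟨b, c, hc, hform⟩
  obtain ⟨ε₁, hε₁, hmap⟩ := exists_symplecticEmbedding hΓ hε hεχ b hc hform E E'
  have hS := finrank_symSquare E'
  have hfinS : Module.Finite F (SymSquare F V₀) := Module.Finite.of_basis E'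
  have htop : ∀ {α : LinearMap.BilinForm F V₀} {ε₀ : P → Submodule F V₀},
      IsSymplecticEmbedding Γ α ε₀ → sSup (Set.range (veroneseEmbedding E E' ε₀)) = ⊤ :=
    fun h => sSup_range_veroneseEmbedding E E' fun x hx => h.exists_point hx
  refine ⟨?_, ?_⟩
  · obtain ⟨π, hπ⟩ := exists_isMorphism_of_map (symToWedge b E') hmap
    exact ⟨standardAlt E, ε₁, π, hε₁, hπ⟩
  · intro α ε₀ h σ _ π hπ
    obtain ⟨g, hgπ, hg⟩ := hπ.exists_extension (htop h)
    have hproj : IsProjection Γ χ ε E E' α ε₀ g := ⟨hε, hεχ, h, hg⟩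
    -- Both maps are defined on the whole symmetrized square and have range ⟨ε^gr(P)⟩, whatever ε₀
    -- and σ are.
    have hkerdim : Module.finrank F (LinearMap.ker g) =
        Module.finrank F (LinearMap.ker (symToWedge b E')) := by
      have h1 := finrank_ker_add_finrank_range_semilinear g
      have h3 := LinearMap.finrank_range_add_finrank_ker (symToWedge b E')
      rw [range_eq_sSup_of_map hg (htop h)] at h1
      rw [range_eq_sSup_of_map hmap (htop hε₁)] at h3
      omega
    have hker : (LinearMap.ker π).map (sSup (Set.range (veroneseEmbedding E E' ε₀))).subtype =
        LinearMap.ker g := by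
      ext t
      constructor
      · rintro ⟨x, hx, rfl⟩
        rw [LinearMap.mem_ker, Submodule.subtype_apply, hgπ, LinearMap.mem_ker.1 hx]
        rfl
      · intro ht
        have htm : t ∈ sSup (Set.range (veroneseEmbedding E E' ε₀)) := by rw [htop h]; trivial
        refine ⟨⟨t, htm⟩, ?_, rfl⟩
        rw [SetLike.mem_coe, LinearMap.mem_ker]
        exact Subtype.ext ((hgπ ⟨t, htm⟩).symm.trans ht)
    constructor
    · intro hchar
      have h2 : (2 : F) ≠ 0 := Ring.two_ne_zero hchar
      have h0 : LinearMap.ker g = ⊥ := by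
        rw [← Submodule.finrank_eq_zero (R := F), hkerdim,
          LinearMap.ker_eq_bot.2 (symToWedge_injective b E' h2), finrank_bot]
      have hinj : LinearMap.ker π = ⊥ := by
        rw [← Submodule.finrank_eq_zero (R := F), ← Submodule.finrank_map_subtype_eq, hker, h0,
          finrank_bot]
      refine ⟨(injective_iff_map_eq_zero π).2 fun x hx => (Submodule.eq_bot_iff _).1 hinj x hx,
        fun w => ?_⟩
      obtain ⟨t, ht⟩ := (range_eq_sSup_of_map hg (htop h)).ge w.2
      have htm : t ∈ sSup (Set.range (veroneseEmbedding E E' ε₀)) := by rw [htop h]; trivial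
      exact ⟨⟨t, htm⟩, Subtype.ext ((hgπ ⟨t, htm⟩).symm.trans ht)⟩
    · intro hchar
      have h2 : (2 : F) = 0 := by
        have := ringChar.Nat.cast_ringChar (R := F)
        rwa [hchar, Nat.cast_ofNat] at this
      have hker1 : Module.finrank F (LinearMap.ker g) = 1 := by
        rw [hkerdim, finrank_ker_symToWedge b E' h2]
      obtain ⟨r, hr0, hr⟩ := exists_polar_radical h2 hV hχ hχ2.1
      obtain ⟨e, he⟩ := exists_symplectic_basis (by simp [Module.finrank_eq_card_basis E])
        h.isAlt h.nondegenerate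
      have hkereq := hproj.ker_eq h2 hV hχ hχ2.1 hr0 hr he hker1
      have hnuc := isNucleus_polarPoints E E' h2 he
      refine ⟨?_, fun N => ?_⟩
      · rw [← hker1, ← hker, Submodule.finrank_map_subtype_eq]
      · rw [hker, hkereq, conicNuclei_eq_polarPoints h2 h]
        -- Existence of the nucleus gives one direction, its uniqueness the other.
        exact ⟨fun hN => hN.unique hnuc, fun hN => hN ▸ hnuc⟩
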